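/- Let $\Bbbk$ be an algebraically closed field of characteristic $0$, let $n\ge 2$, let $V=\Bbbk^{2n}$ with basis $v_1,\dots,v_{2n}$, dual basis $x_1,\dots,x_{2n}$ and symplectic form $\langle v,w\rangle={}^t v\begin{pmatrix}0&I\\-I&0\end{pmatrix}w$, and let $G=Sp_{2n}(\Bbbk)$. Let $X=SpGr(2,V)$ be the variety of isotropic planes in $V$, let $V_2=\langle v_1,v_2\rangle$ and let $P\subset G$ be the stabilizer of $V_2$, so that $X\cong G/P$. Let $S$ be the tautological bundle on $X$, with fibre $W$ at $W\in X$, and $S^\perp$ the bundle with fibre $(V/W)^*$. Let $\Lambda=\bigwedge^\bullet(V_2\otimes (V/V_2)^*)$, let $\eta=\sum_{i=1}^n x_i\otimes x_{n+i}\in V^*\otimes (V/V_2)^*$, and let $\Lambda[T]$ be the polynomial ring in a central variable $T$ of degree $2$ that stands for $(v_1\wedge v_2)\boxtimes\eta$. Let $P\times P$ act on $\Lambda[T]$ by algebra automorphisms: naturally on $\Lambda$ (the first factor on $V_2$, the second on $(V/V_2)^*$), and by $$(p,q)\cdot T=\det(p|_{V_2})\,T+(pv_1\wedge pv_2)\boxtimes(q\eta-\eta),$$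 where $q\eta-\eta\in \mathrm{Sym}_2 (V/V_2)^*$ and $\bigwedge^2V_2\boxtimes \mathrm{Sym}_2(V/V_2)^*\subset\Lambda_2$ via $(v\wedge w)\boxtimes(f\otimes g+g\otimes f)\mapsto (v\otimes f)\wedge(w\otimes g)+(v\otimes g)\wedge(w\otimes f)$. Let $M_k=\bigoplus_{i\ge0}\Lambda_{k-2i}T^i$ be the part of degree $k$, and let $\Phi_k=(G\times G)\times_{P\times P}M_k$ be the corresponding homogeneous vector bundle on $X\times X$; thus $\Phi_0=\mathcal O_{X\times X}$ and $\Phi_1=S\boxtimes S^\perp$. In the fibre over $(gP,hP)$ let $$d(v\otimes f)=(h f)(g v),\qquad d(T)=t:=\sum_{i=1}^n\bigl((h x_i)(gv_1)\,v_2-(h x_i)(gv_2)\,v_1\bigr)\otimes x_{n+i},$$ extended by $d(wT^i)=(dw)\,T^i+(-1)^{|w|}\,i\,w\,t\,T^{i-1}$, where on $\Lambda$ the map $d$ is the Koszul differential, i.e. the skew derivation given by $v\otimes f\mapsto (hf)(gv)$. So $D_\bullet$ arises from the Koszul complex $\bigwedge^\bullet(S\boxtimes S^\perp)$ on $X\times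 X$ by adjoining the variable $T$ of degree $2$ with $dT=t$. **Theorem 2.19.** The maps $d$ are well-defined maps of sheaves $\Phi_k\to\Phi_{k-1}$ with $d^2=0$, and the complex $$D_\bullet:\ \cdots\to\Phi_k\xrightarrow{d}\Phi_{k-1}\xrightarrow{d}\cdots\xrightarrow{d}\Phi_2\xrightarrow{d}S\boxtimes S^\perp\xrightarrow{d}\mathcal O_{X\times X}$$ is a left resolution of the structure sheaf $\mathcal O_\Delta$ of the diagonal $\Delta\subset X\times X$: the sequence of sheaves $\cdots\to\Phi_2\to\Phi_1\to\mathcal O_{X\times X}\to\mathcal O_\Delta\to0$, in which the last non-zero map is the restriction of functions to $\Delta$, is exact. Moreover $\Phi_k\ne0$ for every $k\ge 0$, so the resolution does not terminate. -/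

import Mathlib

open scoped TensorProduct

noncomputable section

namespace SymplecticDiagonal

/-! ### The symplectic space, the symplectic group and the isotropic Grassmannian

Throughout, `n = m + 2` and `N = 2 * n`, so that isotropic planes exist. The basis
`v_1, …, v_n, v_{n+1}, …, v_{2n}` is indexed by `Fin (m+2) ⊕ Fin (m+2)`. -/

section Space

variable (k : Type*) [Field k] (m : ℕ)

/-- Indices `1, …, n` (left) and `n+1, …, 2n` (right) of the symplectic basis. -/
abbrev Idx : Type := Fin (m + 2) ⊕ Fin (m + 2)

/-- The vector space `V = k^{2n}`. -/
abbrev V : Type _ := Idx m → k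

/-- The dual space `V^*`. -/
abbrev VDual : Type _ := Module.Dual k (V k m)

/-- The symplectic group `G = Sp_{2n}(k)`. -/
abbrev G : Type _ := ↥(Matrix.symplecticGroup (Fin (m + 2)) k)

variable {k m}

/-- The basis vectors `v_a` of `V`. -/
def vec (a : Idx m) : V k m := Pi.single a 1

/-- The dual basis vectors `x_a` of `V^*`. -/
def covec (a : Idx m) : VDual k m := LinearMap.proj a

/-- The symplectic form `⟨v, w⟩ = ᵗv J w` with `J = [[0, I], [-I, 0]]`
(Mathlib's `Matrix.J` is the negative of this matrix). -/
def form (v w : V k m) : k := dotProduct v ((-(Matrix.J (Fin (m + 2)) k)).mulVec w)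

/-- The action of `G` on `V`. -/
def act (g : G k m) : V k m →ₗ[k] V k m := Matrix.mulVecLin (g : Matrix (Idx m) (Idx m) k)

/-- The contragredient action of `G` on `V^*`: `(h · f)(v) = f (h⁻¹ v)`. -/
def coact (h : G k m) : VDual k m →ₗ[k] VDual k m := (act h⁻¹).dualMap

variable (k m)

/-- The isotropic plane `V_2 = Span {v_1, v_2}`. -/
def V2 : Submodule k (V k m) := Submodule.span k {vec (Sum.inl 0), vec (Sum.inl 1)}

/-- `(V/V_2)^*`, as the space of linear forms on `V` that vanish on `V_2`. -/
def L : Submodule k (VDual k m) := (V2 k m).dualAnnihilator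

/-- The set `X = SpGr(2,V)` of isotropic planes in `V`. -/
def SpGr : Type _ :=
  {W : Submodule k (V k m) // Module.finrank k W = 2 ∧ ∀ v ∈ W, ∀ w ∈ W, form v w = 0}

variable {k m}

lemma act_mul (g h : G k m) : act (g * h) = act g ∘ₗ act h := by
  simp [act, Matrix.mulVecLin_mul]

lemma act_one : act (1 : G k m) = LinearMap.id := by
  simp [act]

lemma act_injective (g : G k m) : Function.Injective (act g) := by
  have h : act g⁻¹ ∘ₗ act g = LinearMap.id := by rw [← act_mul, inv_mul_cancel, act_one]
  intro a b hab
  have := congrArg (act g⁻¹) hab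
  simpa [← LinearMap.comp_apply, h] using this

lemma form_act (g : G k m) (v w : V k m) : form (act g v) (act g w) = form v w := by
  have hg := SymplecticGroup.mem_iff'.1 g.2
  simp only [form, act, Matrix.mulVecLin_apply, Matrix.neg_mulVec, dotProduct_neg, neg_inj]
  conv_rhs => rw [← hg]
  simp only [← Matrix.mulVec_mulVec, Matrix.dotProduct_mulVec, Matrix.vecMul_transpose]

lemma form_vec_inl (a b : Fin (m + 2)) :
    form (vec (Sum.inl a) : V k m) (vec (Sum.inl b)) = 0 := by
  simp [form, vec, Matrix.J]

lemma finrank_V2 : Module.finrank k (V2 k m) = 2 := by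
  have hli : LinearIndependent k ![(vec (Sum.inl 0) : V k m), vec (Sum.inl 1)] := by
    rw [LinearIndependent.pair_iff]
    intro s t h
    have h0 := congrFun h (Sum.inl 0)
    have h1 := congrFun h (Sum.inl 1)
    simp [vec] at h0 h1
    exact ⟨h0, h1⟩
  have h := finrank_span_eq_card hli
  rwa [Matrix.range_cons_cons_empty, Fintype.card_fin] at h

lemma form_V2 (v : V k m) (hv : v ∈ V2 k m) (w : V k m) (hw : w ∈ V2 k m) : form v w = 0 := by
  rw [V2, Submodule.mem_span_pair] at hv hw
  obtain ⟨a, b, rfl⟩ := hv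
  obtain ⟨c, d, rfl⟩ := hw
  have h := form_vec_inl (k := k) (m := m)
  simp only [form] at h
  simp [form, Matrix.mulVec_add, Matrix.mulVec_smul, add_dotProduct, dotProduct_add, h]

/-- The orbit map `G → X`, `g ↦ g V_2`, which identifies `G/P` with `X`. -/
def orbit (g : G k m) : SpGr k m :=
  ⟨(V2 k m).map (act g), by
    rw [← (Submodule.equivMapOfInjective _ (act_injective g) _).finrank_eq, finrank_V2], by
    rintro _ ⟨v, hv, rfl⟩ _ ⟨w, hw, rfl⟩
    rw [form_act]
    exact form_V2 v hv w hw⟩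

/-! The orbit map is surjective (Witt's theorem for isotropic planes), so that `X = G/P`. -/

lemma form_add_left (u v w : V k m) : form (u + v) w = form u w + form v w := by
  simp [form, add_dotProduct]

lemma form_add_right (u v w : V k m) : form u (v + w) = form u v + form u w := by
  simp [form, Matrix.mulVec_add, dotProduct_add]

lemma form_smul_left (c : k) (v w : V k m) : form (c • v) w = c * form v w := by
  simp [form]

lemma form_smul_right (c : k) (v w : V k m) : form v (c • w) = c * form v w := by
  simp [form, Matrix.mulVec_smul]

lemma form_swap (v w : V k m) : form w v = - form v w := by
  have hJ : (Matrix.J (Fin (m + 2)) k).transpose = - Matrix.J (Fin (m + 2)) k :=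
    Matrix.J_transpose _ _
  simp only [form]
  rw [Matrix.dotProduct_mulVec, ← Matrix.mulVec_transpose, Matrix.transpose_neg, hJ, neg_neg,
    dotProduct_comm]
  simp [Matrix.neg_mulVec]

lemma form_self (v : V k m) : form v v = 0 := by
  simp [form, Matrix.J, dotProduct, Matrix.mulVec, Matrix.fromBlocks,
    Fintype.sum_sum_type, Matrix.one_apply, mul_comm]

lemma eq_zero_of_form (v : V k m) (h : ∀ w, form v w = 0) : v = 0 := by
  have hJ : IsUnit (-(Matrix.J (Fin (m + 2)) k)) :=
    ((Matrix.isUnit_iff_isUnit_det _).2 (Matrix.isUnit_det_J _ _)).neg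
  refine dotProduct_eq_zero v fun w => ?_
  obtain ⟨u, rfl⟩ := (Matrix.mulVec_surjective_iff_isUnit.2 hJ) w
  exact h u

lemma exists_act_eq (f : V k m →ₗ[k] V k m) (hf : ∀ v w, form (f v) (f w) = form v w) :
    ∃ g : G k m, act g = f := by
  refine ⟨⟨LinearMap.toMatrix' f, SymplecticGroup.mem_iff'.2 ?_⟩, ?_⟩
  · rw [← neg_inj, ← Matrix.neg_mul, ← Matrix.mul_neg]
    refine Matrix.ext_of_mulVec_single fun b => ?_
    refine dotProduct_eq _ _ fun a => ?_
    have := hf a (Pi.single b 1)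
    simp only [form] at this
    rw [dotProduct_comm, ← Matrix.mulVec_mulVec, ← Matrix.mulVec_mulVec, Matrix.dotProduct_mulVec,
      Matrix.vecMul_transpose, LinearMap.toMatrix'_mulVec, LinearMap.toMatrix'_mulVec, this,
      dotProduct_comm]
  · simp [act, ← Matrix.toLin'_apply']

lemma exists_transvection (v w : V k m) (h : form v w ≠ 0) :
    ∃ g : G k m, act g v = w ∧ ∀ z, form z v = form z w → act g z = z := by
  let f : V k m →ₗ[k] V k m :=
    { toFun := fun x => x + ((form v w)⁻¹ * form x (w - v)) • (w - v)
      map_add' := fun x y => by rw [form_add_left]; module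
      map_smul' := fun c x => by rw [form_smul_left, RingHom.id_apply]; module }
  have hsub : ∀ x, form x (w - v) = form x w - form x v := fun x => by
    rw [sub_eq_add_neg, form_add_right, ← neg_one_smul k v, form_smul_right]; ring
  obtain ⟨g, hg⟩ := exists_act_eq f fun x y => by
    change form (x + _ • (w - v)) (y + _ • (w - v)) = _
    simp only [form_add_left, form_add_right, form_smul_left, form_smul_right, form_self]
    rw [form_swap y (w - v)]
    ring
  refine ⟨g, ?_, fun z hz => ?_⟩
  · rw [hg]
    change v + _ • (w - v) = w
    rw [hsub, form_self, sub_zero, inv_mul_cancel₀ h, one_smul, add_sub_cancel]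
  · rw [hg]
    change z + _ • (w - v) = z
    rw [hsub, hz, sub_self, mul_zero, zero_smul, add_zero]

lemma exists_form_ne (z v : V k m) (hv : ∀ c : k, v ≠ c • z) :
    ∃ y, form z y = 0 ∧ form v y ≠ 0 := by
  by_contra! hcon
  by_cases hz : ∃ u, form z u ≠ 0
  · obtain ⟨u, hu⟩ := hz
    refine hv (form v u * (form z u)⁻¹) (sub_eq_zero.1 (eq_zero_of_form _ fun w => ?_))
    have h1 : form z (w + (-(form z w * (form z u)⁻¹)) • u) = 0 := by
      rw [form_add_right, form_smul_right]; field_simp; ring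
    have h2 := hcon _ h1
    rw [form_add_right, form_smul_right] at h2
    rw [sub_eq_add_neg, ← neg_smul, form_add_left, form_smul_left]
    linear_combination h2
  · push Not at hz
    exact hv 0 (by rw [zero_smul]; exact eq_zero_of_form v fun w => hcon w (hz w))

lemma exists_move (z v w : V k m) (hzv : form z v = 0) (hzw : form z w = 0)
    (hv : ∀ c : k, v ≠ c • z) (hw : ∀ c : k, w ≠ c • z) :
    ∃ g : G k m, act g z = z ∧ act g v = w := by
  have key : ∃ y, form z y = 0 ∧ form v y ≠ 0 ∧ form w y ≠ 0 := by
    obtain ⟨y₁, h₁, h₁'⟩ := exists_form_ne z v hv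
    obtain ⟨y₂, h₂, h₂'⟩ := exists_form_ne z w hw
    by_cases ha : form w y₁ = 0
    · by_cases hb : form v y₂ = 0
      · refine ⟨y₁ + y₂, ?_, ?_, ?_⟩
        · rw [form_add_right, h₁, h₂, add_zero]
        · rwa [form_add_right, hb, add_zero]
        · rwa [form_add_right, ha, zero_add]
      · exact ⟨y₂, h₂, hb, h₂'⟩
    · exact ⟨y₁, h₁, h₁', ha⟩
  obtain ⟨y, hzy, hvy, hwy⟩ := key
  obtain ⟨g, hg, hg'⟩ := exists_transvection v y hvy
  obtain ⟨h, hh, hh'⟩ := exists_transvection y w (by rw [form_swap]; exact neg_ne_zero.2 hwy)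
  refine ⟨h * g, ?_, ?_⟩
  · rw [act_mul, LinearMap.comp_apply, hg' z (by rw [hzv, hzy]), hh' z (by rw [hzy, hzw])]
  · rw [act_mul, LinearMap.comp_apply, hg, hh]

lemma orbit_surjective : Function.Surjective (orbit (k := k) (m := m)) := by
  rintro ⟨W, hW, hiso⟩
  obtain ⟨b⟩ : Nonempty (Module.Basis (Fin 2) k W) :=
    have : Module.Finite k W := Module.finite_of_finrank_eq_succ hW
    ⟨(Module.finBasisOfFinrankEq k W hW)⟩
  have hli : LinearIndependent k ![(b 0 : V k m), (b 1 : V k m)] := by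
    have := b.linearIndependent.map' W.subtype (Submodule.ker_subtype W)
    have e : (W.subtype ∘ b) = ![(b 0 : V k m), (b 1 : V k m)] := by
      funext i
      fin_cases i <;> rfl
    rwa [e] at this
  rw [LinearIndependent.pair_iff] at hli
  have hv1 : (vec (Sum.inl 0) : V k m) ≠ 0 := fun h => by
    have := congrFun h (Sum.inl 0)
    simp [vec] at this
  obtain ⟨g, -, hg⟩ := exists_move (0 : V k m) (vec (Sum.inl 0)) (b 0 : V k m)
    (by simp [form]) (by simp [form]) (fun c => by simpa using hv1)
    (fun c h => by
      have := hli 1 0 (by rw [h]; simp)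
      exact one_ne_zero this.1)
  obtain ⟨h, hh, hh'⟩ := exists_move (b 0 : V k m) (act g (vec (Sum.inl 1))) (b 1 : V k m)
    (by rw [← hg, form_act, form_vec_inl]) (hiso _ (b 0).2 _ (b 1).2)
    (fun c hc => by
      rw [← hg, ← map_smul] at hc
      have := congrFun (act_injective g hc) (Sum.inl 1)
      simp [vec] at this)
    (fun c hc => by
      have := hli (-c) 1 (by rw [hc]; module)
      exact one_ne_zero this.2)
  refine ⟨h * g, Subtype.ext ?_⟩
  have hle : (V2 k m).map (act (h * g)) ≤ W := by
    rw [V2, Submodule.map_span, Submodule.span_le, Set.image_pair, act_mul]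
    simp only [LinearMap.comp_apply, hg, hh, hh']
    rintro x (rfl | rfl)
    · exact (b 0).2
    · exact (b 1).2
  have : Module.Finite k W := Module.finite_of_finrank_eq_succ hW
  refine Submodule.eq_of_le_of_finrank_eq hle ?_
  rw [hW]
  exact (orbit (h * g)).2.1

variable (k m)

/-- The parabolic subgroup `P ⊂ G` (as a set): the stabilizer of `V_2`. -/
def P : Set (G k m) := {p | (V2 k m).map (act p) = V2 k m}

end Space

/-! ### The algebra `Λ[T]`, the representations `M_j` and the action of `P × P`

Everything takes place in the polynomial algebra `Λ(V ⊗ V^*)[T]`, where the central variable `T`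
of degree `2` stands for `(v_1 ∧ v_2) ⊠ η`. -/

section Algebra

variable (k : Type*) [Field k] (m : ℕ)

/-- The exterior algebra `Λ(V ⊗ V^*)`. -/
abbrev Ext : Type _ := ExteriorAlgebra k (V k m ⊗[k] VDual k m)

/-- The algebra `Λ(V ⊗ V^*)[T]`. -/
abbrev ExtT : Type _ := Polynomial (Ext k m)

/-- The subspace `Λ^j (V_2 ⊗ (V/V_2)^*)` of `Λ(V ⊗ V^*)`. -/
def LambdaPart (j : ℕ) : Submodule k (Ext k m) :=
  (Submodule.map (ExteriorAlgebra.ι k)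
    (Submodule.map₂ (TensorProduct.mk k (V k m) (VDual k m)) (V2 k m) (L k m))) ^ j

/-- `M_j = ⨁_i Λ^{j-2i} (V_2 ⊗ (V/V_2)^*) T^i`, the fibre of the bundle `Φ_j`. -/
def M (j : ℕ) : Submodule k (ExtT k m) where
  carrier := {a | ∀ i, (2 * i ≤ j → a.coeff i ∈ LambdaPart k m (j - 2 * i)) ∧
    (j < 2 * i → a.coeff i = 0)}
  zero_mem' := fun i => by simp
  add_mem' := fun {a b} ha hb i => by
    refine ⟨fun h => ?_, fun h => ?_⟩
    · rw [Polynomial.coeff_add]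
      exact add_mem ((ha i).1 h) ((hb i).1 h)
    · rw [Polynomial.coeff_add, (ha i).2 h, (hb i).2 h, add_zero]
  smul_mem' := fun c a ha i => by
    refine ⟨fun h => ?_, fun h => ?_⟩
    · rw [Polynomial.coeff_smul]
      exact Submodule.smul_mem _ _ ((ha i).1 h)
    · rw [Polynomial.coeff_smul, (ha i).2 h, smul_zero]

variable {k m}

/-- The tensor `η = x_1 ⊗ x_{n+1} + ⋯ + x_n ⊗ x_{2n} ∈ V^* ⊗ (V/V_2)^* ⊂ V^* ⊗ V^*`. -/
def eta : VDual k m ⊗[k] VDual k m := ∑ i, covec (Sum.inl i) ⊗ₜ[k] covec (Sum.inr i)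

/-- For `v, w ∈ V` the linear map `f ⊗ g ↦ (v ⊗ f) ∧ (w ⊗ g)`. On symmetric tensors it is
alternating in `(v, w)` and gives the inclusion `Λ² V ⊗ Sym_2 V^* ⊂ Λ² (V ⊗ V^*)`,
`(v ∧ w) ⊗ (f ⊗ g + g ⊗ f) ↦ (v ⊗ f) ∧ (w ⊗ g) + (v ⊗ g) ∧ (w ⊗ f)`. -/
def wedgeSym (v w : V k m) : VDual k m ⊗[k] VDual k m →ₗ[k] Ext k m :=
  LinearMap.mul' k (Ext k m) ∘ₗ TensorProduct.map
    (ExteriorAlgebra.ι k ∘ₗ TensorProduct.mk k (V k m) (VDual k m) v)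
    (ExteriorAlgebra.ι k ∘ₗ TensorProduct.mk k (V k m) (VDual k m) w)

/-- The scalar by which `p ∈ P` acts on the line `Λ² V_2`, i.e. the determinant of `p` on `V_2`. -/
def detV2 (p : G k m) : k :=
  act p (vec (Sum.inl 0)) (Sum.inl 0) * act p (vec (Sum.inl 1)) (Sum.inl 1)
    - act p (vec (Sum.inl 1)) (Sum.inl 0) * act p (vec (Sum.inl 0)) (Sum.inl 1)

/-- The image of `T = (v_1 ∧ v_2) ⊠ η` under `(p, q) ∈ P × P`: it is
`(p v_1 ∧ p v_2) ⊠ q η = (p v_1 ∧ p v_2) ⊠ η + (p v_1 ∧ p v_2) ⊠ (q η - η)`, where the first term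
is a multiple of `T` and, `q η - η` being in `Sym_2 (V/V_2)^*`, the second term is in `Λ²`. -/
def actT (p q : G k m) : ExtT k m :=
  Polynomial.C (algebraMap k (Ext k m) (detV2 p)) * Polynomial.X +
    Polynomial.C (wedgeSym (act p (vec (Sum.inl 0))) (act p (vec (Sum.inl 1)))
      (TensorProduct.map (coact q) (coact q) eta - eta))

/-- The action of `(p, q) ∈ P × P`: the natural multiplicative action on `Λ(V ⊗ V^*)`, extended
multiplicatively by the action on `T`; it sends `Σ λ_i T^i` to `Σ ((p, q) λ_i) ((p, q) T)^i`. -/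
def rho (p q : G k m) (a : ExtT k m) : ExtT k m :=
  Polynomial.eval₂ (Polynomial.C.comp
    (ExteriorAlgebra.map (TensorProduct.map (act p) (coact q))).toRingHom) (actT p q) a

/-! ### The differential -/

/-- The map `v ⊗ f ↦ (h · f) (g · v)`; this is the evaluation `S ⊠ S^⊥ → O` in the fibre over the
point `(gP, hP)`. -/
def ev (y : G k m × G k m) : Module.Dual k (V k m ⊗[k] VDual k m) :=
  contractRight k (V k m) ∘ₗ TensorProduct.map (act y.1) (coact y.2)

/-- The cycle `t = d T` in the fibre over `(gP, hP)`:
`t = Σ_i ((h x_i)(g v_1) v_2 - (h x_i)(g v_2) v_1) ⊗ x_{n+i}`. -/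
def cyc (y : G k m × G k m) : V k m ⊗[k] VDual k m :=
  ∑ i : Fin (m + 2),
    (coact y.2 (covec (Sum.inl i)) (act y.1 (vec (Sum.inl 0))) • vec (Sum.inl 1)
      - coact y.2 (covec (Sum.inl i)) (act y.1 (vec (Sum.inl 1))) • vec (Sum.inl 0))
      ⊗ₜ[k] covec (Sum.inr i)

/-- The Koszul differential of `Λ(V ⊗ V^*)` in the fibre over `(gP, hP)`: the skew derivation
(contraction) that extends the evaluation map. -/
def koszul (y : G k m × G k m) : Ext k m →ₗ[k] Ext k m :=
  CliffordAlgebra.contractLeft (ev y)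

/-- The differential in the fibre over `(gP, hP)`:
`d (w T^i) = (d w) T^i + (-1)^{|w|} i w t T^{i-1}`.
Here `CliffordAlgebra.involute w` is `(-1)^{|w|} w`. -/
def diff (y : G k m × G k m) : ExtT k m →ₗ[k] ExtT k m :=
  Polynomial.lsum fun i =>
    (Polynomial.monomial i).restrictScalars k ∘ₗ koszul y +
    (Polynomial.monomial (i - 1)).restrictScalars k ∘ₗ
      (i • (LinearMap.mulRight k (ExteriorAlgebra.ι k (cyc y)) ∘ₗ
        (CliffordAlgebra.involute (Q := (0 : QuadraticForm k (V k m ⊗[k] VDual k m)))).toLinearMap))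

end Algebra

/-! ### Zariski topology and regular functions

A (quasi-)affine variety over the algebraically closed field `k` is given by its set of points `Y`
and by its algebra `A` of polynomial functions `Y → k`. -/

section Variety

variable {k Y E : Type*} [Field k] [AddCommGroup E] [Module k E]

/-- `Ω ⊆ Y` is Zariski open: it is a union of sets `{q ≠ 0}` with `q ∈ A`. -/
def IsZariskiOpen (A : Subalgebra k (Y → k)) (Ω : Set Y) : Prop :=
  ∀ y ∈ Ω, ∃ q ∈ A, q y ≠ 0 ∧ ∀ z, q z ≠ 0 → z ∈ Ω

/-- A function with values in a vector space is regular on the open set `Ω`: each of its coordinates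
is locally a quotient of polynomial functions. -/
def IsRegularOn (A : Subalgebra k (Y → k)) (Ω : Set Y) (s : Y → E) : Prop :=
  ∀ ℓ : Module.Dual k E, ∀ y ∈ Ω, ∃ a ∈ A, ∃ b ∈ A, b y ≠ 0 ∧
    ∀ z ∈ Ω, b z ≠ 0 → ℓ (s z) = a z / b z

end Variety

section Sections

variable (k : Type*) [Field k] (m : ℕ)

/-- Polynomial functions on `G`: polynomials in the matrix entries. -/
def polyG : Subalgebra k (G k m → k) :=
  Algebra.adjoin k {f | ∃ a b, f = fun g : G k m => (g : Matrix (Idx m) (Idx m) k) a b}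

/-- Polynomial functions on `G × G`: polynomials in the entries of both matrices. -/
def polyGG : Subalgebra k (G k m × G k m → k) :=
  Algebra.adjoin k ({f | ∃ a b, f = fun y : G k m × G k m => (y.1 : Matrix (Idx m) (Idx m) k) a b} ∪
    {f | ∃ a b, f = fun y : G k m × G k m => (y.2 : Matrix (Idx m) (Idx m) k) a b})

variable {k m}

/-- The preimage in `G × G` of a subset of `X × X`. -/
def preim (U : Set (SpGr k m × SpGr k m)) : Set (G k m × G k m) :=
  {y | (orbit y.1, orbit y.2) ∈ U}

/-- The preimage in `G` of the intersection of a subset of `X × X` with the diagonal `Δ ≅ X`. -/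
def preimDiag (U : Set (SpGr k m × SpGr k m)) : Set (G k m) :=
  {g | (orbit g, orbit g) ∈ U}

/-- Zariski open subsets of `X × X = (G × G)/(P × P)`. -/
def IsOpenXX (U : Set (SpGr k m × SpGr k m)) : Prop := IsZariskiOpen (polyGG k m) (preim U)

/-- Sections over the open set `U ⊆ X × X` of the homogeneous vector bundle
`Φ_j = (G × G) ×_{P × P} M_j`: regular functions `s` on the preimage of `U`, with values in `M_j`,
such that `s (g, h) = (p, q) · s (g p, h q)`; such an `s` stands for `(gP, hP) ↦ [(g, h), s (g, h)]`.
For `j = 0` these are the sections of `O_{X × X}`. Values outside the preimage of `U` are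
irrelevant. -/
structure IsSection (j : ℕ) (U : Set (SpGr k m × SpGr k m)) (s : G k m × G k m → ExtT k m) :
    Prop where
  mem : ∀ y ∈ preim U, s y ∈ M k m j
  regular : IsRegularOn (polyGG k m) (preim U) s
  equivariant : ∀ y ∈ preim U, ∀ p ∈ P k m, ∀ q ∈ P k m, rho p q (s (y.1 * p, y.2 * q)) = s y

/-- Sections over the open set `U ⊆ X × X` of the structure sheaf `O_Δ` of the diagonal, i.e. of the
direct image of `O_X` under `x ↦ (x, x)`: regular functions on `{x ∈ X | (x, x) ∈ U}`, written as
functions on the preimage in `G` that are invariant under `P`. -/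
structure IsSectionDiag (U : Set (SpGr k m × SpGr k m)) (φ : G k m → k) : Prop where
  regular : IsRegularOn (polyG k m) (preimDiag U) φ
  invariant : ∀ g ∈ preimDiag U, ∀ p ∈ P k m, φ (g * p) = φ g

/-- The augmentation `Φ_0 = O_{X × X} → O_Δ`, the restriction of functions to the diagonal
(`M_0 = k`). -/
def aug (s : G k m × G k m → ExtT k m) (g : G k m) : k :=
  ExteriorAlgebra.algebraMapInv ((s (g, g)).coeff 0)

end Sections

end SymplecticDiagonal

end

open scoped TensorProduct

noncomputable section

namespace SymplecticDiagonal

/-! Over a point (gP, hP) the differential is the skew derivation of Λ[T] with u ↦ ev(u) and T ↦ t.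
Its square vanishes because ev(t) is the symplectic product of the first two columns of h⁻¹g, which
span an isotropic plane (`ev_cyc`). It is compatible with P × P because this can be checked on
generators (`diff_rhoHom`). On T the point is that qη − η is symmetric: η minus its transpose is the
symplectic form, which q preserves (`comm_etaDiff`).

Exactness is checked near each point. By equivariance a section is determined by its restriction to
a slice of G × G → X × X, a product of two open cells, and conversely a regular M_j-valued function
on the slice extends to a section near the point (`exists_section_of_slice`). Hence ds' = s need
only be solved on the slice (`exists_primitive_of_slice`).

Off the diagonal some w has ev(w) ≠ 0, and left multiplication by w/ev(w) is a contracting homotopy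
(`exists_primitive_off_diagonal`).

At a diagonal point, V_2 ⊗ (V/V_2)^* has 4n−4 basis tensors but dim X = 4n−5. The evaluations on all
of them except e = v_2 ⊗ x_{n+1} are independent coordinates z_i; the evaluation on e is forced by
isotropy. This redundancy spoils exactness of the bare Koszul complex, and t is the corresponding
syzygy. Its coefficient at e is 1 (`ε_cyc`), so a unipotent change of basis replaces e by t
(`shear`, `diff_shearHom`). The complex becomes the Koszul complex of the z_i tensored with Λ(e)[T],
T ↦ e. For the homotopy z_i ↦ u_i, e ↦ T, the operator dδ + δd counts the factors z_i, u_i, e and T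
(`modelD_modelδ_tmul`). In characteristic 0 it is invertible wherever at least one such factor
occurs. This gives exactness in positive degree (`exists_modelD_eq`), while in degree 0 the
functions vanishing on z = 0, that is on the diagonal, are boundaries (`exists_modelD_eq_tmul_one`).
Sections are rational rather than polynomial on the cell, so denominators are cleared first
(`exists_polyM_of_finReg`).

Functions on the diagonal lift locally by pullback along the second projection (`exists_aug_eq`),
and multiplication by T shows that no M_j vanishes (`M_ne_bot`). -/

/-! ### Regular functions -/

section RegularFunctions

variable {k Y Y' E F : Type*} [Field k] [AddCommGroup E] [Module k E] [AddCommGroup F] [Module k F]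

/-- The algebra of scalar functions that are regular on `Ω`. -/
def regAlg (A : Subalgebra k (Y → k)) (Ω : Set Y) : Subalgebra k (Y → k) where
  carrier := {f | ∀ y ∈ Ω, ∃ a ∈ A, ∃ b ∈ A, b y ≠ 0 ∧ ∀ z ∈ Ω, b z ≠ 0 → f z = a z / b z}
  mul_mem' := by
    intro f g hf hg y hy
    obtain ⟨a, ha, b, hb, hby, h⟩ := hf y hy
    obtain ⟨a', ha', b', hb', hby', h'⟩ := hg y hy
    refine ⟨a * a', mul_mem ha ha', b * b', mul_mem hb hb', mul_ne_zero hby hby', ?_⟩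
    intro z hz hne
    simp only [Pi.mul_apply, mul_ne_zero_iff] at hne ⊢
    rw [h z hz hne.1, h' z hz hne.2, div_mul_div_comm]
  add_mem' := by
    intro f g hf hg y hy
    obtain ⟨a, ha, b, hb, hby, h⟩ := hf y hy
    obtain ⟨a', ha', b', hb', hby', h'⟩ := hg y hy
    refine ⟨a * b' + b * a', add_mem (mul_mem ha hb') (mul_mem hb ha'), b * b', mul_mem hb hb',
      mul_ne_zero hby hby', ?_⟩
    intro z hz hne
    simp only [Pi.mul_apply, Pi.add_apply, mul_ne_zero_iff] at hne ⊢
    rw [h z hz hne.1, h' z hz hne.2, div_add_div _ _ hne.1 hne.2]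
  algebraMap_mem' := fun c y _ => ⟨_, A.algebraMap_mem c, 1, one_mem A, one_ne_zero, by simp⟩

variable {A : Subalgebra k (Y → k)} {A' : Subalgebra k (Y' → k)} {Ω : Set Y} {Ω' : Set Y'}

lemma le_regAlg : A ≤ regAlg A Ω := fun a ha y _ => ⟨a, ha, 1, one_mem A, one_ne_zero, by simp⟩

lemma regAlg_mono {Ω₁ : Set Y} (h : Ω₁ ⊆ Ω) : regAlg A Ω ≤ regAlg A Ω₁ := by
  intro f hf y hy
  obtain ⟨a, ha, b, hb, hby, h'⟩ := hf y (h hy)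
  exact ⟨a, ha, b, hb, hby, fun z hz => h' z (h hz)⟩

lemma regAlg_congr {f g : Y → k} (hf : f ∈ regAlg A Ω) (h : ∀ y ∈ Ω, g y = f y) :
    g ∈ regAlg A Ω := by
  intro y hy
  obtain ⟨a, ha, b, hb, hby, h'⟩ := hf y hy
  exact ⟨a, ha, b, hb, hby, fun z hz hz' => by rw [h z hz, h' z hz hz']⟩

lemma regAlg_of_local {f : Y → k} (h : ∀ y ∈ Ω, ∃ a ∈ regAlg A Ω, ∃ b ∈ regAlg A Ω, b y ≠ 0 ∧
    ∀ z ∈ Ω, b z ≠ 0 → f z = a z / b z) : f ∈ regAlg A Ω := by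
  intro y hy
  obtain ⟨a, ha, b, hb, hby, h⟩ := h y hy
  obtain ⟨a₁, ha₁, a₂, ha₂, hay, h₁⟩ := ha y hy
  obtain ⟨b₁, hb₁, b₂, hb₂, hby', h₂⟩ := hb y hy
  have hb₁y : b₁ y ≠ 0 := by
    rintro h0
    rw [h₂ y hy hby', h0, zero_div] at hby
    exact hby rfl
  -- With a = a₁/a₂ and b = b₁/b₂ the quotient is a₁b₂/(a₂b₁). The additional factor b₂ makes the
  -- new denominator vanish wherever the formula for b is not available.
  refine ⟨a₁ * b₂ * b₂, mul_mem (mul_mem ha₁ hb₂) hb₂, a₂ * b₁ * b₂,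
    mul_mem (mul_mem ha₂ hb₁) hb₂, mul_ne_zero (mul_ne_zero hay hb₁y) hby', ?_⟩
  intro z hz hne
  simp only [Pi.mul_apply, mul_ne_zero_iff] at hne ⊢
  obtain ⟨⟨h3, h4⟩, h5⟩ := hne
  rw [h z hz (by rw [h₂ z hz h5]; exact div_ne_zero h4 h5), h₁ z hz h3, h₂ z hz h5]
  field_simp

lemma regAlg_inv {f : Y → k} (hf : f ∈ regAlg A Ω) (h : ∀ y ∈ Ω, f y ≠ 0) :
    (fun y => (f y)⁻¹) ∈ regAlg A Ω :=
  regAlg_of_local fun y hy => ⟨1, one_mem _, f, hf, h y hy, by simp⟩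

lemma regAlg_comp {ψ : Y → Y'} (hψ : ∀ a ∈ A', a ∘ ψ ∈ regAlg A Ω) (hm : ∀ y ∈ Ω, ψ y ∈ Ω')
    {f : Y' → k} (hf : f ∈ regAlg A' Ω') : (fun y => f (ψ y)) ∈ regAlg A Ω :=
  regAlg_of_local fun y hy => by
    obtain ⟨a, ha, b, hb, hby, h⟩ := hf (ψ y) (hm y hy)
    exact ⟨_, hψ a ha, _, hψ b hb, hby, fun z hz hz' => h _ (hm z hz) hz'⟩

lemma IsZariskiOpen.inter {Ω₁ Ω₂ : Set Y} (h₁ : IsZariskiOpen A Ω₁) (h₂ : IsZariskiOpen A Ω₂) :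
    IsZariskiOpen A (Ω₁ ∩ Ω₂) := by
  intro y hy
  obtain ⟨q, hq, hqy, h⟩ := h₁ y hy.1
  obtain ⟨q', hq', hqy', h'⟩ := h₂ y hy.2
  refine ⟨q * q', mul_mem hq hq', mul_ne_zero hqy hqy', fun z hz => ?_⟩
  simp only [Pi.mul_apply, mul_ne_zero_iff] at hz
  exact ⟨h z hz.1, h' z hz.2⟩

lemma isZariskiOpen_univ : IsZariskiOpen A (Set.univ : Set Y) :=
  fun _ _ => ⟨1, one_mem A, one_ne_zero, by simp⟩

lemma IsZariskiOpen.ne_zero (h : IsZariskiOpen A Ω) {f : Y → k} (hf : f ∈ regAlg A Ω) :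
    IsZariskiOpen A {y | y ∈ Ω ∧ f y ≠ 0} := by
  rintro y ⟨hy, hfy⟩
  obtain ⟨q, hq, hqy, hqΩ⟩ := h y hy
  obtain ⟨a, ha, b, hb, hby, h'⟩ := hf y hy
  have hay : a y ≠ 0 := by
    rintro h0
    rw [h' y hy hby, h0, zero_div] at hfy
    exact hfy rfl
  refine ⟨q * a * b, mul_mem (mul_mem hq ha) hb, mul_ne_zero (mul_ne_zero hqy hay) hby, ?_⟩
  intro z hz
  simp only [Pi.mul_apply, mul_ne_zero_iff] at hz
  exact ⟨hqΩ z hz.1.1, by rw [h' z (hqΩ z hz.1.1) hz.2]; exact div_ne_zero hz.1.2 hz.2⟩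

lemma IsZariskiOpen.preimage (h : IsZariskiOpen A Ω) {ψ : Y → Y'}
    (hψ : ∀ a ∈ A', a ∘ ψ ∈ regAlg A Ω) (h' : IsZariskiOpen A' Ω') :
    IsZariskiOpen A {y | y ∈ Ω ∧ ψ y ∈ Ω'} := by
  rintro y ⟨hy, hy'⟩
  obtain ⟨q, hq, hqy, hqΩ⟩ := h' _ hy'
  obtain ⟨r, hr, hry, hrΩ⟩ := h.ne_zero (hψ q hq) y ⟨hy, hqy⟩
  exact ⟨r, hr, hry, fun z hz => ⟨(hrΩ z hz).1, hqΩ _ (hrΩ z hz).2⟩⟩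

/-- Vector valued functions that on `Ω` are finite sums `∑ cᵢ eᵢ` with `cᵢ` regular and `eᵢ`
constant. -/
inductive FinReg (A : Subalgebra k (Y → k)) (Ω : Set Y) : (Y → E) → Prop
  | zero : FinReg A Ω 0
  | add_smul (c : Y → k) (hc : c ∈ regAlg A Ω) (e : E) (s : Y → E) (hs : FinReg A Ω s) (s' : Y → E)
      (h : ∀ y ∈ Ω, s' y = c y • e + s y) : FinReg A Ω s'

namespace FinReg

lemma congr {s s' : Y → E} (hs : FinReg A Ω s) (h : ∀ y ∈ Ω, s' y = s y) : FinReg A Ω s' :=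
  .add_smul 0 (zero_mem _) 0 s hs s' fun y hy => by simp [h y hy]

lemma smul_const {c : Y → k} (hc : c ∈ regAlg A Ω) (e : E) : FinReg A Ω (fun y => c y • e) :=
  .add_smul c hc e 0 .zero _ fun y _ => by simp

lemma const (e : E) : FinReg A Ω (fun _ => e) :=
  (smul_const (one_mem _) e).congr fun y _ => by simp

lemma add {s s' : Y → E} (hs : FinReg A Ω s) (hs' : FinReg A Ω s') :
    FinReg A Ω (fun y => s y + s' y) := by
  induction hs with
  | zero => exact hs'.congr fun y _ => by simp
  | add_smul c hc e s hs s₁ h ih =>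
    exact .add_smul c hc e _ ih _ fun y hy => by rw [h y hy, add_assoc]

lemma smul {s : Y → E} (hs : FinReg A Ω s) {c : Y → k} (hc : c ∈ regAlg A Ω) :
    FinReg A Ω (fun y => c y • s y) := by
  induction hs with
  | zero => exact zero.congr fun y _ => by simp
  | add_smul c' hc' e s hs s₁ h ih =>
    exact .add_smul _ (mul_mem hc hc') e _ ih _ fun y hy => by
      rw [h y hy, smul_add, Pi.mul_apply, mul_smul]

lemma neg {s : Y → E} (hs : FinReg A Ω s) : FinReg A Ω (fun y => - s y) :=
  (hs.smul (neg_mem (one_mem _))).congr fun y _ => by simp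

lemma sub {s s' : Y → E} (hs : FinReg A Ω s) (hs' : FinReg A Ω s') :
    FinReg A Ω (fun y => s y - s' y) :=
  (hs.add hs'.neg).congr fun y _ => by rw [sub_eq_add_neg]

lemma sum {ι : Type*} (t : Finset ι) {s : ι → Y → E} (hs : ∀ i ∈ t, FinReg A Ω (s i)) :
    FinReg A Ω (fun y => ∑ i ∈ t, s i y) := by
  classical
  induction t using Finset.induction_on with
  | empty => exact zero.congr fun y _ => by simp
  | insert i t hi ih =>
    exact ((hs i (Finset.mem_insert_self i t)).add
      (ih fun j hj => hs j (Finset.mem_insert_of_mem hj))).congr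
        fun y _ => by rw [Finset.sum_insert hi]

/-- The linear map may vary with the point, and regularity is then only needed on constant
arguments. This is how the differential, the group action and the shear are seen to preserve
regularity. -/
lemma bind {s : Y → E} (hs : FinReg A Ω s) (φ : Y → E →ₗ[k] F)
    (hφ : ∀ e, FinReg A Ω (fun y => φ y e)) : FinReg A Ω (fun y => φ y (s y)) := by
  induction hs with
  | zero => exact zero.congr fun y _ => by simp
  | add_smul c hc e s hs s₁ h ih =>
    exact (((hφ e).smul hc).add ih).congr fun y hy => by rw [h y hy, map_add, map_smul]

lemma map {s : Y → E} (hs : FinReg A Ω s) (φ : E →ₗ[k] F) : FinReg A Ω (fun y => φ (s y)) :=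
  hs.bind (fun _ => φ) fun e => const (φ e)

lemma map₂ {E' : Type*} [AddCommGroup E'] [Module k E'] {s : Y → E} {s' : Y → E'}
    (hs : FinReg A Ω s) (hs' : FinReg A Ω s') (φ : E →ₗ[k] E' →ₗ[k] F) :
    FinReg A Ω (fun y => φ (s y) (s' y)) :=
  hs'.bind (fun y => φ (s y)) fun e => hs.map (φ.flip e)

lemma mul {R : Type*} [Ring R] [Algebra k R] {s s' : Y → R} (hs : FinReg A Ω s)
    (hs' : FinReg A Ω s') : FinReg A Ω (fun y => s y * s' y) :=
  hs.map₂ hs' (LinearMap.mul k R)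

lemma mem_regAlg {s : Y → k} (hs : FinReg A Ω s) : s ∈ regAlg A Ω := by
  induction hs with
  | zero => exact zero_mem _
  | add_smul c hc e s hs s₁ h ih =>
    exact regAlg_congr (add_mem (mul_mem hc (algebraMap_mem (regAlg A Ω) e)) ih)
      fun y hy => by rw [h y hy]; simp

lemma isRegularOn {s : Y → E} (hs : FinReg A Ω s) : IsRegularOn A Ω s :=
  fun ℓ => (hs.map ℓ).mem_regAlg

lemma mono {Ω₁ : Set Y} (h : Ω₁ ⊆ Ω) {s : Y → E} (hs : FinReg A Ω s) : FinReg A Ω₁ s := by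
  induction hs with
  | zero => exact zero
  | add_smul c hc e s hs s₁ h' ih =>
    exact .add_smul c (regAlg_mono h hc) e s ih s₁ fun y hy => h' y (h hy)

lemma comp {ψ : Y → Y'} (hψ : ∀ a ∈ A', a ∘ ψ ∈ regAlg A Ω) (hm : ∀ y ∈ Ω, ψ y ∈ Ω')
    {s : Y' → E} (hs : FinReg A' Ω' s) : FinReg A Ω (fun y => s (ψ y)) := by
  induction hs with
  | zero => exact zero
  | add_smul c hc e s hs s₁ h ih =>
    exact .add_smul _ (regAlg_comp hψ hm hc) e _ ih _ fun y hy => h _ (hm y hy)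

end FinReg

/-- Coordinates of a basis of `N` extend to functionals on all of `E`, and regularity is given for
these. The converse passage `FinReg.isRegularOn` needs no finiteness. -/
lemma IsRegularOn.finReg {s : Y → E} (hs : IsRegularOn A Ω s) (N : Submodule k E)
    [FiniteDimensional k N] (hN : ∀ y ∈ Ω, s y ∈ N) : FinReg A Ω s := by
  let b := Module.finBasis k N
  have hex : ∀ i, ∃ ℓ : E →ₗ[k] k, ℓ ∘ₗ N.subtype = b.coord i := fun i =>
    (b.coord i).exists_extend
  choose ℓ hℓ using hex
  have hreg : ∀ i, (fun y => ℓ i (s y)) ∈ regAlg A Ω := fun i => hs (ℓ i)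
  refine (FinReg.sum Finset.univ fun i _ => FinReg.smul_const (hreg i) (b i : E)).congr ?_
  intro y hy
  have h1 := congrArg (Subtype.val) (b.sum_repr ⟨s y, hN y hy⟩)
  refine h1.symm.trans ?_
  simp only [Submodule.coe_sum, Submodule.coe_smul]
  refine Finset.sum_congr rfl fun i _ => ?_
  rw [← b.coord_apply, ← hℓ i, LinearMap.comp_apply, Submodule.subtype_apply]

end RegularFunctions

/-! ### Differentials on `Λ(U)[T]` -/

section PolyExt

variable {k U U' : Type*} [Field k] [AddCommGroup U] [Module k U] [AddCommGroup U'] [Module k U']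

/-- Reduces identities between homomorphisms and skew derivations of Λ(U)[T] to left multiplication
by the generators. -/
lemma polyExt_induction {P : Polynomial (ExteriorAlgebra k U) → Prop}
    (algebraMap : ∀ r : k, P (algebraMap k _ r)) (add : ∀ a b, P a → P b → P (a + b))
    (ι_mul : ∀ u a, P a → P (Polynomial.C (ExteriorAlgebra.ι k u) * a))
    (X_mul : ∀ a, P a → P (Polynomial.X * a)) (a : Polynomial (ExteriorAlgebra k U)) : P a := by
  induction a using Polynomial.induction_on' with
  | add a b ha hb => exact add a b ha hb
  | monomial n w =>
    induction n with
    | zero =>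
      rw [Polynomial.monomial_zero_left]
      refine CliffordAlgebra.left_induction (Q := (0 : QuadraticForm k U))
        (P := fun w => P (Polynomial.C w)) (fun r => ?_) (fun x y hx hy => ?_)
        (fun x u hx => ?_) w
      · exact algebraMap r
      · rw [Polynomial.C_add]
        exact add _ _ hx hy
      · rw [Polynomial.C_mul]
        exact ι_mul u _ hx
    | succ n ih =>
      rw [← Polynomial.X_mul_monomial]
      exact X_mul _ ih

lemma ι_mul_ι_swap (u v : U) :
    ExteriorAlgebra.ι k u * ExteriorAlgebra.ι k v
      = - (ExteriorAlgebra.ι k v * ExteriorAlgebra.ι k u) :=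
  eq_neg_of_add_eq_zero_left (ExteriorAlgebra.ι_add_mul_swap u v)

lemma commute_ι_mul_ι (u v : U) (w : ExteriorAlgebra k U) :
    Commute (ExteriorAlgebra.ι k u * ExteriorAlgebra.ι k v) w := by
  refine CliffordAlgebra.left_induction (Q := (0 : QuadraticForm k U))
    (P := fun w => Commute (ExteriorAlgebra.ι k u * ExteriorAlgebra.ι k v) w)
    (fun r => Algebra.commute_algebraMap_right r _) (fun x y hx hy => hx.add_right hy)
    (fun x z hx => Commute.mul_right ?_ hx) w
  change _ * ExteriorAlgebra.ι k z = ExteriorAlgebra.ι k z * _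
  rw [mul_assoc, ι_mul_ι_swap v z, mul_neg, ← mul_assoc, ι_mul_ι_swap u z, neg_mul, neg_neg,
    mul_assoc]

/-- Moving the odd element t to the left of w costs exactly the sign (−1)^{|w|}. In the form t·w the
T-part of the differential carries no sign any more. -/
lemma involute_mul_ι (w : ExteriorAlgebra k U) (t : U) :
    CliffordAlgebra.involute (Q := (0 : QuadraticForm k U)) w * ExteriorAlgebra.ι k t
      = ExteriorAlgebra.ι k t * w := by
  refine CliffordAlgebra.left_induction (Q := (0 : QuadraticForm k U))
    (P := fun w => CliffordAlgebra.involute (Q := (0 : QuadraticForm k U)) w *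
      ExteriorAlgebra.ι k t = ExteriorAlgebra.ι k t * w)
    (fun r => ?_) (fun x y hx hy => ?_) (fun x z hx => ?_) w
  · rw [AlgHom.commutes]
    exact Algebra.commutes r _
  · rw [map_add, add_mul, hx, hy, mul_add]
  · rw [map_mul, mul_assoc, hx, CliffordAlgebra.involute_ι, ← mul_assoc, ← mul_assoc, neg_mul]
    congr 1
    exact (ι_mul_ι_swap t z).symm

/-- The skew derivation of `Λ(U)[T]` with `u ↦ φ u` on `U` and `T ↦ t`. -/
def polyD (φ : Module.Dual k U) (t : U) :
    Polynomial (ExteriorAlgebra k U) →ₗ[k] Polynomial (ExteriorAlgebra k U) :=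
  Polynomial.lsum fun i =>
    (Polynomial.monomial i).restrictScalars k ∘ₗ CliffordAlgebra.contractLeft φ +
    (Polynomial.monomial (i - 1)).restrictScalars k ∘ₗ
      (i • (LinearMap.mulRight k (ExteriorAlgebra.ι k t) ∘ₗ
        (CliffordAlgebra.involute (Q := (0 : QuadraticForm k U))).toLinearMap))

variable (φ : Module.Dual k U) (t : U)

lemma polyD_monomial (n : ℕ) (w : ExteriorAlgebra k U) :
    polyD φ t (Polynomial.monomial n w) =
      Polynomial.monomial n (CliffordAlgebra.contractLeft φ w) +
      Polynomial.monomial (n - 1) (n • (ExteriorAlgebra.ι k t * w)) := by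
  rw [polyD, Polynomial.lsum_apply, Polynomial.sum_monomial_index _ _ (LinearMap.map_zero _)]
  simp only [LinearMap.add_apply, LinearMap.comp_apply, LinearMap.restrictScalars_apply,
    LinearMap.smul_apply, LinearMap.mulRight_apply, AlgHom.toLinearMap_apply, involute_mul_ι]

lemma polyD_coeff (a : Polynomial (ExteriorAlgebra k U)) (i : ℕ) :
    (polyD φ t a).coeff i = CliffordAlgebra.contractLeft φ (a.coeff i) +
      (i + 1) • (ExteriorAlgebra.ι k t * a.coeff (i + 1)) := by
  induction a using Polynomial.induction_on' with
  | add a b ha hb =>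
    simp only [map_add, Polynomial.coeff_add, ha, hb, mul_add, smul_add]
    abel
  | monomial n w =>
    rw [polyD_monomial, Polynomial.coeff_add]
    congr 1
    · simp only [Polynomial.coeff_monomial]
      split_ifs <;> simp
    · rcases n with _ | n
      · simp
      · simp only [Polynomial.coeff_monomial, Nat.add_sub_cancel, Nat.add_right_cancel_iff]
        split_ifs with h
        · rw [h]
        · simp

lemma polyD_algebraMap (r : k) : polyD φ t (algebraMap k _ r) = 0 := by
  ext1 i
  rw [polyD_coeff, Polynomial.algebraMap_apply]
  simp only [Polynomial.coeff_C, Nat.add_eq_zero_iff, one_ne_zero, and_false, if_false, mul_zero,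
    smul_zero, add_zero, Polynomial.coeff_zero]
  split_ifs
  · exact CliffordAlgebra.contractLeft_algebraMap _ φ r
  · exact map_zero _

lemma polyD_ι_mul (u : U) (a : Polynomial (ExteriorAlgebra k U)) :
    polyD φ t (Polynomial.C (ExteriorAlgebra.ι k u) * a) =
      φ u • a - Polynomial.C (ExteriorAlgebra.ι k u) * polyD φ t a := by
  ext1 i
  simp only [polyD_coeff, Polynomial.coeff_C_mul, Polynomial.coeff_sub, Polynomial.coeff_smul]
  rw [ExteriorAlgebra.ι, CliffordAlgebra.contractLeft_ι_mul, ← ExteriorAlgebra.ι, ← mul_assoc,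
    ι_mul_ι_swap t u]
  simp only [mul_add, mul_smul_comm, neg_mul, mul_assoc, smul_neg]
  abel

lemma polyD_X_mul (a : Polynomial (ExteriorAlgebra k U)) :
    polyD φ t (Polynomial.X * a) =
      Polynomial.C (ExteriorAlgebra.ι k t) * a + Polynomial.X * polyD φ t a := by
  ext1 i
  rcases i with _ | i
  · simp [polyD_coeff]
  · simp only [polyD_coeff, Polynomial.coeff_C_mul, Polynomial.coeff_add, Polynomial.coeff_X_mul]
    rw [add_smul (i + 1) 1, one_smul]
    abel

lemma polyD_ι_mul_ι_mul (u v : U) (a : Polynomial (ExteriorAlgebra k U)) :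
    polyD φ t (Polynomial.C (ExteriorAlgebra.ι k u * ExteriorAlgebra.ι k v) * a) =
      Polynomial.C (φ u • ExteriorAlgebra.ι k v - φ v • ExteriorAlgebra.ι k u) * a +
        Polynomial.C (ExteriorAlgebra.ι k u * ExteriorAlgebra.ι k v) * polyD φ t a := by
  rw [Polynomial.C_mul, mul_assoc, polyD_ι_mul, polyD_ι_mul, Polynomial.C_sub, sub_mul, mul_sub,
    mul_assoc, mul_smul_comm, ← Polynomial.smul_C, ← Polynomial.smul_C,
    smul_mul_assoc, smul_mul_assoc]
  abel

/-- On generators u ↦ φ(u) ↦ 0 and T ↦ t ↦ φ(t), so φ(t) is the only obstruction. -/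
lemma polyD_polyD (h : φ t = 0) (a : Polynomial (ExteriorAlgebra k U)) :
    polyD φ t (polyD φ t a) = 0 := by
  induction a using polyExt_induction with
  | algebraMap r => rw [polyD_algebraMap, map_zero]
  | add a b ha hb => rw [map_add, map_add, ha, hb, add_zero]
  | ι_mul u a ha => rw [polyD_ι_mul, map_sub, map_smul, polyD_ι_mul, ha, mul_zero, sub_zero, sub_self]
  | X_mul a ha =>
    rw [polyD_X_mul, map_add, polyD_ι_mul, polyD_X_mul, ha, h, zero_smul, mul_zero, add_zero,
      zero_sub, neg_add_cancel]

/-- The intertwining relation propagates from generators by the Leibniz rule. The rule for the image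
of T is a hypothesis because that image may contain a quadratic term besides a multiple of T. -/
lemma polyD_algHom {φ : Module.Dual k U'} {t : U'} {φ' : Module.Dual k U} {t' : U}
    (ρ : Polynomial (ExteriorAlgebra k U) →ₐ[k] Polynomial (ExteriorAlgebra k U'))
    (B : U →ₗ[k] U')
    (hρ : ∀ u, ρ (Polynomial.C (ExteriorAlgebra.ι k u)) = Polynomial.C (ExteriorAlgebra.ι k (B u)))
    (hφ : φ ∘ₗ B = φ')
    (hX : ∀ b, polyD φ t (ρ Polynomial.X * b) =
      Polynomial.C (ExteriorAlgebra.ι k (B t')) * b + ρ Polynomial.X * polyD φ t b)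
    (a : Polynomial (ExteriorAlgebra k U)) : polyD φ t (ρ a) = ρ (polyD φ' t' a) := by
  induction a using polyExt_induction with
  | algebraMap r => rw [polyD_algebraMap, map_zero, AlgHom.commutes, polyD_algebraMap]
  | add a b ha hb => simp only [map_add, ha, hb]
  | ι_mul u a ha =>
    rw [polyD_ι_mul, map_mul, hρ, polyD_ι_mul, ha, map_sub, map_smul, map_mul, hρ, ← hφ,
      LinearMap.comp_apply]
  | X_mul a ha => rw [polyD_X_mul, map_mul, hX, ha, map_add, map_mul, map_mul, hρ]

end PolyExt

/-! ### The differential and the action of `P × P` on the modules `M_j` -/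

section Equivariance

variable {k : Type*} [Field k] {m : ℕ}

variable (k m) in
/-- The subspace `V_2 ⊗ (V/V_2)^*` of `V ⊗ V^*`. -/
def V2L : Submodule k (V k m ⊗[k] VDual k m) :=
  Submodule.map₂ (TensorProduct.mk k (V k m) (VDual k m)) (V2 k m) (L k m)

lemma tmul_mem_V2L {v : V k m} {f : VDual k m} (hv : v ∈ V2 k m) (hf : f ∈ L k m) :
    v ⊗ₜ[k] f ∈ V2L k m := Submodule.apply_mem_map₂ _ hv hf

lemma LambdaPart_eq (j : ℕ) :
    LambdaPart k m j = (Submodule.map (ExteriorAlgebra.ι k) (V2L k m)) ^ j := rfl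

lemma ι_mem_LambdaPart {u : V k m ⊗[k] VDual k m} (hu : u ∈ V2L k m) :
    ExteriorAlgebra.ι k u ∈ LambdaPart k m 1 := by
  rw [LambdaPart_eq, pow_one]
  exact Submodule.mem_map_of_mem hu

lemma mul_mem_LambdaPart {i j : ℕ} {a b : Ext k m} (ha : a ∈ LambdaPart k m i)
    (hb : b ∈ LambdaPart k m j) : a * b ∈ LambdaPart k m (i + j) := by
  rw [LambdaPart_eq] at *
  rw [pow_add]
  exact Submodule.mul_mem_mul ha hb

lemma mem_M {j : ℕ} {a : ExtT k m} : a ∈ M k m j ↔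
    ∀ i, (2 * i ≤ j → a.coeff i ∈ LambdaPart k m (j - 2 * i)) ∧ (j < 2 * i → a.coeff i = 0) :=
  Iff.rfl

lemma algebraMap_mem_M (r : k) : algebraMap k (ExtT k m) r ∈ M k m 0 := by
  rw [mem_M]
  intro i
  rw [Polynomial.algebraMap_apply, Polynomial.coeff_C]
  refine ⟨fun h => ?_, fun h => if_neg (by omega)⟩
  have : i = 0 := by omega
  subst this
  rw [if_pos rfl, LambdaPart_eq, mul_zero, Nat.sub_zero, pow_zero]
  exact Submodule.algebraMap_mem _

lemma C_mul_mem_M {p j : ℕ} {w : Ext k m} (hw : w ∈ LambdaPart k m p) {a : ExtT k m}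
    (ha : a ∈ M k m j) : Polynomial.C w * a ∈ M k m (p + j) := by
  rw [mem_M] at ha ⊢
  intro i
  rw [Polynomial.coeff_C_mul]
  rcases le_or_gt (2 * i) j with h | h
  · refine ⟨fun _ => ?_, fun h' => by omega⟩
    rw [Nat.add_sub_assoc h]
    exact mul_mem_LambdaPart hw ((ha i).1 h)
  · rw [(ha i).2 h, mul_zero]
    exact ⟨fun _ => zero_mem _, fun _ => rfl⟩

lemma ι_mul_mem_M {j : ℕ} {u : V k m ⊗[k] VDual k m} (hu : u ∈ V2L k m) {a : ExtT k m}
    (ha : a ∈ M k m j) : Polynomial.C (ExteriorAlgebra.ι k u) * a ∈ M k m (j + 1) := by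
  rw [add_comm]
  exact C_mul_mem_M (ι_mem_LambdaPart hu) ha

lemma X_mul_mem_M {j : ℕ} {a : ExtT k m} (ha : a ∈ M k m j) :
    Polynomial.X * a ∈ M k m (j + 2) := by
  rw [mem_M] at ha ⊢
  intro i
  rcases i with _ | i
  · simp
  · rw [Polynomial.coeff_X_mul]
    refine ⟨fun h => ?_, fun h => (ha i).2 (by omega)⟩
    have := (ha i).1 (by omega)
    rwa [show j + 2 - 2 * (i + 1) = j - 2 * i by omega]

/-- In contrast to `polyExt_induction`, only vectors of `V2L` are multiplied in, so that hypotheses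
on the action or on ev are needed on that subspace alone. -/
lemma M_induction {P : ℕ → ExtT k m → Prop} (zero : ∀ j, P j 0)
    (algebraMap : ∀ r : k, P 0 (algebraMap k _ r))
    (add : ∀ j a b, a ∈ M k m j → b ∈ M k m j → P j a → P j b → P j (a + b))
    (ι_mul : ∀ u ∈ V2L k m, ∀ j a, a ∈ M k m j → P j a →
      P (j + 1) (Polynomial.C (ExteriorAlgebra.ι k u) * a))
    (X_mul : ∀ j a, a ∈ M k m j → P j a → P (j + 2) (Polynomial.X * a))
    {j : ℕ} {a : ExtT k m} (ha : a ∈ M k m j) : P j a := by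
  have key : ∀ p, ∀ w ∈ LambdaPart k m p, Polynomial.C w ∈ M k m p ∧ P p (Polynomial.C w) := by
    intro p w hw
    rw [LambdaPart_eq] at hw
    induction hw using Submodule.pow_induction_on_left' with
    | algebraMap r => exact ⟨algebraMap_mem_M r, algebraMap r⟩
    | add x y i hx hy h1 h2 =>
      rw [Polynomial.C_add]
      exact ⟨add_mem h1.1 h2.1, add _ _ _ h1.1 h2.1 h1.2 h2.2⟩
    | mem_mul u hu i x hx h =>
      obtain ⟨u, hu, rfl⟩ := hu
      rw [Polynomial.C_mul]
      exact ⟨ι_mul_mem_M hu h.1, ι_mul u hu _ _ h.1 h.2⟩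
  have key2 : ∀ i p, ∀ w ∈ LambdaPart k m p, Polynomial.monomial i w ∈ M k m (p + 2 * i) ∧
      P (p + 2 * i) (Polynomial.monomial i w) := by
    intro i p w hw
    induction i with
    | zero => exact key p w hw
    | succ i ih =>
      rw [← Polynomial.X_mul_monomial]
      exact ⟨X_mul_mem_M ih.1, X_mul _ _ ih.1 ih.2⟩
  have hmon : ∀ i, Polynomial.monomial i (a.coeff i) ∈ M k m j ∧
      P j (Polynomial.monomial i (a.coeff i)) := by
    intro i
    rcases le_or_gt (2 * i) j with h | h
    · have := key2 i _ _ ((mem_M.1 ha i).1 h)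
      rwa [Nat.sub_add_cancel h] at this
    · rw [(mem_M.1 ha i).2 h, map_zero]
      exact ⟨zero_mem _, zero j⟩
  rw [a.as_sum_support]
  generalize a.support = s
  classical
  suffices h : ∑ i ∈ s, Polynomial.monomial i (a.coeff i) ∈ M k m j ∧
      P j (∑ i ∈ s, Polynomial.monomial i (a.coeff i)) from h.2
  induction s using Finset.induction_on with
  | empty => exact ⟨by simp, by simpa using zero j⟩
  | insert i s hi ih =>
    rw [Finset.sum_insert hi]
    exact ⟨add_mem (hmon i).1 ih.1, add _ _ _ (hmon i).1 ih.1 (hmon i).2 ih.2⟩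

lemma eq_algebraMap_of_mem_M {a : ExtT k m} (ha : a ∈ M k m 0) :
    a = algebraMap k _ (ExteriorAlgebra.algebraMapInv (a.coeff 0)) := by
  refine M_induction (P := fun j a => j = 0 →
    a = algebraMap k _ (ExteriorAlgebra.algebraMapInv (a.coeff 0))) ?_ ?_ ?_ ?_ ?_ ha rfl
  · intro j _
    simp
  · intro r _
    rw [Polynomial.algebraMap_apply, Polynomial.coeff_C_zero,
      ExteriorAlgebra.algebraMap_leftInverse, Polynomial.algebraMap_apply]
  · intro j a b _ _ ha hb hj
    conv_lhs => rw [ha hj, hb hj]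
    rw [Polynomial.coeff_add, map_add, map_add]
  · intro u _ j a _ _ h
    omega
  · intro j a _ _ h
    omega

instance finiteDimensional_M (j : ℕ) : FiniteDimensional k (M k m j) := by
  have hfg : ∀ p, FiniteDimensional k (LambdaPart k m p) := by
    intro p
    rw [LambdaPart_eq]
    exact Module.Finite.iff_fg.2 (Submodule.FG.pow
      (Submodule.FG.map _ (Module.Finite.iff_fg.1 inferInstance)) p)
  let N : ℕ → Submodule k (ExtT k m) := fun i => (LambdaPart k m (j - 2 * i)).map
    ((Polynomial.monomial i).restrictScalars k)
  have hle : M k m j ≤ ⨆ i ∈ Finset.range (j + 1), N i := by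
    intro a ha
    rw [a.as_sum_support]
    refine Submodule.sum_mem _ fun i hi => ?_
    rcases le_or_gt (2 * i) j with h | h
    · refine Submodule.mem_iSup_of_mem i (Submodule.mem_iSup_of_mem
        (Finset.mem_range.2 (by omega)) ?_)
      exact ⟨_, (mem_M.1 ha i).1 h, rfl⟩
    · rw [(mem_M.1 ha i).2 h, map_zero]
      exact zero_mem _
  have : FiniteDimensional k (⨆ i ∈ Finset.range (j + 1), N i : Submodule k (ExtT k m)) := by
    rw [← Finset.sup_eq_iSup]
    exact Submodule.finiteDimensional_finset_sup _ _
  exact Submodule.finiteDimensional_of_le hle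

lemma polyD_mem_M {φ : Module.Dual k (V k m ⊗[k] VDual k m)} {t : V k m ⊗[k] VDual k m}
    (ht : t ∈ V2L k m) {j : ℕ} {a : ExtT k m} (ha : a ∈ M k m (j + 1)) :
    polyD φ t a ∈ M k m j := by
  -- The clause for j = 0 stands in for the missing M_{−1}: when a generator multiplies an element
  -- of degree 0, the derivative of that element has to vanish.
  refine (M_induction (P := fun j a => (j = 0 → polyD φ t a = 0) ∧
    ∀ i, j = i + 1 → polyD φ t a ∈ M k m i) ?_ ?_ ?_ ?_ ?_ ha).2 j rfl
  · intro j
    rw [map_zero]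
    exact ⟨fun _ => rfl, fun i _ => zero_mem _⟩
  · intro r
    rw [polyD_algebraMap]
    exact ⟨fun _ => rfl, fun i _ => zero_mem _⟩
  · intro j a b _ _ ha hb
    rw [map_add]
    exact ⟨fun h => by rw [ha.1 h, hb.1 h, add_zero], fun i h => add_mem (ha.2 i h) (hb.2 i h)⟩
  · intro u hu j a ha h
    refine ⟨fun h => by omega, fun i hi => ?_⟩
    obtain rfl : j = i := by omega
    rw [polyD_ι_mul]
    refine sub_mem (Submodule.smul_mem _ _ ha) ?_
    rcases j with _ | j
    · rw [h.1 rfl, mul_zero]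
      exact zero_mem _
    · exact ι_mul_mem_M hu (h.2 j rfl)
  · intro j a ha h
    refine ⟨fun h => by omega, fun i hi => ?_⟩
    obtain rfl : i = j + 1 := by omega
    rw [polyD_X_mul]
    refine add_mem (ι_mul_mem_M ht ha) ?_
    rcases j with _ | j
    · rw [h.1 rfl, mul_zero]
      exact zero_mem _
    · exact X_mul_mem_M (h.2 j rfl)

lemma polyD_eq_zero_of_mem_M_zero (φ : Module.Dual k (V k m ⊗[k] VDual k m))
    (t : V k m ⊗[k] VDual k m) {a : ExtT k m} (ha : a ∈ M k m 0) : polyD φ t a = 0 := by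
  rw [eq_algebraMap_of_mem_M ha, polyD_algebraMap]

lemma polyD_congr {φ φ' : Module.Dual k (V k m ⊗[k] VDual k m)} (t : V k m ⊗[k] VDual k m)
    (h : ∀ u ∈ V2L k m, φ u = φ' u) {j : ℕ} {a : ExtT k m} (ha : a ∈ M k m j) :
    polyD φ t a = polyD φ' t a := by
  refine M_induction (P := fun _ a => polyD φ t a = polyD φ' t a) ?_ ?_ ?_ ?_ ?_ ha
  · intro j
    rw [map_zero, map_zero]
  · intro r
    rw [polyD_algebraMap, polyD_algebraMap]
  · intro j a b _ _ ha hb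
    rw [map_add, map_add, ha, hb]
  · intro u hu j a _ ha
    rw [polyD_ι_mul, polyD_ι_mul, ha, h u hu]
  · intro j a _ ha
    rw [polyD_X_mul, polyD_X_mul, ha]

lemma diff_eq_polyD (y : G k m × G k m) : diff y = polyD (ev y) (cyc y) := rfl

/-! #### The group actions -/

lemma coact_mul (g h : G k m) : coact (g * h) = coact g ∘ₗ coact h := by
  rw [coact, coact, coact, mul_inv_rev, act_mul, LinearMap.dualMap_comp_dualMap]

lemma act_inv_act (g : G k m) (v : V k m) : act g⁻¹ (act g v) = v := by
  rw [← LinearMap.comp_apply, ← act_mul, inv_mul_cancel, act_one, LinearMap.id_apply]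

lemma one_mem_P : (1 : G k m) ∈ P k m := by
  change (V2 k m).map (act 1) = V2 k m
  rw [act_one, Submodule.map_id]

lemma mul_mem_P {p q : G k m} (hp : p ∈ P k m) (hq : q ∈ P k m) : p * q ∈ P k m := by
  change (V2 k m).map (act (p * q)) = V2 k m
  rw [act_mul, Submodule.map_comp, hq, hp]

lemma inv_mem_P {p : G k m} (hp : p ∈ P k m) : p⁻¹ ∈ P k m := by
  change (V2 k m).map (act p⁻¹) = V2 k m
  conv_lhs => rw [← show (V2 k m).map (act p) = V2 k m from hp]
  rw [← Submodule.map_comp, ← act_mul, inv_mul_cancel, act_one, Submodule.map_id]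

lemma act_mem_V2 {p : G k m} (hp : p ∈ P k m) {v : V k m} (hv : v ∈ V2 k m) :
    act p v ∈ V2 k m := by
  rw [← show (V2 k m).map (act p) = V2 k m from hp]
  exact Submodule.mem_map_of_mem hv

lemma coact_mem_L {q : G k m} (hq : q ∈ P k m) {f : VDual k m} (hf : f ∈ L k m) :
    coact q f ∈ L k m := by
  rw [L, Submodule.mem_dualAnnihilator] at *
  exact fun w hw => hf _ (act_mem_V2 (inv_mem_P hq) hw)

lemma vec_inl_mem_V2_zero : (vec (Sum.inl 0) : V k m) ∈ V2 k m :=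
  Submodule.subset_span (by simp)

lemma vec_inl_mem_V2_one : (vec (Sum.inl 1) : V k m) ∈ V2 k m :=
  Submodule.subset_span (by simp)

lemma mem_V2_eq {v : V k m} (hv : v ∈ V2 k m) :
    v = v (Sum.inl 0) • vec (Sum.inl 0) + v (Sum.inl 1) • vec (Sum.inl 1) := by
  obtain ⟨a, b, rfl⟩ := Submodule.mem_span_pair.1 hv
  simp [vec]

lemma mem_V2_iff {v : V k m} : v ∈ V2 k m ↔ ∀ a, a ≠ Sum.inl 0 → a ≠ Sum.inl 1 → v a = 0 := by
  constructor
  · intro hv a h0 h1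
    rw [mem_V2_eq hv]
    simp [vec, h0, h1]
  · intro h
    refine Submodule.mem_span_pair.2 ⟨v (Sum.inl 0), v (Sum.inl 1), ?_⟩
    funext a
    by_cases h0 : a = Sum.inl 0
    · subst h0
      simp [vec]
    · by_cases h1 : a = Sum.inl 1
      · subst h1
        simp [vec]
      · simp [vec, h0, h1, h a h0 h1]

lemma covec_mem_L {a : Idx m} (h0 : a ≠ Sum.inl 0) (h1 : a ≠ Sum.inl 1) :
    (covec a : VDual k m) ∈ L k m := by
  rw [L, Submodule.mem_dualAnnihilator]
  exact fun w hw => mem_V2_iff.1 hw a h0 h1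

lemma covec_inr_mem_L (i : Fin (m + 2)) : (covec (Sum.inr i) : VDual k m) ∈ L k m :=
  covec_mem_L (by simp) (by simp)

lemma cyc_mem_V2L (y : G k m × G k m) : cyc y ∈ V2L k m :=
  Submodule.sum_mem _ fun i _ => tmul_mem_V2L
    (sub_mem (Submodule.smul_mem _ _ vec_inl_mem_V2_one)
      (Submodule.smul_mem _ _ vec_inl_mem_V2_zero)) (covec_inr_mem_L i)

/-- The natural map of `(p, q)` on `V ⊗ V^*`. -/
def actVV (p q : G k m) : V k m ⊗[k] VDual k m →ₗ[k] V k m ⊗[k] VDual k m :=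
  TensorProduct.map (act p) (coact q)

lemma actVV_mem_V2L {p q : G k m} (hp : p ∈ P k m) (hq : q ∈ P k m)
    {u : V k m ⊗[k] VDual k m} (hu : u ∈ V2L k m) : actVV p q u ∈ V2L k m := by
  have : V2L k m ≤ (V2L k m).comap (actVV p q) := by
    refine Submodule.map₂_le.2 fun v hv f hf => ?_
    exact tmul_mem_V2L (act_mem_V2 hp hv) (coact_mem_L hq hf)
  exact this hu

lemma actVV_mul (p q p' q' : G k m) : actVV (p * p') (q * q') = actVV p q ∘ₗ actVV p' q' := by
  rw [actVV, act_mul, coact_mul, TensorProduct.map_comp]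
  rfl

lemma ev_comp_actVV (y : G k m × G k m) (p q : G k m) :
    ev y ∘ₗ actVV p q = ev (y.1 * p, y.2 * q) := by
  rw [ev, ev, LinearMap.comp_assoc]
  congr 1
  exact (actVV_mul _ _ _ _).symm

lemma ev_tmul (y : G k m × G k m) (v : V k m) (f : VDual k m) :
    ev y (v ⊗ₜ f) = f (act (y.2⁻¹ * y.1) v) := by
  rw [act_mul]
  rfl

/-! #### The linear maps `κ` and `wedgeSym` -/

/-- The map `f ⊗ g ↦ φ (v ⊗ f) (w ⊗ g) - φ (w ⊗ f) (v ⊗ g)`. -/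
def kap (φ : Module.Dual k (V k m ⊗[k] VDual k m)) (v w : V k m) :
    VDual k m ⊗[k] VDual k m →ₗ[k] V k m ⊗[k] VDual k m :=
  TensorProduct.mk k _ _ w ∘ₗ (TensorProduct.lid k (VDual k m)).toLinearMap ∘ₗ
      TensorProduct.map (φ ∘ₗ TensorProduct.mk k _ _ v) LinearMap.id
  - TensorProduct.mk k _ _ v ∘ₗ (TensorProduct.lid k (VDual k m)).toLinearMap ∘ₗ
      TensorProduct.map (φ ∘ₗ TensorProduct.mk k _ _ w) LinearMap.id

lemma kap_tmul (φ : Module.Dual k (V k m ⊗[k] VDual k m)) (v w : V k m) (f g : VDual k m) :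
    kap φ v w (f ⊗ₜ g) = φ (v ⊗ₜ f) • (w ⊗ₜ[k] g) - φ (w ⊗ₜ f) • (v ⊗ₜ[k] g) := by
  simp [kap]

/-- Presents t as the contraction of (v_1 ∧ v_2) ⊠ η with ev, so that its behaviour under P × P
follows from bilinearity. -/
lemma cyc_eq_kap (y : G k m × G k m) :
    cyc y = kap (ev y) (vec (Sum.inl 0)) (vec (Sum.inl 1)) eta := by
  rw [cyc, eta, map_sum]
  refine Finset.sum_congr rfl fun i _ => ?_
  rw [kap_tmul, TensorProduct.sub_tmul, TensorProduct.smul_tmul', TensorProduct.smul_tmul']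
  rfl

lemma actVV_kap (φ : Module.Dual k (V k m ⊗[k] VDual k m)) (p q : G k m) (v w : V k m)
    (τ : VDual k m ⊗[k] VDual k m) :
    actVV p q (kap (φ ∘ₗ actVV p q) v w τ) =
      kap φ (act p v) (act p w) (TensorProduct.map (coact q) (coact q) τ) := by
  induction τ with
  | zero => simp only [map_zero]
  | add a b ha hb => simp only [map_add, ha, hb]
  | tmul f g =>
    rw [kap_tmul, TensorProduct.map_tmul, kap_tmul, map_sub, map_smul, map_smul]
    rfl

lemma kap_comb (φ : Module.Dual k (V k m ⊗[k] VDual k m)) (v w : V k m) (a b c d : k)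
    (τ : VDual k m ⊗[k] VDual k m) :
    kap φ (a • v + c • w) (b • v + d • w) τ = (a * d - b * c) • kap φ v w τ := by
  induction τ with
  | zero => simp only [map_zero, smul_zero]
  | add x y hx hy => simp only [map_add, hx, hy, smul_add]
  | tmul f g =>
    simp only [kap_tmul, TensorProduct.add_tmul, ← TensorProduct.smul_tmul', map_add, map_smul,
      smul_eq_mul]
    module

lemma wedgeSym_tmul (v w : V k m) (f g : VDual k m) :
    wedgeSym v w (f ⊗ₜ g) = ExteriorAlgebra.ι k (v ⊗ₜ f) * ExteriorAlgebra.ι k (w ⊗ₜ g) := rfl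

lemma wedgeSym_add_left (v v' w : V k m) (τ : VDual k m ⊗[k] VDual k m) :
    wedgeSym (v + v') w τ = wedgeSym v w τ + wedgeSym v' w τ := by
  induction τ with
  | zero => simp only [map_zero, add_zero]
  | add x y hx hy => simp only [map_add, hx, hy]; abel
  | tmul f g => simp only [wedgeSym_tmul, TensorProduct.add_tmul, map_add, add_mul]

lemma wedgeSym_add_right (v w w' : V k m) (τ : VDual k m ⊗[k] VDual k m) :
    wedgeSym v (w + w') τ = wedgeSym v w τ + wedgeSym v w' τ := by
  induction τ with
  | zero => simp only [map_zero, add_zero]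
  | add x y hx hy => simp only [map_add, hx, hy]; abel
  | tmul f g => simp only [wedgeSym_tmul, TensorProduct.add_tmul, map_add, mul_add]

lemma wedgeSym_smul_left (c : k) (v w : V k m) (τ : VDual k m ⊗[k] VDual k m) :
    wedgeSym (c • v) w τ = c • wedgeSym v w τ := by
  induction τ with
  | zero => simp only [map_zero, smul_zero]
  | add x y hx hy => simp only [map_add, hx, hy, smul_add]
  | tmul f g => simp only [wedgeSym_tmul, ← TensorProduct.smul_tmul', map_smul, smul_mul_assoc]

lemma wedgeSym_smul_right (c : k) (v w : V k m) (τ : VDual k m ⊗[k] VDual k m) :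
    wedgeSym v (c • w) τ = c • wedgeSym v w τ := by
  induction τ with
  | zero => simp only [map_zero, smul_zero]
  | add x y hx hy => simp only [map_add, hx, hy, smul_add]
  | tmul f g => simp only [wedgeSym_tmul, ← TensorProduct.smul_tmul', map_smul, mul_smul_comm]

lemma wedgeSym_swap (v w : V k m) (τ : VDual k m ⊗[k] VDual k m) :
    wedgeSym w v τ = - wedgeSym v w (TensorProduct.comm k _ _ τ) := by
  induction τ with
  | zero => simp only [map_zero, neg_zero]
  | add x y hx hy => simp only [map_add, hx, hy, neg_add]
  | tmul f g => rw [TensorProduct.comm_tmul, wedgeSym_tmul, wedgeSym_tmul, ι_mul_ι_swap]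

lemma wedgeSym_self [CharZero k] (v : V k m) {τ : VDual k m ⊗[k] VDual k m}
    (hτ : TensorProduct.comm k _ _ τ = τ) : wedgeSym v v τ = 0 := by
  have h := wedgeSym_swap v v τ
  rw [hτ] at h
  have h2 : (2 : k) • wedgeSym v v τ = 0 := by
    rw [two_smul]
    exact eq_neg_iff_add_eq_zero.1 h
  exact (smul_eq_zero.1 h2).resolve_left two_ne_zero

/-- On a symmetric tensor the expression is bilinear and alternating in the two vectors, hence
scales by the determinant. -/
lemma wedgeSym_comb [CharZero k] (v w : V k m) (a b c d : k)
    {τ : VDual k m ⊗[k] VDual k m} (hτ : TensorProduct.comm k _ _ τ = τ) :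
    wedgeSym (a • v + c • w) (b • v + d • w) τ = (a * d - b * c) • wedgeSym v w τ := by
  simp only [wedgeSym_add_left, wedgeSym_add_right, wedgeSym_smul_left, wedgeSym_smul_right,
    wedgeSym_self _ hτ, wedgeSym_swap v w, hτ]
  module

lemma commute_wedgeSym (v w : V k m) (τ : VDual k m ⊗[k] VDual k m) (x : Ext k m) :
    Commute (wedgeSym v w τ) x := by
  induction τ with
  | zero => simpa only [map_zero] using Commute.zero_left x
  | add a b ha hb => simpa only [map_add] using ha.add_left hb
  | tmul f g => exact commute_ι_mul_ι _ _ _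

lemma wedgeSym_map_L_mem {v w : V k m} (hv : v ∈ V2 k m) (hw : w ∈ V2 k m)
    (π : VDual k m →ₗ[k] VDual k m) (hπ : ∀ f, π f ∈ L k m) (τ : VDual k m ⊗[k] VDual k m) :
    wedgeSym v w (TensorProduct.map π π τ) ∈ LambdaPart k m 2 := by
  induction τ with
  | zero => simpa only [map_zero] using zero_mem _
  | add a b ha hb => simpa only [map_add] using add_mem ha hb
  | tmul f g =>
    exact mul_mem_LambdaPart (ι_mem_LambdaPart (tmul_mem_V2L hv (hπ f)))
      (ι_mem_LambdaPart (tmul_mem_V2L hw (hπ g)))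

lemma polyD_wedgeSym_mul (φ : Module.Dual k (V k m ⊗[k] VDual k m)) (t : V k m ⊗[k] VDual k m)
    (v w : V k m) (τ : VDual k m ⊗[k] VDual k m) (a : ExtT k m) :
    polyD φ t (Polynomial.C (wedgeSym v w τ) * a) =
      Polynomial.C (ExteriorAlgebra.ι k (TensorProduct.mk k _ _ w
          (TensorProduct.lid k _ (TensorProduct.map (φ ∘ₗ TensorProduct.mk k _ _ v)
            LinearMap.id τ)))
        - ExteriorAlgebra.ι k (TensorProduct.mk k _ _ v (TensorProduct.lid k _
          (TensorProduct.map (φ ∘ₗ TensorProduct.mk k _ _ w) LinearMap.id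
            (TensorProduct.comm k _ _ τ))))) * a
      + Polynomial.C (wedgeSym v w τ) * polyD φ t a := by
  induction τ with
  | zero => simp only [map_zero, zero_mul, sub_zero, add_zero]
  | add x y hx hy =>
    simp only [map_add, add_mul, hx, hy, map_sub, sub_mul]
    abel
  | tmul f g =>
    rw [wedgeSym_tmul, polyD_ι_mul_ι_mul]
    simp

lemma polyD_wedgeSym_mul_of_comm (φ : Module.Dual k (V k m ⊗[k] VDual k m))
    (t : V k m ⊗[k] VDual k m) (v w : V k m) {τ : VDual k m ⊗[k] VDual k m}
    (hτ : TensorProduct.comm k _ _ τ = τ) (a : ExtT k m) :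
    polyD φ t (Polynomial.C (wedgeSym v w τ) * a) =
      Polynomial.C (ExteriorAlgebra.ι k (kap φ v w τ)) * a
      + Polynomial.C (wedgeSym v w τ) * polyD φ t a := by
  rw [polyD_wedgeSym_mul, hτ, ← map_sub (ExteriorAlgebra.ι k)]
  rfl

end Equivariance

/-! ### The action of `P × P` on `Λ[T]` -/

section Rho

variable {k : Type*} [Field k] {m : ℕ}

/-- The evaluation of a tensor in `V^* ⊗ V^*` at a pair of vectors. -/
def pairing (τ : VDual k m ⊗[k] VDual k m) (v w : V k m) : k :=
  TensorProduct.dualDistrib k (V k m) (V k m) τ (v ⊗ₜ w)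

lemma pairing_tmul (f g : VDual k m) (v w : V k m) : pairing (f ⊗ₜ[k] g) v w = f v * g w := rfl

lemma pairing_sub (τ τ' : VDual k m ⊗[k] VDual k m) (v w : V k m) :
    pairing (τ - τ') v w = pairing τ v w - pairing τ' v w := by
  simp [pairing]

lemma pairing_ext {τ τ' : VDual k m ⊗[k] VDual k m}
    (h : ∀ v w, pairing τ v w = pairing τ' v w) : τ = τ' := by
  refine (TensorProduct.dualDistribEquiv k (V k m) (V k m)).injective ?_
  exact TensorProduct.ext' h

lemma pairing_comm (τ : VDual k m ⊗[k] VDual k m) (v w : V k m) :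
    pairing (TensorProduct.comm k _ _ τ) v w = pairing τ w v := by
  induction τ with
  | zero => simp [pairing]
  | add a b ha hb =>
    simp only [pairing, map_add, LinearMap.add_apply] at *
    rw [ha, hb]
  | tmul f g => rw [TensorProduct.comm_tmul, pairing_tmul, pairing_tmul, mul_comm]

lemma pairing_map_dualMap (α : V k m →ₗ[k] V k m) (τ : VDual k m ⊗[k] VDual k m) (v w : V k m) :
    pairing (TensorProduct.map α.dualMap α.dualMap τ) v w = pairing τ (α v) (α w) := by
  induction τ with
  | zero => simp [pairing]
  | add a b ha hb =>
    simp only [pairing, map_add, LinearMap.add_apply] at *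
    rw [ha, hb]
  | tmul f g => rfl

lemma pairing_add_left (τ : VDual k m ⊗[k] VDual k m) (v v' w : V k m) :
    pairing τ (v + v') w = pairing τ v w + pairing τ v' w := by
  simp [pairing, TensorProduct.add_tmul]

lemma pairing_add_right (τ : VDual k m ⊗[k] VDual k m) (v w w' : V k m) :
    pairing τ v (w + w') = pairing τ v w + pairing τ v w' := by
  simp [pairing, TensorProduct.tmul_add]

lemma form_eq_sum (v w : V k m) :
    form v w = ∑ i, (v (Sum.inl i) * w (Sum.inr i) - v (Sum.inr i) * w (Sum.inl i)) := by
  simp [form, Matrix.J, dotProduct, Matrix.mulVec, Matrix.fromBlocks, Fintype.sum_sum_type,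
    Matrix.one_apply, Finset.sum_add_distrib, sub_eq_add_neg]

lemma pairing_eta (v w : V k m) : pairing eta v w = ∑ i, v (Sum.inl i) * w (Sum.inr i) := by
  simp only [pairing, eta, map_sum, LinearMap.sum_apply]
  rfl

lemma pairing_eta_swap (v w : V k m) : pairing eta v w = pairing eta w v + form v w := by
  rw [pairing_eta, pairing_eta, form_eq_sum, ← Finset.sum_add_distrib]
  exact Finset.sum_congr rfl fun i _ => by ring

/-- The tensor `q η - η`. -/
def etaDiff (q : G k m) : VDual k m ⊗[k] VDual k m :=
  TensorProduct.map (coact q) (coact q) eta - eta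

lemma pairing_etaDiff (q : G k m) (v w : V k m) :
    pairing (etaDiff q) v w = pairing eta (act q⁻¹ v) (act q⁻¹ w) - pairing eta v w := by
  rw [etaDiff, pairing_sub, coact, pairing_map_dualMap]

/-- The antisymmetrization of η is the symplectic form, which q preserves; it therefore cancels in
qη − η. -/
lemma comm_etaDiff (q : G k m) : TensorProduct.comm k _ _ (etaDiff q) = etaDiff q := by
  refine pairing_ext fun v w => ?_
  rw [pairing_comm, pairing_etaDiff, pairing_etaDiff, pairing_eta_swap v w,
    pairing_eta_swap (act q⁻¹ v), form_act]
  ring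

lemma pairing_eta_right {w : V k m} (hw : w ∈ V2 k m) (v : V k m) : pairing eta v w = 0 := by
  rw [pairing_eta]
  refine Finset.sum_eq_zero fun i _ => ?_
  rw [mem_V2_iff.1 hw (Sum.inr i) (by simp) (by simp), mul_zero]

lemma pairing_etaDiff_right {q : G k m} (hq : q ∈ P k m) {w : V k m} (hw : w ∈ V2 k m)
    (v : V k m) : pairing (etaDiff q) v w = 0 := by
  rw [pairing_etaDiff, pairing_eta_right hw, pairing_eta_right (act_mem_V2 (inv_mem_P hq) hw),
    sub_zero]

lemma pairing_etaDiff_left {q : G k m} (hq : q ∈ P k m) {v : V k m} (hv : v ∈ V2 k m)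
    (w : V k m) : pairing (etaDiff q) v w = 0 := by
  rw [← comm_etaDiff, pairing_comm, pairing_etaDiff_right hq hv]

/-- The projection of `V` that kills `V_2` and fixes the other basis vectors. -/
def projV2 : V k m →ₗ[k] V k m :=
  LinearMap.id - (LinearMap.toSpanSingleton k _ (vec (Sum.inl 0)) ∘ₗ covec (Sum.inl 0) +
    LinearMap.toSpanSingleton k _ (vec (Sum.inl 1)) ∘ₗ covec (Sum.inl 1))

lemma projV2_apply (v : V k m) : projV2 v =
    v - (v (Sum.inl 0) • vec (Sum.inl 0) + v (Sum.inl 1) • vec (Sum.inl 1)) := rfl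

lemma eq_projV2_add (v : V k m) : ∃ w ∈ V2 k m, v = projV2 v + w :=
  ⟨v (Sum.inl 0) • vec (Sum.inl 0) + v (Sum.inl 1) • vec (Sum.inl 1),
    add_mem (Submodule.smul_mem _ _ vec_inl_mem_V2_zero)
      (Submodule.smul_mem _ _ vec_inl_mem_V2_one), by rw [projV2_apply, sub_add_cancel]⟩

lemma projV2_of_mem {v : V k m} (hv : v ∈ V2 k m) : projV2 v = 0 := by
  rw [projV2_apply, ← mem_V2_eq hv, sub_self]

/-- As a bilinear form, qη − η vanishes when either argument lies in V_2: η does so in its second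
argument, q preserves V_2, and symmetry gives the first. Hence it factors through V/V_2 on both
sides. -/
lemma etaDiff_eq_map {q : G k m} (hq : q ∈ P k m) :
    TensorProduct.map (projV2 (k := k) (m := m)).dualMap (projV2 (k := k) (m := m)).dualMap
      (etaDiff q) = etaDiff q := by
  refine pairing_ext fun v w => ?_
  rw [pairing_map_dualMap]
  obtain ⟨v', hv', hv⟩ := eq_projV2_add v
  obtain ⟨w', hw', hw⟩ := eq_projV2_add w
  conv_rhs => rw [hv, hw]
  rw [pairing_add_left, pairing_add_right, pairing_etaDiff_left hq hv',
    pairing_etaDiff_right hq hw', add_zero, add_zero]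

lemma wedgeSym_etaDiff_mem {q : G k m} (hq : q ∈ P k m) {v w : V k m} (hv : v ∈ V2 k m)
    (hw : w ∈ V2 k m) : wedgeSym v w (etaDiff q) ∈ LambdaPart k m 2 := by
  rw [← etaDiff_eq_map hq]
  refine wedgeSym_map_L_mem hv hw _ (fun f => ?_) _
  rw [L, Submodule.mem_dualAnnihilator]
  intro u hu
  rw [LinearMap.dualMap_apply, projV2_of_mem hu, map_zero]

lemma actT_eq (p q : G k m) : actT p q =
    detV2 p • Polynomial.X + Polynomial.C (wedgeSym (act p (vec (Sum.inl 0)))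
      (act p (vec (Sum.inl 1))) (etaDiff q)) := by
  rw [actT, ← Polynomial.algebraMap_apply, Algebra.smul_def]
  rfl

/-- T and products of two odd elements are central. Centrality is what makes the substitution T ↦
`actT p q` multiplicative. -/
lemma commute_actT (p q : G k m) (w : Ext k m) : Commute (Polynomial.C w) (actT p q) := by
  rw [actT_eq]
  refine Commute.add_right (Commute.smul_right (Polynomial.commute_X _).symm _) ?_
  exact ((commute_wedgeSym _ _ _ w).map Polynomial.C).symm

/-- The action of `(p, q)` as an algebra endomorphism. -/
def rhoHom (p q : G k m) : ExtT k m →ₐ[k] ExtT k m :=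
  { Polynomial.eval₂RingHom' (Polynomial.C.comp
      (ExteriorAlgebra.map (TensorProduct.map (act p) (coact q))).toRingHom) (actT p q)
      (fun w => commute_actT p q _) with
    commutes' := fun r => by
      change Polynomial.eval₂ _ _ (algebraMap k (ExtT k m) r) = _
      rw [Polynomial.algebraMap_apply, Polynomial.eval₂_C]
      exact congrArg Polynomial.C (AlgHom.commutes _ r) }

lemma rho_eq (p q : G k m) (a : ExtT k m) : rho p q a = rhoHom p q a := rfl

lemma rhoHom_ι (p q : G k m) (u : V k m ⊗[k] VDual k m) :
    rhoHom p q (Polynomial.C (ExteriorAlgebra.ι k u)) =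
      Polynomial.C (ExteriorAlgebra.ι k (actVV p q u)) := by
  rw [← rho_eq, rho, Polynomial.eval₂_C]
  exact congrArg Polynomial.C (ExteriorAlgebra.map_apply_ι _ u)

lemma rhoHom_X (p q : G k m) : rhoHom p q Polynomial.X = actT p q := by
  rw [← rho_eq, rho, Polynomial.eval₂_X]

lemma rhoHom_wedgeSym (p q : G k m) (v w : V k m) (τ : VDual k m ⊗[k] VDual k m) :
    rhoHom p q (Polynomial.C (wedgeSym v w τ)) =
      Polynomial.C (wedgeSym (act p v) (act p w) (TensorProduct.map (coact q) (coact q) τ)) := by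
  induction τ with
  | zero => simp only [map_zero]
  | add a b ha hb => simp only [map_add, ha, hb]
  | tmul f g =>
    rw [wedgeSym_tmul, Polynomial.C_mul, map_mul, rhoHom_ι, rhoHom_ι, ← Polynomial.C_mul]
    rfl

lemma act_vec_zero {p : G k m} (hp : p ∈ P k m) : act p (vec (Sum.inl 0)) =
    act p (vec (Sum.inl 0)) (Sum.inl 0) • vec (Sum.inl 0) +
      act p (vec (Sum.inl 0)) (Sum.inl 1) • vec (Sum.inl 1) :=
  mem_V2_eq (act_mem_V2 hp vec_inl_mem_V2_zero)

lemma act_vec_one {p : G k m} (hp : p ∈ P k m) : act p (vec (Sum.inl 1)) =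
    act p (vec (Sum.inl 1)) (Sum.inl 0) • vec (Sum.inl 0) +
      act p (vec (Sum.inl 1)) (Sum.inl 1) • vec (Sum.inl 1) :=
  mem_V2_eq (act_mem_V2 hp vec_inl_mem_V2_one)

lemma act_mul_vec_zero (g : G k m) {p : G k m} (hp : p ∈ P k m) :
    act (g * p) (vec (Sum.inl 0)) =
    act p (vec (Sum.inl 0)) (Sum.inl 0) • act g (vec (Sum.inl 0)) +
      act p (vec (Sum.inl 0)) (Sum.inl 1) • act g (vec (Sum.inl 1)) := by
  rw [act_mul, LinearMap.comp_apply]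
  conv_lhs => rw [act_vec_zero hp]
  rw [map_add, map_smul, map_smul]

lemma act_mul_vec_one (g : G k m) {p : G k m} (hp : p ∈ P k m) :
    act (g * p) (vec (Sum.inl 1)) =
    act p (vec (Sum.inl 1)) (Sum.inl 0) • act g (vec (Sum.inl 0)) +
      act p (vec (Sum.inl 1)) (Sum.inl 1) • act g (vec (Sum.inl 1)) := by
  rw [act_mul, LinearMap.comp_apply]
  conv_lhs => rw [act_vec_one hp]
  rw [map_add, map_smul, map_smul]

lemma detV2_mul (g : G k m) {p : G k m} (hp : p ∈ P k m) :
    detV2 (g * p) = detV2 g * detV2 p := by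
  rw [detV2, act_mul_vec_zero g hp, act_mul_vec_one g hp, detV2, detV2]
  simp only [Pi.add_apply, Pi.smul_apply, smul_eq_mul]
  ring

/-- On T this is the cocycle identity qq'η − η = q(q'η − η) + (qη − η). The last term arrives with
the factor det p', which is absorbed by replacing p v_1, p v_2 with pp' v_1, pp' v_2. -/
lemma rhoHom_comp [CharZero k] (p q : G k m) {p' : G k m} (hp' : p' ∈ P k m) (q' : G k m)
    (a : ExtT k m) :
    rhoHom p q (rhoHom p' q' a) = rhoHom (p * p') (q * q') a := by
  induction a using polyExt_induction with
  | algebraMap r => simp only [AlgHom.commutes]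
  | add a b ha hb => simp only [map_add, ha, hb]
  | ι_mul u a ha =>
    simp only [map_mul, ha, rhoHom_ι, actVV_mul, LinearMap.comp_apply]
  | X_mul a ha =>
    rw [map_mul, map_mul, map_mul, ha, rhoHom_X, rhoHom_X]
    congr 1
    rw [actT_eq, actT_eq, map_add, map_smul, rhoHom_X, rhoHom_wedgeSym, detV2_mul p hp', actT_eq,
      smul_add, smul_smul, mul_comm (detV2 p') (detV2 p), add_assoc]
    congr 1
    rw [Polynomial.smul_C, ← Polynomial.C_add]
    congr 1
    have h1 : act p (act p' (vec (Sum.inl 0))) = act (p * p') (vec (Sum.inl 0)) := by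
      rw [act_mul, LinearMap.comp_apply]
    have h2 : act p (act p' (vec (Sum.inl 1))) = act (p * p') (vec (Sum.inl 1)) := by
      rw [act_mul, LinearMap.comp_apply]
    have h3 : detV2 p' • wedgeSym (act p (vec (Sum.inl 0))) (act p (vec (Sum.inl 1))) (etaDiff q)
        = wedgeSym (act (p * p') (vec (Sum.inl 0))) (act (p * p') (vec (Sum.inl 1)))
          (etaDiff q) := by
      rw [act_mul_vec_zero p hp', act_mul_vec_one p hp', wedgeSym_comb _ _ _ _ _ _ (comm_etaDiff q)]
      rfl
    rw [h1, h2, h3, ← map_add]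
    congr 1
    rw [etaDiff, etaDiff, etaDiff, map_sub, coact_mul, TensorProduct.map_comp,
      LinearMap.comp_apply]
    abel

/-- Only T needs thought. The symmetry of qη − η turns the derivative of the quadratic correction
into a single `kap` term, and this is the amount by which the image of t at (gp, hq) differs from
det(p)·t at (g, h). -/
lemma diff_rhoHom (y : G k m × G k m) {p : G k m} (hp : p ∈ P k m) (q : G k m) (a : ExtT k m) :
    diff y (rhoHom p q a) = rhoHom p q (diff (y.1 * p, y.2 * q) a) := by
  rw [diff_eq_polyD, diff_eq_polyD]
  refine polyD_algHom (rhoHom p q) (actVV p q) (rhoHom_ι p q) (ev_comp_actVV y p q) ?_ a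
  intro b
  rw [rhoHom_X, actT_eq, add_mul, map_add, smul_mul_assoc, map_smul, polyD_X_mul,
    polyD_wedgeSym_mul_of_comm _ _ _ _ (comm_etaDiff q)]
  have h : actVV p q (cyc (y.1 * p, y.2 * q)) = detV2 p • cyc y +
      kap (ev y) (act p (vec (Sum.inl 0))) (act p (vec (Sum.inl 1))) (etaDiff q) := by
    rw [cyc_eq_kap, ← ev_comp_actVV, actVV_kap, cyc_eq_kap, etaDiff, map_sub]
    have : kap (ev y) (act p (vec (Sum.inl 0))) (act p (vec (Sum.inl 1))) eta =
        detV2 p • kap (ev y) (vec (Sum.inl 0)) (vec (Sum.inl 1)) eta := by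
      conv_lhs => rw [act_vec_zero hp, act_vec_one hp]
      rw [kap_comb]
      rfl
    rw [this]
    abel
  rw [h, map_add, map_smul, Polynomial.C_add, ← Polynomial.smul_C, add_mul, add_mul,
    smul_mul_assoc, smul_mul_assoc, smul_add]
  abel

lemma actT_mul_mem_M {p q : G k m} (hp : p ∈ P k m) (hq : q ∈ P k m) {j : ℕ} {a : ExtT k m}
    (ha : a ∈ M k m j) : actT p q * a ∈ M k m (j + 2) := by
  rw [actT_eq, add_mul, smul_mul_assoc]
  refine add_mem (Submodule.smul_mem _ _ (X_mul_mem_M ha)) ?_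
  rw [add_comm]
  exact C_mul_mem_M (wedgeSym_etaDiff_mem hq (act_mem_V2 hp vec_inl_mem_V2_zero)
    (act_mem_V2 hp vec_inl_mem_V2_one)) ha

lemma rhoHom_mem_M {p q : G k m} (hp : p ∈ P k m) (hq : q ∈ P k m) {j : ℕ} {a : ExtT k m}
    (ha : a ∈ M k m j) : rhoHom p q a ∈ M k m j := by
  refine M_induction (P := fun j a => rhoHom p q a ∈ M k m j) ?_ ?_ ?_ ?_ ?_ ha
  · intro j
    rw [map_zero]
    exact zero_mem _
  · intro r
    rw [AlgHom.commutes]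
    exact algebraMap_mem_M r
  · intro j a b _ _ ha hb
    rw [map_add]
    exact add_mem ha hb
  · intro u hu j a _ ha
    rw [map_mul, rhoHom_ι]
    exact ι_mul_mem_M (actVV_mem_V2L hp hq hu) ha
  · intro j a _ ha
    rw [map_mul, rhoHom_X]
    exact actT_mul_mem_M hp hq ha

/-! #### `d` is a differential that only depends on `h⁻¹ g` -/

lemma ev_congr {y y' : G k m × G k m} (h : y.2⁻¹ * y.1 = y'.2⁻¹ * y'.1) : ev y = ev y' := by
  refine TensorProduct.ext' fun v f => ?_
  rw [ev_tmul, ev_tmul, h]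

lemma diff_congr {y y' : G k m × G k m} (h : y.2⁻¹ * y.1 = y'.2⁻¹ * y'.1) :
    diff y = diff y' := by
  rw [diff_eq_polyD, diff_eq_polyD, cyc_eq_kap, cyc_eq_kap, ev_congr h]

/-- Evaluating t gives, term by term, the symplectic product of the images of v_1 and v_2 under
h⁻¹g; these are orthogonal because V_2 is isotropic. -/
lemma ev_cyc (y : G k m × G k m) : ev y (cyc y) = 0 := by
  have h : form (act (y.2⁻¹ * y.1) (vec (Sum.inl 0)) : V k m)
      (act (y.2⁻¹ * y.1) (vec (Sum.inl 1))) = 0 := by rw [form_act, form_vec_inl]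
  rw [form_eq_sum] at h
  rw [cyc_eq_kap, eta, map_sum, map_sum, ← h]
  refine Finset.sum_congr rfl fun i _ => ?_
  rw [kap_tmul, map_sub, map_smul, map_smul, ev_tmul, ev_tmul, ev_tmul, ev_tmul, smul_eq_mul,
    smul_eq_mul]
  simp only [covec, LinearMap.proj_apply]
  ring

lemma diff_diff (y : G k m × G k m) (a : ExtT k m) : diff y (diff y a) = 0 :=
  polyD_polyD _ _ (ev_cyc y) a

lemma diff_mem_M (y : G k m × G k m) {j : ℕ} {a : ExtT k m} (ha : a ∈ M k m (j + 1)) :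
    diff y a ∈ M k m j := polyD_mem_M (cyc_mem_V2L y) ha

end Rho

/-! ### A homotopy for the Koszul complex of a regular system of coordinates -/

section Euler

/-- The operator E = dδ + δd commutes with d, so d preserves its eigenspaces. By their independence
a cycle has only cycles g_w as eigencomponents; then (w+1) g_w = dδ g_w, and the positive eigenvalue
can be divided out. -/
lemma exists_primitive_of_euler {k F : Type*} [Field k] [CharZero k] [AddCommGroup F] [Module k F]
    (d δ : Module.End k F) (hd : ∀ x, d (d x) = 0) {N N' : Submodule k F}
    (hδ : ∀ x ∈ N, δ x ∈ N') {f : F}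
    (hf : f ∈ ⨆ w : ℕ, (Module.End.eigenspace (d * δ + δ * d) ((w + 1 : ℕ) : k) ⊓ N))
    (hdf : d f = 0) : ∃ b ∈ N', d b = f := by
  obtain ⟨g, hg, rfl⟩ := (Submodule.mem_iSup_iff_exists_finsupp _ _).1 hf
  have hE : ∀ w, (d * δ + δ * d) (g w) = ((w + 1 : ℕ) : k) • g w := fun w =>
    Module.End.mem_eigenspace_iff.1 (hg w).1
  have hind : iSupIndep fun w : ℕ =>
      Module.End.eigenspace (d * δ + δ * d) ((w + 1 : ℕ) : k) :=
    (Module.End.eigenspaces_iSupIndep (d * δ + δ * d)).comp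
      (f := fun w : ℕ => ((w + 1 : ℕ) : k)) fun a b hab => by
        have := Nat.cast_injective (R := k) hab
        omega
  have hmem : ∀ w ∈ g.support, d (g w) ∈
      Module.End.eigenspace (d * δ + δ * d) ((w + 1 : ℕ) : k) := by
    intro w _
    rw [Module.End.mem_eigenspace_iff, ← map_smul, ← hE w]
    simp only [LinearMap.add_apply, Module.End.mul_apply, map_add, hd, map_zero, zero_add, add_zero]
  have hzero := (iSupIndep_iff_finsetSum_eq_zero_imp_eq_zero _).1 hind g.support
    (fun w => d (g w)) hmem (by rw [← map_sum]; exact hdf)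
  refine ⟨∑ w ∈ g.support, ((w + 1 : ℕ) : k)⁻¹ • δ (g w),
    Submodule.sum_mem _ fun w _ => Submodule.smul_mem _ _ (hδ _ (hg w).2), ?_⟩
  rw [map_sum]
  refine Finset.sum_congr rfl fun w hw => ?_
  have h := hE w
  simp only [LinearMap.add_apply, Module.End.mul_apply] at h
  rw [hzero w hw, map_zero, add_zero] at h
  rw [map_smul, h, smul_smul, inv_mul_cancel₀ (Nat.cast_ne_zero.2 (Nat.succ_ne_zero w)), one_smul]

end Euler

/-! ### Superposition and anticommutation of skew derivations -/

section PolyExt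

variable {k U : Type*} [Field k] [AddCommGroup U] [Module k U]

lemma polyD_add (φ φ' : Module.Dual k U) (t t' : U) (a : Polynomial (ExteriorAlgebra k U)) :
    polyD (φ + φ') (t + t') a = polyD φ t a + polyD φ' t' a := by
  ext1 i
  simp only [polyD_coeff, map_add, LinearMap.add_apply, Polynomial.coeff_add, add_mul, smul_add]
  abel

lemma polyD_sum {σ : Type*} (S : Finset σ) (c : σ → k) (φ : σ → Module.Dual k U)
    (a : Polynomial (ExteriorAlgebra k U)) :
    polyD (∑ i ∈ S, c i • φ i) 0 a = ∑ i ∈ S, c i • polyD (φ i) 0 a := by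
  ext1 n
  simp only [polyD_coeff, map_zero, zero_mul, smul_zero, add_zero, map_sum, LinearMap.sum_apply,
    Polynomial.finsetSum_coeff, map_smul, LinearMap.smul_apply, Polynomial.coeff_smul]

/-- Polarization of the fact that every contraction has square zero. -/
lemma polyD_contract_anticomm (φ ψ : Module.Dual k U) (a : Polynomial (ExteriorAlgebra k U)) :
    polyD φ 0 (polyD ψ 0 a) = - polyD ψ 0 (polyD φ 0 a) := by
  have h1 := polyD_polyD (φ + ψ) 0 (LinearMap.map_zero _) a
  have h2 : ∀ b, polyD (φ + ψ) 0 b = polyD φ 0 b + polyD ψ 0 b := fun b => by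
    rw [← polyD_add, add_zero]
  rw [h2, h2, map_add, map_add, polyD_polyD φ 0 (LinearMap.map_zero φ),
    polyD_polyD ψ 0 (LinearMap.map_zero ψ), zero_add, add_zero] at h1
  exact eq_neg_of_add_eq_zero_left h1

lemma polyD_zero_X_mul (φ : Module.Dual k U) (a : Polynomial (ExteriorAlgebra k U)) :
    polyD φ 0 (Polynomial.X * a) = Polynomial.X * polyD φ 0 a := by
  rw [polyD_X_mul, map_zero, Polynomial.C_0, zero_mul, zero_add]

lemma polyD_zero_ι_mul (t u : U) (a : Polynomial (ExteriorAlgebra k U)) :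
    polyD 0 t (Polynomial.C (ExteriorAlgebra.ι k u) * a) =
      -(Polynomial.C (ExteriorAlgebra.ι k u) * polyD 0 t a) := by
  rw [polyD_ι_mul, LinearMap.zero_apply, zero_smul, zero_sub]

lemma C_ι_smul_mul (c : k) (u : U) (a : Polynomial (ExteriorAlgebra k U)) :
    Polynomial.C (ExteriorAlgebra.ι k (c • u)) * a =
      c • (Polynomial.C (ExteriorAlgebra.ι k u) * a) := by
  rw [map_smul, ← Polynomial.smul_C, smul_mul_assoc]

lemma X_mul_C_mul (w : ExteriorAlgebra k U) (a : Polynomial (ExteriorAlgebra k U)) :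
    Polynomial.X * (Polynomial.C w * a) = Polynomial.C w * (Polynomial.X * a) := by
  rw [← mul_assoc, Polynomial.X_mul_C, mul_assoc]

end PolyExt

/-! ### Frames, the number operator and the homotopy on polynomial maps -/

variable {k : Type*} [Field k] {m : ℕ} {σ : Type*}

variable (k m σ) in
/-- Dual bases `(u_i)_{i ∈ S}, e` and `(φ_i)_{i ∈ S}, ε` of `V_2 ⊗ (V/V_2)^*`. -/
structure Frame (S : Finset σ) where
  /-- basis vectors -/
  u : σ → V k m ⊗[k] VDual k m
  /-- coordinates -/
  φ : σ → Module.Dual k (V k m ⊗[k] VDual k m)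
  /-- the distinguished basis vector -/
  e : V k m ⊗[k] VDual k m
  /-- the distinguished coordinate -/
  ε : Module.Dual k (V k m ⊗[k] VDual k m)
  φ_u_self : ∀ i ∈ S, φ i (u i) = 1
  φ_u_ne : ∀ i ∈ S, ∀ j ∈ S, i ≠ j → φ i (u j) = 0
  φ_e : ∀ i ∈ S, φ i e = 0
  ε_e : ε e = 1
  u_mem : ∀ i ∈ S, u i ∈ V2L k m
  e_mem : e ∈ V2L k m
  repr : ∀ w ∈ V2L k m, ∑ i ∈ S, φ i w • u i + ε w • e = w

namespace Frame

variable {S : Finset σ} (B : Frame k m σ S)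

/-- The part `T ι_ε` of the homotopy. -/
def homT : ExtT k m →ₗ[k] ExtT k m := LinearMap.mulLeft k Polynomial.X ∘ₗ polyD B.ε 0

lemma homT_apply (a : ExtT k m) : B.homT a = Polynomial.X * polyD B.ε 0 a := rfl

lemma homT_ι_mul (u : V k m ⊗[k] VDual k m) (a : ExtT k m) :
    B.homT (Polynomial.C (ExteriorAlgebra.ι k u) * a) =
      B.ε u • (Polynomial.X * a) - Polynomial.C (ExteriorAlgebra.ι k u) * B.homT a := by
  rw [homT_apply, polyD_ι_mul, mul_sub, mul_smul_comm, X_mul_C_mul]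
  rfl

lemma homT_X_mul (a : ExtT k m) : B.homT (Polynomial.X * a) = Polynomial.X * B.homT a := by
  rw [homT_apply, polyD_zero_X_mul]
  rfl

/-- The anticommutator of e ∂_T and T ι_ε is the even derivation e ι_ε + T ∂_T; this is its Leibniz
rule for the factor u. -/
lemma anticomm_homT_ι_mul (u : V k m ⊗[k] VDual k m) (a : ExtT k m) :
    polyD 0 B.e (B.homT (Polynomial.C (ExteriorAlgebra.ι k u) * a)) +
      B.homT (polyD 0 B.e (Polynomial.C (ExteriorAlgebra.ι k u) * a)) =
      Polynomial.C (ExteriorAlgebra.ι k (B.ε u • B.e)) * a +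
      Polynomial.C (ExteriorAlgebra.ι k u) *
        (polyD 0 B.e (B.homT a) + B.homT (polyD 0 B.e a)) := by
  have h1 : polyD 0 B.e (B.homT (Polynomial.C (ExteriorAlgebra.ι k u) * a)) =
      B.ε u • (Polynomial.C (ExteriorAlgebra.ι k B.e) * a + Polynomial.X * polyD 0 B.e a) +
        Polynomial.C (ExteriorAlgebra.ι k u) * polyD 0 B.e (B.homT a) := by
    rw [homT_ι_mul, LinearMap.map_sub, LinearMap.map_smul, polyD_X_mul, polyD_zero_ι_mul,
      sub_neg_eq_add]
  have h2 : B.homT (polyD 0 B.e (Polynomial.C (ExteriorAlgebra.ι k u) * a)) =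
      Polynomial.C (ExteriorAlgebra.ι k u) * B.homT (polyD 0 B.e a) -
        B.ε u • (Polynomial.X * polyD 0 B.e a) := by
    rw [polyD_zero_ι_mul, LinearMap.map_neg, homT_ι_mul, neg_sub]
  rw [h1, h2, C_ι_smul_mul, mul_add, smul_add]
  abel

/-- The operator that counts the factors of a monomial in the `u_i`, `e` and `T`. -/
def number : ExtT k m →ₗ[k] ExtT k m :=
  ∑ i ∈ S, LinearMap.mulLeft k (Polynomial.C (ExteriorAlgebra.ι k (B.u i))) ∘ₗ polyD (B.φ i) 0 +
    (polyD 0 B.e ∘ₗ B.homT + B.homT ∘ₗ polyD 0 B.e)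

lemma number_apply (a : ExtT k m) : B.number a =
    ∑ i ∈ S, Polynomial.C (ExteriorAlgebra.ι k (B.u i)) * polyD (B.φ i) 0 a +
      (polyD 0 B.e (B.homT a) + B.homT (polyD 0 B.e a)) := by
  simp [number]

lemma number_algebraMap (r : k) : B.number (algebraMap k _ r) = 0 := by
  rw [number_apply, homT_apply, homT_apply, polyD_algebraMap, polyD_algebraMap, mul_zero, map_zero,
    map_zero, mul_zero, add_zero, add_zero]
  exact Finset.sum_eq_zero fun i _ => by rw [polyD_algebraMap, mul_zero]

/-- Each summand of the operator acts as an even derivation that sends u to one of its components in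
the frame, and the components add up to u. -/
lemma number_ι_mul {u : V k m ⊗[k] VDual k m} (hu : u ∈ V2L k m) (a : ExtT k m) :
    B.number (Polynomial.C (ExteriorAlgebra.ι k u) * a) =
      Polynomial.C (ExteriorAlgebra.ι k u) * a +
        Polynomial.C (ExteriorAlgebra.ι k u) * B.number a := by
  have h1 : ∀ i, Polynomial.C (ExteriorAlgebra.ι k (B.u i)) *
      polyD (B.φ i) 0 (Polynomial.C (ExteriorAlgebra.ι k u) * a) =
      Polynomial.C (ExteriorAlgebra.ι k (B.φ i u • B.u i)) * a +
      Polynomial.C (ExteriorAlgebra.ι k u) * (Polynomial.C (ExteriorAlgebra.ι k (B.u i)) *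
        polyD (B.φ i) 0 a) := by
    intro i
    rw [polyD_ι_mul, mul_sub, mul_smul_comm, C_ι_smul_mul,
      ← mul_assoc (Polynomial.C _) (Polynomial.C _), ← Polynomial.C_mul, ι_mul_ι_swap,
      Polynomial.C_neg, neg_mul, sub_neg_eq_add, Polynomial.C_mul, mul_assoc]
  have h3 : Polynomial.C (ExteriorAlgebra.ι k u) * a =
      ∑ i ∈ S, Polynomial.C (ExteriorAlgebra.ι k (B.φ i u • B.u i)) * a +
        Polynomial.C (ExteriorAlgebra.ι k (B.ε u • B.e)) * a := by
    conv_lhs => rw [← B.repr u hu]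
    rw [map_add, map_sum, map_add, map_sum, add_mul, Finset.sum_mul]
  rw [number_apply, number_apply, Finset.sum_congr rfl fun i _ => h1 i, B.anticomm_homT_ι_mul,
    Finset.sum_add_distrib, ← Finset.mul_sum]
  simp only [mul_add]
  conv_rhs => rw [h3]
  abel

lemma number_X_mul (a : ExtT k m) :
    B.number (Polynomial.X * a) = Polynomial.X * a + Polynomial.X * B.number a := by
  rw [number_apply, number_apply]
  simp only [homT_X_mul, polyD_X_mul, map_add, homT_ι_mul, B.ε_e, one_smul, mul_add,
    map_zero, zero_mul, zero_add, X_mul_C_mul, Finset.mul_sum]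
  abel

/-- A product of w factors has degree at most 2w, since T has degree 2. The bound j ≤ 2w is recorded
because it forces w ≥ 1 as soon as j ≥ 1. -/
lemma mem_iSup_number {j : ℕ} {a : ExtT k m} (ha : a ∈ M k m j) :
    a ∈ ⨆ w : ℕ, (⨆ _ : j ≤ 2 * w, (Module.End.eigenspace B.number (w : k) ⊓ M k m j)) := by
  refine M_induction (P := fun j a => a ∈ ⨆ w : ℕ, (⨆ _ : j ≤ 2 * w,
    (Module.End.eigenspace B.number (w : k) ⊓ M k m j))) ?_ ?_ ?_ ?_ ?_ ha
  · intro j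
    exact zero_mem _
  · intro r
    refine Submodule.mem_iSup_of_mem 0 (Submodule.mem_iSup_of_mem (by omega) ⟨?_, ?_⟩)
    · rw [SetLike.mem_coe, Module.End.mem_eigenspace_iff, number_algebraMap, Nat.cast_zero,
        zero_smul]
    · exact algebraMap_mem_M r
  · intro j a b _ _ ha hb
    exact add_mem ha hb
  · intro u hu j a _ ha
    have : (⨆ w : ℕ, (⨆ _ : j ≤ 2 * w, (Module.End.eigenspace B.number (w : k) ⊓ M k m j))) ≤
        (⨆ w : ℕ, (⨆ _ : j + 1 ≤ 2 * w, (Module.End.eigenspace B.number (w : k) ⊓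
          M k m (j + 1)))).comap
          (LinearMap.mulLeft k (Polynomial.C (ExteriorAlgebra.ι k u))) := by
      refine iSup_le fun w => iSup_le fun hw x hx => ?_
      refine Submodule.mem_iSup_of_mem (w + 1) (Submodule.mem_iSup_of_mem (by omega) ⟨?_, ?_⟩)
      · rw [SetLike.mem_coe, Module.End.mem_eigenspace_iff, LinearMap.mulLeft_apply,
          B.number_ι_mul hu, Module.End.mem_eigenspace_iff.1 hx.1, mul_smul_comm, Nat.cast_add,
          Nat.cast_one, add_smul, one_smul, add_comm]
      · exact ι_mul_mem_M hu hx.2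
    exact this ha
  · intro j a _ ha
    have : (⨆ w : ℕ, (⨆ _ : j ≤ 2 * w, (Module.End.eigenspace B.number (w : k) ⊓ M k m j))) ≤
        (⨆ w : ℕ, (⨆ _ : j + 2 ≤ 2 * w, (Module.End.eigenspace B.number (w : k) ⊓
          M k m (j + 2)))).comap (LinearMap.mulLeft k Polynomial.X) := by
      refine iSup_le fun w => iSup_le fun hw x hx => ?_
      refine Submodule.mem_iSup_of_mem (w + 1) (Submodule.mem_iSup_of_mem (by omega) ⟨?_, ?_⟩)
      · rw [SetLike.mem_coe, Module.End.mem_eigenspace_iff, LinearMap.mulLeft_apply,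
          B.number_X_mul, Module.End.mem_eigenspace_iff.1 hx.1, mul_smul_comm, Nat.cast_add,
          Nat.cast_one, add_smul, one_smul, add_comm]
      · exact X_mul_mem_M hx.2
    exact this ha

/-! #### The complex of polynomial maps -/

/-- The differential on polynomial maps for the contraction with `∑ z_i φ_i` and `T ↦ e`. -/
def modelD : Module.End k (MvPolynomial σ k ⊗[k] ExtT k m) :=
  ∑ i ∈ S, TensorProduct.map (LinearMap.mulLeft k (MvPolynomial.X i)) (polyD (B.φ i) 0) +
    TensorProduct.map LinearMap.id (polyD 0 B.e)

/-- The homotopy `z_i ↦ u_i`, `e ↦ T`. -/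
def modelδ : Module.End k (MvPolynomial σ k ⊗[k] ExtT k m) :=
  ∑ i ∈ S, TensorProduct.map (MvPolynomial.pderiv i).toLinearMap
      (LinearMap.mulLeft k (Polynomial.C (ExteriorAlgebra.ι k (B.u i)))) +
    TensorProduct.map LinearMap.id B.homT

lemma modelD_tmul (r : MvPolynomial σ k) (a : ExtT k m) : B.modelD (r ⊗ₜ a) =
    ∑ i ∈ S, (MvPolynomial.X i * r) ⊗ₜ[k] polyD (B.φ i) 0 a + r ⊗ₜ[k] polyD 0 B.e a := by
  simp [modelD]

lemma modelδ_tmul (r : MvPolynomial σ k) (a : ExtT k m) : B.modelδ (r ⊗ₜ a) =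
    ∑ i ∈ S, (MvPolynomial.pderiv i r) ⊗ₜ[k] (Polynomial.C (ExteriorAlgebra.ι k (B.u i)) * a) +
      r ⊗ₜ[k] B.homT a := by
  simp [modelδ]

lemma polyD_φ_homT (i : σ) (a : ExtT k m) :
    polyD (B.φ i) 0 (B.homT a) = - B.homT (polyD (B.φ i) 0 a) := by
  rw [homT_apply, homT_apply, polyD_zero_X_mul, polyD_contract_anticomm, mul_neg]

lemma polyD_φ_ι_mul {i j : σ} (hi : i ∈ S) (hj : j ∈ S) [DecidableEq σ] (a : ExtT k m) :
    polyD (B.φ i) 0 (Polynomial.C (ExteriorAlgebra.ι k (B.u j)) * a) =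
      (if i = j then a else 0) -
        Polynomial.C (ExteriorAlgebra.ι k (B.u j)) * polyD (B.φ i) 0 a := by
  rw [polyD_ι_mul]
  split_ifs with h
  · rw [← h, B.φ_u_self i hi, one_smul]
  · rw [B.φ_u_ne i hi j hj h, zero_smul]

lemma modelD_modelδ_expand (r : MvPolynomial σ k) (a : ExtT k m) : B.modelD (B.modelδ (r ⊗ₜ a)) =
    ∑ j ∈ S, ∑ i ∈ S, (MvPolynomial.X i * MvPolynomial.pderiv j r) ⊗ₜ[k]
        (polyD (B.φ i) 0 (Polynomial.C (ExteriorAlgebra.ι k (B.u j)) * a)) +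
    ∑ j ∈ S, (MvPolynomial.pderiv j r) ⊗ₜ[k]
        (polyD 0 B.e (Polynomial.C (ExteriorAlgebra.ι k (B.u j)) * a)) +
    (∑ i ∈ S, (MvPolynomial.X i * r) ⊗ₜ[k] polyD (B.φ i) 0 (B.homT a) +
      r ⊗ₜ[k] polyD 0 B.e (B.homT a)) := by
  rw [modelδ_tmul, map_add, map_sum, modelD_tmul, Finset.sum_congr rfl fun j _ =>
    B.modelD_tmul _ _, Finset.sum_add_distrib]

lemma modelδ_modelD_expand (r : MvPolynomial σ k) (a : ExtT k m) : B.modelδ (B.modelD (r ⊗ₜ a)) =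
    ∑ i ∈ S, ∑ j ∈ S, (MvPolynomial.pderiv j (MvPolynomial.X i * r)) ⊗ₜ[k]
        (Polynomial.C (ExteriorAlgebra.ι k (B.u j)) * polyD (B.φ i) 0 a) +
    ∑ i ∈ S, (MvPolynomial.X i * r) ⊗ₜ[k] B.homT (polyD (B.φ i) 0 a) +
    (∑ j ∈ S, (MvPolynomial.pderiv j r) ⊗ₜ[k]
        (Polynomial.C (ExteriorAlgebra.ι k (B.u j)) * polyD 0 B.e a) +
      r ⊗ₜ[k] B.homT (polyD 0 B.e a)) := by
  rw [modelD_tmul, map_add, map_sum, modelδ_tmul, Finset.sum_congr rfl fun i _ =>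
    B.modelδ_tmul _ _, Finset.sum_add_distrib]

/-- Contracting u_j by φ_i leaves a Kronecker delta, which produces the Euler field ∑ z_i ∂_i; the
remaining double sum comes from the sign rule. -/
lemma sum_contract_ι_mul (r : MvPolynomial σ k) (a : ExtT k m) : ∑ j ∈ S, ∑ i ∈ S, (MvPolynomial.X i * MvPolynomial.pderiv j r) ⊗ₜ[k]
        (polyD (B.φ i) 0 (Polynomial.C (ExteriorAlgebra.ι k (B.u j)) * a)) =
    ∑ i ∈ S, (MvPolynomial.X i * MvPolynomial.pderiv i r) ⊗ₜ[k] a -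
    ∑ i ∈ S, ∑ j ∈ S, (MvPolynomial.X i * MvPolynomial.pderiv j r) ⊗ₜ[k]
        (Polynomial.C (ExteriorAlgebra.ι k (B.u j)) * polyD (B.φ i) 0 a) := by
  classical
  rw [Finset.sum_comm, ← Finset.sum_sub_distrib]
  refine Finset.sum_congr rfl fun i hi => ?_
  have h : ∀ j ∈ S, (MvPolynomial.X i * MvPolynomial.pderiv j r) ⊗ₜ[k]
      (polyD (B.φ i) 0 (Polynomial.C (ExteriorAlgebra.ι k (B.u j)) * a)) =
      (MvPolynomial.X i * MvPolynomial.pderiv j r) ⊗ₜ[k] (if i = j then a else 0) -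
      (MvPolynomial.X i * MvPolynomial.pderiv j r) ⊗ₜ[k]
        (Polynomial.C (ExteriorAlgebra.ι k (B.u j)) * polyD (B.φ i) 0 a) := by
    intro j hj
    rw [B.polyD_φ_ι_mul hi hj, TensorProduct.tmul_sub]
  rw [Finset.sum_congr rfl h, Finset.sum_sub_distrib]
  congr 1
  rw [Finset.sum_eq_single_of_mem i hi, if_pos rfl]
  intro j _ hj
  rw [if_neg hj.symm, TensorProduct.tmul_zero]

/-- Differentiating z_i in the product produces the part ∑ u_i ι_{φ_i} of the number operator, and
the same double sum as in `sum_contract_ι_mul`, now with the opposite sign in the total. -/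
lemma sum_pderiv_X_mul (r : MvPolynomial σ k) (a : ExtT k m) : ∑ i ∈ S, ∑ j ∈ S, (MvPolynomial.pderiv j (MvPolynomial.X i * r)) ⊗ₜ[k]
        (Polynomial.C (ExteriorAlgebra.ι k (B.u j)) * polyD (B.φ i) 0 a) =
    ∑ i ∈ S, r ⊗ₜ[k] (Polynomial.C (ExteriorAlgebra.ι k (B.u i)) * polyD (B.φ i) 0 a) +
    ∑ i ∈ S, ∑ j ∈ S, (MvPolynomial.X i * MvPolynomial.pderiv j r) ⊗ₜ[k]
        (Polynomial.C (ExteriorAlgebra.ι k (B.u j)) * polyD (B.φ i) 0 a) := by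
  classical
  rw [← Finset.sum_add_distrib]
  refine Finset.sum_congr rfl fun i hi => ?_
  have : ∀ j, MvPolynomial.pderiv j (MvPolynomial.X i * r) =
      (if j = i then r else 0) + MvPolynomial.X i * MvPolynomial.pderiv j r := by
    intro j
    rw [Derivation.leibniz, MvPolynomial.pderiv_X, smul_eq_mul, smul_eq_mul, add_comm,
      Pi.single_apply]
    congr 1
    by_cases h : i = j
    · rw [if_pos h, if_pos h.symm, mul_one]
    · rw [if_neg h, if_neg fun h' => h h'.symm, mul_zero]
  rw [Finset.sum_congr rfl fun j hj => by rw [this j, TensorProduct.add_tmul],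
    Finset.sum_add_distrib]
  congr 1
  rw [Finset.sum_eq_single_of_mem i hi, if_pos rfl]
  intro j _ hj
  rw [if_neg hj, TensorProduct.zero_tmul]

lemma sum_wedge_ι_mul (r : MvPolynomial σ k) (a : ExtT k m) : ∑ j ∈ S, (MvPolynomial.pderiv j r) ⊗ₜ[k]
        (polyD 0 B.e (Polynomial.C (ExteriorAlgebra.ι k (B.u j)) * a)) =
    - ∑ j ∈ S, (MvPolynomial.pderiv j r) ⊗ₜ[k]
        (Polynomial.C (ExteriorAlgebra.ι k (B.u j)) * polyD 0 B.e a) := by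
  rw [← Finset.sum_neg_distrib]
  exact Finset.sum_congr rfl fun j _ => by rw [polyD_zero_ι_mul, TensorProduct.tmul_neg]

lemma sum_contract_homT (r : MvPolynomial σ k) (a : ExtT k m) : ∑ i ∈ S, (MvPolynomial.X i * r) ⊗ₜ[k] polyD (B.φ i) 0 (B.homT a) =
    - ∑ i ∈ S, (MvPolynomial.X i * r) ⊗ₜ[k] B.homT (polyD (B.φ i) 0 a) := by
  rw [← Finset.sum_neg_distrib]
  exact Finset.sum_congr rfl fun j _ => by rw [polyD_φ_homT, TensorProduct.tmul_neg]

lemma modelD_modelδ_tmul (r : MvPolynomial σ k) (a : ExtT k m) :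
    B.modelD (B.modelδ (r ⊗ₜ a)) + B.modelδ (B.modelD (r ⊗ₜ a)) =
      (∑ i ∈ S, MvPolynomial.X i * MvPolynomial.pderiv i r) ⊗ₜ[k] a + r ⊗ₜ[k] B.number a := by
  have hN : r ⊗ₜ[k] B.number a =
      ∑ i ∈ S, r ⊗ₜ[k] (Polynomial.C (ExteriorAlgebra.ι k (B.u i)) * polyD (B.φ i) 0 a) +
        (r ⊗ₜ[k] polyD 0 B.e (B.homT a) + r ⊗ₜ[k] B.homT (polyD 0 B.e a)) := by
    rw [number_apply, TensorProduct.tmul_add, TensorProduct.tmul_add, TensorProduct.tmul_sum]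
  have h1 := (B.modelD_modelδ_expand r a).trans (congrArg₂ (· + ·)
    (congrArg₂ (· + ·) (B.sum_contract_ι_mul r a) (B.sum_wedge_ι_mul r a))
    (congrArg₂ (· + ·) (B.sum_contract_homT r a) rfl))
  have h2 := (B.modelδ_modelD_expand r a).trans (congrArg₂ (· + ·)
    (congrArg₂ (· + ·) (B.sum_pderiv_X_mul r a) rfl) rfl)
  -- Here p is the Euler field in z and n the sum of the u_i ι_{φ_i}; v and w form the
  -- anticommutator of e ∂_T and T ι_ε. The cross terms q, s, t occur once with each sign.
  have key : ∀ {x y z p q s t v w n : MvPolynomial σ k ⊗[k] ExtT k m},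
      x = (p - q) + -s + (-t + v) → y = (n + q) + t + (s + w) → z = n + (v + w) →
      x + y = p + z := by
    rintro x y z p q s t v w n rfl rfl rfl
    abel
  rw [TensorProduct.sum_tmul]
  exact key h1 h2 hN

end Frame

/-! ### Exactness of the complex of polynomial maps -/

section Eval

variable {k E σ : Type*} [Field k] [AddCommGroup E] [Module k E]

/-- Evaluation of polynomial maps at a point. -/
def evalMap (z : σ → k) : MvPolynomial σ k ⊗[k] E →ₗ[k] E :=
  (TensorProduct.lid k E).toLinearMap ∘ₗ
    TensorProduct.map (MvPolynomial.aeval z).toLinearMap LinearMap.id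

lemma evalMap_tmul (z : σ → k) (r : MvPolynomial σ k) (a : E) :
    evalMap z (r ⊗ₜ[k] a) = MvPolynomial.eval z r • a := by
  simp [evalMap, MvPolynomial.aeval_eq_eval]

/-- In a basis of `E` the coefficients are polynomials vanishing at every point, hence zero over an
infinite field. -/
lemma evalMap_ext [Infinite k] {f : MvPolynomial σ k ⊗[k] E} (h : ∀ z, evalMap z f = 0) :
    f = 0 := by
  classical
  let b := Module.Basis.ofVectorSpace k E
  refine (TensorProduct.equivFinsuppOfBasisRight (M := MvPolynomial σ k) b).injective ?_
  rw [map_zero]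
  ext1 i
  refine MvPolynomial.funext fun z => ?_
  rw [TensorProduct.equivFinsuppOfBasisRight_apply, Finsupp.zero_apply, map_zero]
  have key : ∀ g : MvPolynomial σ k ⊗[k] E, MvPolynomial.eval z
      (TensorProduct.rid k (MvPolynomial σ k) ((b.coord i).lTensor _ g)) =
        b.coord i (evalMap z g) := by
    intro g
    induction g with
    | zero => simp only [map_zero]
    | add x y hx hy => simp only [map_add, hx, hy]
    | tmul r a =>
      rw [LinearMap.lTensor_tmul, TensorProduct.rid_tmul, evalMap_tmul,
        (b.coord i).map_smul, MvPolynomial.smul_eval, smul_eq_mul, mul_comm]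
  rw [key, h, map_zero]

lemma evalMap_mul (z : σ → k) (q : MvPolynomial σ k) (f : MvPolynomial σ k ⊗[k] E) :
    evalMap z (TensorProduct.map (LinearMap.mulLeft k q) LinearMap.id f) =
      MvPolynomial.eval z q • evalMap z f := by
  induction f with
  | zero => simp only [map_zero, smul_zero]
  | add x y hx hy => simp only [map_add, hx, hy, smul_add]
  | tmul r a =>
    rw [TensorProduct.map_tmul, evalMap_tmul, evalMap_tmul, LinearMap.mulLeft_apply, map_mul,
      mul_smul, LinearMap.id_apply]

end Eval

/-! ### Primitives for the model complex with values in M_j -/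

section Model

variable {k : Type*} [Field k] {m : ℕ} {σ : Type*}

variable (k m σ) in
/-- Polynomial maps with values in `M_j`. -/
def polyM (j : ℕ) : Submodule k (MvPolynomial σ k ⊗[k] ExtT k m) :=
  Submodule.map₂ (TensorProduct.mk k (MvPolynomial σ k) (ExtT k m)) ⊤ (M k m j)

lemma tmul_mem_polyM (r : MvPolynomial σ k) {j : ℕ} {a : ExtT k m} (ha : a ∈ M k m j) :
    r ⊗ₜ[k] a ∈ polyM k m σ j := Submodule.apply_mem_map₂ _ Submodule.mem_top ha

lemma evalMap_mem_M (z : σ → k) {j : ℕ} {f : MvPolynomial σ k ⊗[k] ExtT k m}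
    (hf : f ∈ polyM k m σ j) : evalMap z f ∈ M k m j := by
  have : polyM k m σ j ≤ (M k m j).comap (evalMap z) := by
    refine Submodule.map₂_le.2 fun r _ a ha => ?_
    rw [Submodule.mem_comap, TensorProduct.mk_apply, evalMap_tmul]
    exact Submodule.smul_mem _ _ ha
  exact this hf

lemma map_mulLeft_mem_polyM (q : MvPolynomial σ k) {j : ℕ}
    {f : MvPolynomial σ k ⊗[k] ExtT k m} (hf : f ∈ polyM k m σ j) :
    TensorProduct.map (LinearMap.mulLeft k q) LinearMap.id f ∈ polyM k m σ j := by
  have : polyM k m σ j ≤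
      (polyM k m σ j).comap (TensorProduct.map (LinearMap.mulLeft k q) LinearMap.id) :=
    Submodule.map₂_le.2 fun r _ a ha => tmul_mem_polyM (q * r) ha
  exact this hf

namespace Frame

variable {S : Finset σ} (B : Frame k m σ S)

/-- The linear form `∑ z_i φ_i`. -/
def lin (z : σ → k) : Module.Dual k (V k m ⊗[k] VDual k m) := ∑ i ∈ S, z i • B.φ i

lemma lin_e (z : σ → k) : B.lin z B.e = 0 := by
  rw [lin, LinearMap.sum_apply]
  exact Finset.sum_eq_zero fun i hi => by rw [LinearMap.smul_apply, B.φ_e i hi, smul_zero]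

lemma evalMap_modelD (z : σ → k) (f : MvPolynomial σ k ⊗[k] ExtT k m) :
    evalMap z (B.modelD f) = polyD (B.lin z) B.e (evalMap z f) := by
  induction f with
  | zero => simp only [map_zero]
  | add x y hx hy => simp only [map_add, hx, hy]
  | tmul r a =>
    have h : polyD (B.lin z) B.e a = polyD (B.lin z) 0 a + polyD 0 B.e a := by
      rw [← polyD_add, add_zero, zero_add]
    rw [modelD_tmul, map_add, map_sum, evalMap_tmul, evalMap_tmul, map_smul, h, lin, polyD_sum,
      smul_add, Finset.smul_sum]
    congr 1
    refine Finset.sum_congr rfl fun i _ => ?_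
    rw [evalMap_tmul, map_mul, MvPolynomial.eval_X, smul_smul, mul_comm]

lemma modelD_modelD [Infinite k] (f : MvPolynomial σ k ⊗[k] ExtT k m) :
    B.modelD (B.modelD f) = 0 :=
  evalMap_ext fun z => by
    rw [evalMap_modelD, evalMap_modelD, polyD_polyD _ _ (B.lin_e z)]

lemma homT_mem_M {j : ℕ} {a : ExtT k m} (ha : a ∈ M k m j) : B.homT a ∈ M k m (j + 1) := by
  rcases j with _ | j
  · rw [homT_apply, polyD_eq_zero_of_mem_M_zero _ _ ha, mul_zero]
    exact zero_mem _
  · exact X_mul_mem_M (polyD_mem_M (zero_mem _) ha)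

lemma modelδ_mem_polyM {j : ℕ} {f : MvPolynomial σ k ⊗[k] ExtT k m} (hf : f ∈ polyM k m σ j) :
    B.modelδ f ∈ polyM k m σ (j + 1) := by
  have : polyM k m σ j ≤ (polyM k m σ (j + 1)).comap B.modelδ := by
    refine Submodule.map₂_le.2 fun r _ a ha => ?_
    rw [Submodule.mem_comap, TensorProduct.mk_apply, modelδ_tmul]
    exact add_mem (Submodule.sum_mem _ fun i hi =>
      tmul_mem_polyM _ (ι_mul_mem_M (B.u_mem i hi) ha)) (tmul_mem_polyM _ (B.homT_mem_M ha))
  exact this hf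

/-- The Euler operator of the complex of polynomial maps. -/
def euler : Module.End k (MvPolynomial σ k ⊗[k] ExtT k m) :=
  B.modelD * B.modelδ + B.modelδ * B.modelD

lemma euler_monomial_tmul (s : σ →₀ ℕ) (c : k) {w : ℕ} {a : ExtT k m}
    (ha : a ∈ Module.End.eigenspace B.number (w : k)) :
    B.euler (MvPolynomial.monomial s c ⊗ₜ a) =
      ((∑ i ∈ S, s i + w : ℕ) : k) • (MvPolynomial.monomial s c ⊗ₜ[k] a) := by
  have h := B.modelD_modelδ_tmul (MvPolynomial.monomial s c) a
  rw [Module.End.mem_eigenspace_iff.1 ha, TensorProduct.tmul_smul, Finset.sum_congr rfl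
    fun i _ => MvPolynomial.X_mul_pderiv_monomial, ← Finset.sum_smul] at h
  refine h.trans ?_
  rw [Nat.cast_add, add_smul, ← Nat.cast_smul_eq_nsmul k, ← TensorProduct.smul_tmul']

lemma monomial_tmul_mem (s : σ →₀ ℕ) (c : k) {j : ℕ} (h : 1 ≤ ∑ i ∈ S, s i ∨ 1 ≤ j)
    {a : ExtT k m} (ha : a ∈ M k m j) :
    MvPolynomial.monomial s c ⊗ₜ[k] a ∈
      ⨆ w : ℕ, (Module.End.eigenspace B.euler ((w + 1 : ℕ) : k) ⊓ polyM k m σ j) := by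
  have : (⨆ w : ℕ, (⨆ _ : j ≤ 2 * w, (Module.End.eigenspace B.number (w : k) ⊓ M k m j))) ≤
      (⨆ w : ℕ, (Module.End.eigenspace B.euler ((w + 1 : ℕ) : k) ⊓ polyM k m σ j)).comap
        (TensorProduct.mk k _ _ (MvPolynomial.monomial s c)) := by
    refine iSup_le fun w => iSup_le fun hw x hx => ?_
    -- Eigenvalues are indexed as w + 1 to encode positivity. The truncated subtraction is harmless:
    -- either a variable from S occurs, or j ≥ 1 and then w ≥ 1.
    refine Submodule.mem_iSup_of_mem (∑ i ∈ S, s i + w - 1) ⟨?_, tmul_mem_polyM _ hx.2⟩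
    rw [SetLike.mem_coe, Module.End.mem_eigenspace_iff, Nat.sub_add_cancel (by omega)]
    exact B.euler_monomial_tmul s c hx.1
  exact this (B.mem_iSup_number ha)

lemma tmul_mem_iSup_euler {j : ℕ} (r : MvPolynomial σ k)
    (h : (∀ s ∈ r.support, ∃ i ∈ S, s i ≠ 0) ∨ 1 ≤ j) {a : ExtT k m} (ha : a ∈ M k m j) :
    r ⊗ₜ[k] a ∈
      ⨆ w : ℕ, (Module.End.eigenspace B.euler ((w + 1 : ℕ) : k) ⊓ polyM k m σ j) := by
  rw [r.as_sum, TensorProduct.sum_tmul]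
  refine Submodule.sum_mem _ fun s hs => B.monomial_tmul_mem s _ ?_ ha
  refine h.imp_left fun h => ?_
  obtain ⟨i, hi, hsi⟩ := h s hs
  exact (Nat.one_le_iff_ne_zero.2 hsi).trans
    (Finset.single_le_sum (f := fun i => s i) (fun _ _ => Nat.zero_le _) hi)

lemma exists_modelD_eq [CharZero k] {j : ℕ} {f : MvPolynomial σ k ⊗[k] ExtT k m}
    (hf : f ∈ polyM k m σ (j + 1)) (hd : B.modelD f = 0) :
    ∃ b ∈ polyM k m σ (j + 2), B.modelD b = f := by
  refine exists_primitive_of_euler B.modelD B.modelδ B.modelD_modelD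
    (fun x hx => B.modelδ_mem_polyM hx) ?_ hd
  have : polyM k m σ (j + 1) ≤ ⨆ w : ℕ,
      (Module.End.eigenspace B.euler ((w + 1 : ℕ) : k) ⊓ polyM k m σ (j + 1)) :=
    Submodule.map₂_le.2 fun r _ a ha => B.tmul_mem_iSup_euler r (Or.inr (by omega)) ha
  exact this hf

/-- Setting the variables in S to 0 does not change r modulo the ideal, and the resulting polynomial
vanishes at all points. -/
lemma mem_span_X_of_eval_eq_zero [Infinite k] {r : MvPolynomial σ k}
    (h : ∀ z : σ → k, (∀ i ∈ S, z i = 0) → MvPolynomial.eval z r = 0) :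
    r ∈ Ideal.span (MvPolynomial.X '' (S : Set σ) : Set (MvPolynomial σ k)) := by
  classical
  let f : σ → MvPolynomial σ k := fun i => if i ∈ S then 0 else MvPolynomial.X i
  have h0 : MvPolynomial.aeval f r = 0 := by
    refine MvPolynomial.funext fun z => ?_
    rw [map_zero, ← MvPolynomial.coe_aeval_eq_eval]
    change ((MvPolynomial.aeval z).comp (MvPolynomial.aeval f)) r = 0
    rw [MvPolynomial.comp_aeval, MvPolynomial.aeval_eq_eval]
    refine h _ fun i hi => ?_
    simp [f, hi]
  set I := Ideal.span (MvPolynomial.X '' (S : Set σ) : Set (MvPolynomial σ k))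
  have h1 : (Ideal.Quotient.mkₐ k I).comp (MvPolynomial.aeval f) = Ideal.Quotient.mkₐ k I := by
    refine MvPolynomial.algHom_ext fun i => ?_
    rw [AlgHom.comp_apply, MvPolynomial.aeval_X]
    by_cases hi : i ∈ S
    · simp only [f, if_pos hi, map_zero]
      exact (Ideal.Quotient.eq_zero_iff_mem.2 (Ideal.subset_span (Set.mem_image_of_mem _ hi))).symm
    · simp only [f, if_neg hi]
  have h2 := DFunLike.congr_fun h1 r
  rw [AlgHom.comp_apply, h0, map_zero] at h2
  exact Ideal.Quotient.eq_zero_iff_mem.1 h2.symm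

/-- Every monomial of r contains a variable from S, so the counting operator has positive
eigenvalues on it although the degree in Λ[T] is 0. -/
lemma exists_modelD_eq_tmul_one [CharZero k] {r : MvPolynomial σ k}
    (h : ∀ z : σ → k, (∀ i ∈ S, z i = 0) → MvPolynomial.eval z r = 0) :
    ∃ b ∈ polyM k m σ 1, B.modelD b = r ⊗ₜ algebraMap k (ExtT k m) 1 := by
  refine exists_primitive_of_euler B.modelD B.modelδ B.modelD_modelD
    (fun x hx => B.modelδ_mem_polyM hx) (B.tmul_mem_iSup_euler r (Or.inl
      (MvPolynomial.mem_ideal_span_X_image.1 (mem_span_X_of_eval_eq_zero h)))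
      (algebraMap_mem_M 1)) ?_
  rw [modelD_tmul, polyD_algebraMap, TensorProduct.tmul_zero, add_zero]
  exact Finset.sum_eq_zero fun i _ => by rw [polyD_algebraMap, TensorProduct.tmul_zero]

end Frame

end Model

/-! ### The open cell -/

section Cell

variable {k : Type*} [Field k] {m : ℕ}

lemma form_vec_inr (v : V k m) (i : Fin (m + 2)) : form v (vec (Sum.inr i)) = v (Sum.inl i) := by
  simp [form_eq_sum, vec, Pi.single_apply]

lemma form_vec_inl_left (v : V k m) (i : Fin (m + 2)) :
    form (vec (Sum.inl i)) v = v (Sum.inr i) := by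
  simp [form_eq_sum, vec, Pi.single_apply]

/-- The symplectic map that sends `v_1, v_2` to `A, B` and fixes `v_{n+1}, v_{n+2}`, for
`A ∈ v_1 + ⟨v_3, …⟩` and `B ∈ v_2 + ⟨v_3, …⟩` with `⟨A, B⟩ = 0`. -/
def unipotent (A B x : V k m) : V k m :=
  x (Sum.inl 0) • A + x (Sum.inl 1) • B + (projV2 x +
    (form (projV2 x) A + x (Sum.inr 0)) • vec (Sum.inr 0) +
    (form (projV2 x) B + x (Sum.inr 1)) • vec (Sum.inr 1))

/-- `unipotent` as a linear map. -/
def unipotentLin (A B : V k m) : V k m →ₗ[k] V k m where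
  toFun := unipotent A B
  map_add' x y := by
    simp only [unipotent, map_add, form_add_left, Pi.add_apply]
    module
  map_smul' c x := by
    simp only [unipotent, map_smul, form_smul_left, Pi.smul_apply, smul_eq_mul, RingHom.id_apply]
    module

lemma projV2_inl_zero (x : V k m) : projV2 x (Sum.inl 0) = 0 := by
  simp [projV2_apply, vec]

lemma projV2_inl_one (x : V k m) : projV2 x (Sum.inl 1) = 0 := by
  simp [projV2_apply, vec]

lemma projV2_inr (x : V k m) (i : Fin (m + 2)) : projV2 x (Sum.inr i) = x (Sum.inr i) := by
  simp [projV2_apply, vec]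

/-- On x in the span of v_3, …, v_{2n} the added multiples of v_{n+1} and v_{n+2} are ⟨x, A − v_1⟩
and ⟨x, B − v_2⟩, chosen so that the image of x pairs with A and B as x does with v_1 and v_2. They
do not affect pairings within that span, because v_{n+1} and v_{n+2} are orthogonal to it. -/
lemma form_unipotent {A B : V k m} (hA0 : A (Sum.inl 0) = 1) (hA1 : A (Sum.inl 1) = 0)
    (hB0 : B (Sum.inl 0) = 0) (hB1 : B (Sum.inl 1) = 1) (hAB : form A B = 0) (x y : V k m) :
    form (unipotent A B x) (unipotent A B y) = form x y := by
  have hx : x = x (Sum.inl 0) • vec (Sum.inl 0) + x (Sum.inl 1) • vec (Sum.inl 1) + projV2 x := by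
    rw [projV2_apply]; abel
  have hy : y = y (Sum.inl 0) • vec (Sum.inl 0) + y (Sum.inl 1) • vec (Sum.inl 1) + projV2 y := by
    rw [projV2_apply]; abel
  have g' : ∀ i j, (vec (Sum.inl i) : V k m) (Sum.inr j) = 0 := fun i j => by simp [vec]
  have hL : form x y = x (Sum.inl 0) * y (Sum.inr 0) + x (Sum.inl 1) * y (Sum.inr 1)
      - y (Sum.inl 0) * x (Sum.inr 0) - y (Sum.inl 1) * x (Sum.inr 1)
      + form (projV2 x) (projV2 y) := by
    conv_lhs => rw [hx, hy]
    simp only [form_add_left, form_add_right, form_smul_left, form_smul_right,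
      form_vec_inl_left, projV2_inr]
    rw [form_swap (vec (Sum.inl 0)) (projV2 x), form_swap (vec (Sum.inl 1)) (projV2 x),
      form_vec_inl_left, form_vec_inl_left, projV2_inr, projV2_inr]
    simp only [g']
    ring
  rw [hL]
  have hBA : form B A = 0 := by rw [form_swap, hAB, neg_zero]
  have e1 := form_swap A (projV2 x)
  have e2 := form_swap B (projV2 x)
  have e3 := form_swap A (projV2 y)
  have e4 := form_swap B (projV2 y)
  have f1 : ∀ i (v : V k m), form (vec (Sum.inr i)) v = - v (Sum.inl i) := fun i v => by
    rw [form_swap, form_vec_inr]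
  simp only [unipotent, form_add_left, form_add_right, form_smul_left, form_smul_right,
    form_vec_inr, f1, projV2_inl_zero, projV2_inl_one, hA0, hA1, hB0, hB1,
    hAB, hBA, form_self, e1, e2, e3, e4, Pi.add_apply, Pi.smul_apply, smul_eq_mul]
  have g : ∀ i j, (vec (Sum.inr i) : V k m) (Sum.inl j) = 0 := fun i j => by simp [vec]
  simp only [g]
  ring

/-! ### Coordinates of isotropic planes in the open cell -/

/-- The basis vectors of `V_2`. -/
def lead (c : Fin 2) : Idx m := if c = 0 then Sum.inl 0 else Sum.inl 1

variable (m) in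
/-- The coordinates on the open cell. -/
def cellIdx : Finset (Fin 2 × Idx m) :=
  Finset.univ.filter fun c => c.2 ≠ Sum.inl 0 ∧ c.2 ≠ Sum.inl 1 ∧ c ≠ (1, Sum.inr 0)

lemma mem_cellIdx {c : Fin 2 × Idx m} :
    c ∈ cellIdx m ↔ c.2 ≠ Sum.inl 0 ∧ c.2 ≠ Sum.inl 1 ∧ c ≠ (1, Sum.inr 0) := by
  simp [cellIdx]

/-- The first basis vector of the plane with coordinates `z`. -/
def planeA (z : Fin 2 × Idx m → k) : V k m := fun j =>
  if j = Sum.inl 0 then 1 else if j = Sum.inl 1 then 0 else z (0, j)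

/-- The second basis vector of the plane with coordinates `z`, up to the coordinate `n+1`. -/
def planeB' (z : Fin 2 × Idx m → k) : V k m := fun j =>
  if j = Sum.inl 0 then 0 else if j = Sum.inl 1 then 1 else if j = Sum.inr 0 then 0 else z (1, j)

/-- The second basis vector of the plane with coordinates `z`. -/
def planeB (z : Fin 2 × Idx m → k) : V k m :=
  planeB' z - form (planeA z) (planeB' z) • vec (Sum.inr 0)

section

variable (z : Fin 2 × Idx m → k)

lemma planeA_inl_zero : planeA z (Sum.inl 0) = 1 := by simp [planeA]

lemma planeA_inl_one : planeA z (Sum.inl 1) = 0 := by simp [planeA]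

lemma planeB_inl_zero : planeB z (Sum.inl 0) = 0 := by simp [planeB, planeB', vec]

lemma planeB_inl_one : planeB z (Sum.inl 1) = 1 := by simp [planeB, planeB', vec]

lemma planeB_of_ne {j : Idx m} (h0 : j ≠ Sum.inl 0) (h1 : j ≠ Sum.inl 1) (h : j ≠ Sum.inr 0) :
    planeB z j = z (1, j) := by simp [planeB, planeB', vec, h0, h1, h]

lemma planeA_of_ne {j : Idx m} (h0 : j ≠ Sum.inl 0) (h1 : j ≠ Sum.inl 1) :
    planeA z j = z (0, j) := by simp [planeA, h0, h1]

/-- Since ⟨A, v_{n+1}⟩ = 1, isotropy can be solved for the v_{n+1}-coordinate of B. This is why (1,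
n+1) is left out of `cellIdx`. -/
lemma form_planeA_planeB : form (planeA z) (planeB z) = 0 := by
  rw [planeB, sub_eq_add_neg, ← neg_smul, form_add_right, form_smul_right, form_vec_inr,
    planeA_inl_zero]
  ring

/-- The element of the unipotent radical opposite to `P` with coordinates `z`. -/
def cellG : G k m :=
  (exists_act_eq (unipotentLin (planeA z) (planeB z)) (form_unipotent (planeA_inl_zero z)
    (planeA_inl_one z) (planeB_inl_zero z) (planeB_inl_one z) (form_planeA_planeB z))).choose

lemma act_cellG (x : V k m) : act (cellG z) x = unipotent (planeA z) (planeB z) x :=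
  LinearMap.congr_fun (exists_act_eq (unipotentLin (planeA z) (planeB z))
    (form_unipotent (planeA_inl_zero z) (planeA_inl_one z) (planeB_inl_zero z) (planeB_inl_one z)
      (form_planeA_planeB z))).choose_spec x

lemma act_cellG_zero : act (cellG z) (vec (Sum.inl 0)) = planeA z := by
  rw [act_cellG, unipotent, projV2_of_mem vec_inl_mem_V2_zero]
  simp [vec, form]

lemma act_cellG_one : act (cellG z) (vec (Sum.inl 1)) = planeB z := by
  rw [act_cellG, unipotent, projV2_of_mem vec_inl_mem_V2_one]
  simp [vec, form]

end

lemma eq_one_of_act (g : G k m) (h : ∀ x, act g x = x) : g = 1 := by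
  refine Subtype.ext (Matrix.ext_of_mulVec_single fun i => ?_)
  have := h (Pi.single i 1)
  rw [OneMemClass.coe_one, Matrix.one_mulVec]
  exact this

lemma cellG_zero : cellG (0 : Fin 2 × Idx m → k) = 1 := by
  have hA : planeA (0 : Fin 2 × Idx m → k) = vec (Sum.inl 0) := by
    funext j
    simp only [planeA, vec, Pi.single_apply, Pi.zero_apply, ite_self]
  have hB' : planeB' (0 : Fin 2 × Idx m → k) = vec (Sum.inl 1) := by
    funext j
    simp only [planeB', vec, Pi.single_apply, Pi.zero_apply, ite_self]
    split_ifs with h0 h1 h2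
    · simp [h0] at h1
    · rfl
    · rfl
    · rfl
  have hB : planeB (0 : Fin 2 × Idx m → k) = vec (Sum.inl 1) := by
    rw [planeB, hA, hB', form_vec_inl, zero_smul, sub_zero]
  refine eq_one_of_act _ fun x => ?_
  rw [act_cellG, hA, hB, unipotent, form_swap (vec (Sum.inl 0)), form_swap (vec (Sum.inl 1)),
    form_vec_inl_left, form_vec_inl_left, projV2_inr, projV2_inr, neg_add_cancel, neg_add_cancel,
    projV2_apply]
  module

/-- The coordinates of the plane `g V_2`, if it lies in the open cell. -/
def cellCoord (g : G k m) (c : Fin 2 × Idx m) : k :=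
  if c ∈ cellIdx m then
    -- Cramer's rule: these are the coordinates of the basis of gV_2 whose (v_1, v_2)-coordinates
    -- are (1, 0) and (0, 1).
    (if c.1 = 0 then
      act g (vec (Sum.inl 1)) (Sum.inl 1) * act g (vec (Sum.inl 0)) c.2 -
        act g (vec (Sum.inl 0)) (Sum.inl 1) * act g (vec (Sum.inl 1)) c.2
    else
      act g (vec (Sum.inl 0)) (Sum.inl 0) * act g (vec (Sum.inl 1)) c.2 -
        act g (vec (Sum.inl 1)) (Sum.inl 0) * act g (vec (Sum.inl 0)) c.2) / detV2 g
  else 0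

lemma detV2_one : detV2 (1 : G k m) = 1 := by
  simp [detV2, act_one, vec]

lemma detV2_ne_zero {p : G k m} (hp : p ∈ P k m) : detV2 p ≠ 0 := by
  intro h
  have := detV2_mul p⁻¹ hp
  rw [inv_mul_cancel, detV2_one, h, mul_zero] at this
  exact one_ne_zero this

lemma cellCoord_one : cellCoord (1 : G k m) = 0 := by
  funext c
  rw [cellCoord]
  split_ifs with h h0
  · rw [mem_cellIdx] at h
    simp [act_one, vec, h.1, h.2.1]
  · rw [mem_cellIdx] at h
    simp [act_one, vec, h.1, h.2.1]
  · rfl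

/-- Numerator and denominator are 2 × 2 minors of (gv_1, gv_2), and p multiplies each of them by its
determinant on V_2. -/
lemma cellCoord_mul (g : G k m) {p : G k m} (hp : p ∈ P k m) :
    cellCoord (g * p) = cellCoord g := by
  have hd := detV2_ne_zero hp
  funext c
  rw [cellCoord, cellCoord, detV2_mul g hp, act_mul_vec_zero g hp, act_mul_vec_one g hp]
  split_ifs with h h0
  · rw [← mul_div_mul_right _ (detV2 g) hd]
    congr 1
    simp only [Pi.add_apply, Pi.smul_apply, smul_eq_mul, detV2]
    ring
  · rw [← mul_div_mul_right _ (detV2 g) hd]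
    congr 1
    simp only [Pi.add_apply, Pi.smul_apply, smul_eq_mul, detV2]
    ring
  · rfl

lemma form_comb_comb {α β : V k m} (h : form α β = 0) (a b c d : k) :
    form (a • α + b • β) (c • α + d • β) = 0 := by
  have h' : form β α = 0 := by rw [form_swap, h, neg_zero]
  simp only [form_add_left, form_add_right, form_smul_left, form_smul_right, form_self, h, h']
  ring

lemma planeA_cellCoord {g : G k m} (hg : detV2 g ≠ 0) : planeA (cellCoord g) =
    act g ((act g (vec (Sum.inl 1)) (Sum.inl 1) / detV2 g) • vec (Sum.inl 0) +
      (-(act g (vec (Sum.inl 0)) (Sum.inl 1) / detV2 g)) • vec (Sum.inl 1)) := by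
  rw [map_add, map_smul, map_smul]
  funext j
  simp only [Pi.add_apply, Pi.smul_apply, smul_eq_mul]
  by_cases h0 : j = Sum.inl 0
  · subst h0
    rw [planeA_inl_zero]
    field_simp
    rw [detV2]
    ring
  · by_cases h1 : j = Sum.inl 1
    · subst h1
      rw [planeA_inl_one]
      ring
    · rw [planeA_of_ne _ h0 h1, cellCoord, if_pos (mem_cellIdx.2 ⟨h0, h1, by simp⟩), if_pos rfl]
      ring

/-- Both vectors agree outside the v_{n+1}-coordinate and are orthogonal to A. As ⟨A, v_{n+1}⟩ = 1,
that coordinate agrees as well. -/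
lemma planeB_cellCoord {g : G k m} (hg : detV2 g ≠ 0) : planeB (cellCoord g) =
    act g ((-(act g (vec (Sum.inl 1)) (Sum.inl 0) / detV2 g)) • vec (Sum.inl 0) +
      (act g (vec (Sum.inl 0)) (Sum.inl 0) / detV2 g) • vec (Sum.inl 1)) := by
  have hform : form (planeA (cellCoord g)) (act g
      ((-(act g (vec (Sum.inl 1)) (Sum.inl 0) / detV2 g)) • vec (Sum.inl 0) +
      (act g (vec (Sum.inl 0)) (Sum.inl 0) / detV2 g) • vec (Sum.inl 1))) = 0 := by
    rw [planeA_cellCoord hg, form_act, form_comb_comb (form_vec_inl _ _)]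
  rw [map_add, map_smul, map_smul] at hform ⊢
  set w := (-(act g (vec (Sum.inl 1)) (Sum.inl 0) / detV2 g)) • act g (vec (Sum.inl 0)) +
      (act g (vec (Sum.inl 0)) (Sum.inl 0) / detV2 g) • act g (vec (Sum.inl 1)) with hw
  have hoff : ∀ j, j ≠ Sum.inr 0 → planeB (cellCoord g) j = w j := by
    intro j h
    simp only [hw, Pi.add_apply, Pi.smul_apply, smul_eq_mul]
    by_cases h0 : j = Sum.inl 0
    · subst h0
      rw [planeB_inl_zero]
      ring
    · by_cases h1 : j = Sum.inl 1
      · subst h1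
        rw [planeB_inl_one]
        field_simp
        rw [detV2]
        ring
      · rw [planeB_of_ne _ h0 h1 h, cellCoord, if_pos (mem_cellIdx.2 ⟨h0, h1, by simp [h]⟩),
          if_neg (by simp)]
        ring
  have hdiff : planeB (cellCoord g) =
      w + (planeB (cellCoord g) (Sum.inr 0) - w (Sum.inr 0)) • vec (Sum.inr 0) := by
    funext j
    by_cases h : j = Sum.inr 0
    · subst h
      simp [vec]
    · rw [hoff j h]
      simp [vec, h]
  have h2 := form_planeA_planeB (cellCoord g)
  rw [hdiff, form_add_right, form_smul_right, hform, form_vec_inr, planeA_inl_zero, zero_add,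
    mul_one] at h2
  rw [hdiff, h2, zero_smul, add_zero]

lemma mem_P_of_mem {p : G k m} (h0 : act p (vec (Sum.inl 0)) ∈ V2 k m)
    (h1 : act p (vec (Sum.inl 1)) ∈ V2 k m) : p ∈ P k m := by
  have hle : (V2 k m).map (act p) ≤ V2 k m := by
    conv_lhs => rw [V2, Submodule.map_span]
    rw [Submodule.span_le, Set.image_pair]
    rintro x (rfl | rfl)
    · exact h0
    · exact h1
  refine Submodule.eq_of_le_of_finrank_eq hle ?_
  rw [finrank_V2]
  exact (orbit p).2.1

lemma inv_mul_cellG_mem_P {g : G k m} (hg : detV2 g ≠ 0) :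
    g⁻¹ * cellG (cellCoord g) ∈ P k m := by
  refine mem_P_of_mem ?_ ?_
  · rw [act_mul, LinearMap.comp_apply, act_cellG_zero, planeA_cellCoord hg, act_inv_act]
    exact add_mem (Submodule.smul_mem _ _ vec_inl_mem_V2_zero)
      (Submodule.smul_mem _ _ vec_inl_mem_V2_one)
  · rw [act_mul, LinearMap.comp_apply, act_cellG_one, planeB_cellCoord hg, act_inv_act]
    exact add_mem (Submodule.smul_mem _ _ vec_inl_mem_V2_zero)
      (Submodule.smul_mem _ _ vec_inl_mem_V2_one)

lemma orbit_eq_iff {g g' : G k m} : orbit g = orbit g' ↔ g⁻¹ * g' ∈ P k m := by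
  constructor
  · intro h
    have h' : (V2 k m).map (act g) = (V2 k m).map (act g') := congrArg Subtype.val h
    change (V2 k m).map (act (g⁻¹ * g')) = V2 k m
    rw [act_mul, Submodule.map_comp, ← h', ← Submodule.map_comp, ← act_mul, inv_mul_cancel, act_one,
      Submodule.map_id]
  · intro h
    refine Subtype.ext ?_
    change (V2 k m).map (act g) = (V2 k m).map (act g')
    have h' : (V2 k m).map (act (g⁻¹ * g')) = V2 k m := h
    conv_lhs => rw [← h']
    rw [← Submodule.map_comp, ← act_mul, mul_inv_cancel_left]

lemma orbit_mul (g : G k m) {p : G k m} (hp : p ∈ P k m) : orbit (g * p) = orbit g :=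
  (orbit_eq_iff.2 (by rwa [inv_mul_cancel_left])).symm

end Cell

/-! ### Regularity of the actions and of the differential -/

section Regularity

variable {k Y Y' E : Type*} [Field k] {m : ℕ} [AddCommGroup E] [Module k E]
  {A : Subalgebra k (Y → k)} {Ω : Set Y}

lemma reg_add {f g : Y → k} (hf : f ∈ regAlg A Ω) (hg : g ∈ regAlg A Ω) :
    (fun y => f y + g y) ∈ regAlg A Ω := add_mem hf hg

lemma reg_sub {f g : Y → k} (hf : f ∈ regAlg A Ω) (hg : g ∈ regAlg A Ω) :
    (fun y => f y - g y) ∈ regAlg A Ω := sub_mem hf hg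

lemma reg_mul {f g : Y → k} (hf : f ∈ regAlg A Ω) (hg : g ∈ regAlg A Ω) :
    (fun y => f y * g y) ∈ regAlg A Ω := mul_mem hf hg

lemma reg_const (c : k) : (fun _ => c) ∈ regAlg A Ω := algebraMap_mem (regAlg A Ω) c

lemma reg_sum {ι : Type*} (t : Finset ι) {f : ι → Y → k} (hf : ∀ i ∈ t, f i ∈ regAlg A Ω) :
    (fun y => ∑ i ∈ t, f i y) ∈ regAlg A Ω := by
  have := sum_mem hf
  convert this using 1
  funext y
  rw [Finset.sum_apply]

lemma FinReg.pi {ι : Type*} [Fintype ι] {v : Y → ι → k}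
    (h : ∀ i, (fun y => v y i) ∈ regAlg A Ω) : FinReg A Ω v := by
  classical
  refine (FinReg.sum Finset.univ fun i _ =>
    FinReg.smul_const (h i) (Pi.single i (1 : k) : ι → k)).congr fun y _ => ?_
  exact pi_eq_sum_univ' (v y)

lemma FinReg.apply {ι : Type*} {v : Y → ι → k} (h : FinReg A Ω v) (i : ι) :
    (fun y => v y i) ∈ regAlg A Ω := (h.map (LinearMap.proj i)).mem_regAlg

/-- Maps to `G` with regular matrix entries. -/
def RegG (A : Subalgebra k (Y → k)) (Ω : Set Y) (g : Y → G k m) : Prop :=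
  ∀ a b, (fun y => (g y : Matrix (Idx m) (Idx m) k) a b) ∈ regAlg A Ω

namespace RegG

variable {g h : Y → G k m}

lemma const (g : G k m) : RegG A Ω (fun _ => g) := fun _ _ => reg_const _

lemma mul (hg : RegG A Ω g) (hh : RegG A Ω h) : RegG A Ω (fun y => g y * h y) := by
  intro a b
  simp only [Submonoid.coe_mul, Matrix.mul_apply]
  exact reg_sum _ fun c _ => reg_mul (hg a c) (hh c b)

/-- The inverse of a symplectic matrix is −J ᵗg J, whose entries are polynomial in those of g. -/
lemma inv (hg : RegG A Ω g) : RegG A Ω (fun y => (g y)⁻¹) := by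
  intro a b
  simp only [SymplecticGroup.coe_inv, Matrix.mul_apply, Matrix.transpose_apply]
  exact reg_sum _ fun c _ => reg_mul (reg_sum _ fun d _ => reg_mul (reg_const _) (hg c d))
    (reg_const _)

lemma mono {Ω₁ : Set Y} (h : Ω₁ ⊆ Ω) (hg : RegG A Ω g) : RegG A Ω₁ g :=
  fun a b => regAlg_mono h (hg a b)

lemma act (hg : RegG A Ω g) (v : V k m) : FinReg A Ω (fun y => act (g y) v) := by
  refine FinReg.pi fun a => ?_
  exact regAlg_congr (reg_sum Finset.univ fun b _ => reg_mul (hg a b) (reg_const (v b)))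
    fun y _ => rfl

lemma act_apply (hg : RegG A Ω g) (v : V k m) (a : Idx m) :
    (fun y => SymplecticDiagonal.act (g y) v a) ∈ regAlg A Ω := (hg.act v).apply a

lemma of_act (h : ∀ a b, (fun y => SymplecticDiagonal.act (g y) (vec b) a) ∈ regAlg A Ω) :
    RegG A Ω g := by
  intro a b
  refine regAlg_congr (h a b) fun y _ => ?_
  rw [SymplecticDiagonal.act, Matrix.mulVecLin_apply, vec, Matrix.mulVec_single_one]
  rfl

lemma coact (hg : RegG A Ω g) (f : VDual k m) : FinReg A Ω (fun y => coact (g y) f) := by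
  refine (FinReg.sum Finset.univ fun b _ => FinReg.smul_const
    ((hg.inv.act (vec b)).map f).mem_regAlg (covec b : VDual k m)).congr fun y _ => ?_
  refine (Pi.basisFun k (Idx m)).ext fun b => ?_
  simp only [Pi.basisFun_apply, LinearMap.sum_apply, LinearMap.smul_apply, covec,
    LinearMap.proj_apply, smul_eq_mul, Pi.single_apply, mul_ite, mul_one, mul_zero,
    Finset.sum_ite_eq', Finset.mem_univ, if_true]
  rfl

lemma actVV (hg : RegG A Ω g) (hh : RegG A Ω h) (u : V k m ⊗[k] VDual k m) :
    FinReg A Ω (fun y => actVV (g y) (h y) u) := by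
  induction u with
  | zero => exact FinReg.zero.congr fun y _ => map_zero _
  | add a b ha hb => exact (ha.add hb).congr fun y _ => map_add _ _ _
  | tmul v f => exact (hg.act v).map₂ (hh.coact f) (TensorProduct.mk k _ _)

lemma detV2 (hg : RegG A Ω g) : (fun y => detV2 (g y)) ∈ regAlg A Ω :=
  reg_sub (reg_mul (hg.act_apply _ _) (hg.act_apply _ _))
    (reg_mul (hg.act_apply _ _) (hg.act_apply _ _))

lemma cellCoord (hg : RegG A Ω g) (hne : ∀ y ∈ Ω, SymplecticDiagonal.detV2 (g y) ≠ 0)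
    (c : Fin 2 × Idx m) : (fun y => cellCoord (g y) c) ∈ regAlg A Ω := by
  simp only [SymplecticDiagonal.cellCoord]
  split_ifs with h h0
  · simp only [div_eq_mul_inv]
    exact reg_mul (reg_sub (reg_mul (hg.act_apply _ _) (hg.act_apply _ _))
      (reg_mul (hg.act_apply _ _) (hg.act_apply _ _))) (regAlg_inv hg.detV2 hne)
  · simp only [div_eq_mul_inv]
    exact reg_mul (reg_sub (reg_mul (hg.act_apply _ _) (hg.act_apply _ _))
      (reg_mul (hg.act_apply _ _) (hg.act_apply _ _))) (regAlg_inv hg.detV2 hne)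
  · exact reg_const 0

end RegG

lemma reg_form {v w : Y → V k m} (hv : ∀ j, (fun y => v y j) ∈ regAlg A Ω)
    (hw : ∀ j, (fun y => w y j) ∈ regAlg A Ω) : (fun y => form (v y) (w y)) ∈ regAlg A Ω := by
  simp only [form_eq_sum]
  exact reg_sum _ fun i _ => reg_sub (reg_mul (hv _) (hw _)) (reg_mul (hv _) (hw _))

section CellG

variable {z : Y → Fin 2 × Idx m → k} (hz : ∀ c, (fun y => z y c) ∈ regAlg A Ω)
include hz

lemma reg_planeA (j : Idx m) : (fun y => planeA (z y) j) ∈ regAlg A Ω := by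
  simp only [planeA]
  split_ifs
  · exact reg_const _
  · exact reg_const _
  · exact hz _

lemma reg_planeB' (j : Idx m) : (fun y => planeB' (z y) j) ∈ regAlg A Ω := by
  simp only [planeB']
  split_ifs
  · exact reg_const _
  · exact reg_const _
  · exact reg_const _
  · exact hz _

lemma reg_planeB (j : Idx m) : (fun y => planeB (z y) j) ∈ regAlg A Ω :=
  reg_sub (reg_planeB' hz j)
    (reg_mul (reg_form (reg_planeA hz) (reg_planeB' hz)) (reg_const (vec (Sum.inr 0) j)))

lemma regG_cellG : RegG A Ω (fun y => cellG (z y)) := by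
  refine RegG.of_act fun a b => ?_
  simp only [act_cellG, unipotent, Pi.add_apply, Pi.smul_apply, smul_eq_mul]
  refine reg_add (reg_add (reg_mul (reg_const _) (reg_planeA hz a))
    (reg_mul (reg_const _) (reg_planeB hz a))) (reg_add (reg_add (reg_const _)
      (reg_mul (reg_add (reg_form (fun _ => reg_const _) (reg_planeA hz)) (reg_const _))
        (reg_const _)))
      (reg_mul (reg_add (reg_form (fun _ => reg_const _) (reg_planeB hz)) (reg_const _))
        (reg_const _)))

end CellG

section Families

variable {U U' : Type*} [AddCommGroup U] [Module k U] [AddCommGroup U'] [Module k U']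

lemma finReg_algHom
    {ρ : Y → Polynomial (ExteriorAlgebra k U) →ₐ[k] Polynomial (ExteriorAlgebra k U')}
    (hι : ∀ u, FinReg A Ω (fun y => ρ y (Polynomial.C (ExteriorAlgebra.ι k u))))
    (hX : FinReg A Ω (fun y => ρ y Polynomial.X)) (a : Polynomial (ExteriorAlgebra k U)) :
    FinReg A Ω (fun y => ρ y a) := by
  induction a using polyExt_induction with
  | algebraMap r => exact (FinReg.const _).congr fun y _ => AlgHom.commutes _ r
  | add a b ha hb => exact (ha.add hb).congr fun y _ => map_add _ _ _
  | ι_mul u a ha => exact ((hι u).mul ha).congr fun y _ => map_mul _ _ _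
  | X_mul a ha => exact (hX.mul ha).congr fun y _ => map_mul _ _ _

variable (k U) in
/-- The linear map `u ↦ C (ι u)`. -/
def Cι : U →ₗ[k] Polynomial (ExteriorAlgebra k U) :=
  (Polynomial.CAlgHom (R := k)).toLinearMap ∘ₗ ExteriorAlgebra.ι k

lemma FinReg.C_ι {u : Y → U} (hu : FinReg A Ω u) :
    FinReg A Ω (fun y => Polynomial.C (ExteriorAlgebra.ι k (u y))) := hu.map (Cι k U)

lemma finReg_polyD {φ : Y → Module.Dual k U} {t : Y → U}
    (hφ : ∀ u, (fun y => φ y u) ∈ regAlg A Ω) (ht : FinReg A Ω t)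
    (a : Polynomial (ExteriorAlgebra k U)) : FinReg A Ω (fun y => polyD (φ y) (t y) a) := by
  induction a using polyExt_induction with
  | algebraMap r => exact FinReg.zero.congr fun y _ => polyD_algebraMap _ _ r
  | add a b ha hb => exact (ha.add hb).congr fun y _ => map_add _ _ _
  | ι_mul u a ha =>
    exact ((FinReg.smul_const (hφ u) a).sub ((FinReg.const _).mul ha)).congr
      fun y _ => polyD_ι_mul _ _ u a
  | X_mul a ha =>
    exact ((ht.C_ι.mul (FinReg.const a)).add ((FinReg.const _).mul ha)).congr
      fun y _ => polyD_X_mul _ _ a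

end Families

variable {g h : Y → G k m}

lemma finReg_wedgeSym {v w : Y → V k m} {α : Y → VDual k m →ₗ[k] VDual k m}
    (hv : FinReg A Ω v) (hw : FinReg A Ω w) (hα : ∀ f, FinReg A Ω (fun y => α y f))
    (τ : VDual k m ⊗[k] VDual k m) :
    FinReg A Ω (fun y => wedgeSym (v y) (w y) (TensorProduct.map (α y) (α y) τ)) := by
  induction τ with
  | zero => exact FinReg.zero.congr fun y _ => by simp only [map_zero, Pi.zero_apply]
  | add a b ha hb => exact (ha.add hb).congr fun y _ => by simp only [map_add]
  | tmul f f' =>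
    exact ((hv.map₂ (hα f) (TensorProduct.mk k _ _)).map (ExteriorAlgebra.ι k)).mul
      ((hw.map₂ (hα f') (TensorProduct.mk k _ _)).map (ExteriorAlgebra.ι k))

lemma finReg_actT (hg : RegG A Ω g) (hh : RegG A Ω h) :
    FinReg A Ω (fun y => actT (g y) (h y)) := by
  have h1 := finReg_wedgeSym (hg.act (vec (Sum.inl 0))) (hg.act (vec (Sum.inl 1)))
    (fun f => hh.coact f) eta
  have h2 := finReg_wedgeSym (hg.act (vec (Sum.inl 0))) (hg.act (vec (Sum.inl 1)))
    (fun f => FinReg.const (A := A) (Ω := Ω) (E := VDual k m) (LinearMap.id f)) eta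
  refine ((FinReg.smul_const hg.detV2 Polynomial.X).add ((h1.sub h2).map
    (Polynomial.CAlgHom (R := k)).toLinearMap)).congr fun y _ => ?_
  rw [actT_eq, etaDiff, map_sub, TensorProduct.map_id, LinearMap.id_apply]
  rfl

lemma finReg_rhoHom (hg : RegG A Ω g) (hh : RegG A Ω h) (a : ExtT k m) :
    FinReg A Ω (fun y => rhoHom (g y) (h y) a) := by
  refine finReg_algHom (ρ := fun y => rhoHom (g y) (h y)) (fun u => ?_) ?_ a
  · exact (hg.actVV hh u).C_ι.congr fun y _ => rhoHom_ι _ _ u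
  · exact (finReg_actT hg hh).congr fun y _ => rhoHom_X _ _

lemma reg_ev (hg : RegG A Ω g) (hh : RegG A Ω h) (u : V k m ⊗[k] VDual k m) :
    (fun y => ev (g y, h y) u) ∈ regAlg A Ω := by
  induction u with
  | zero => exact regAlg_congr (reg_const 0) fun y _ => map_zero _
  | add a b ha hb => exact regAlg_congr (reg_add ha hb) fun y _ => map_add _ _ _
  | tmul v f =>
    exact regAlg_congr (((hh.inv.mul hg).act v).map f).mem_regAlg fun y _ => ev_tmul _ _ _

lemma finReg_cyc (hg : RegG A Ω g) (hh : RegG A Ω h) :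
    FinReg A Ω (fun y => cyc (g y, h y)) :=
  FinReg.sum Finset.univ fun i _ =>
    ((FinReg.smul_const (reg_ev hg hh (vec (Sum.inl 0) ⊗ₜ covec (Sum.inl i)))
        (vec (Sum.inl 1) : V k m)).sub
      (FinReg.smul_const (reg_ev hg hh (vec (Sum.inl 1) ⊗ₜ covec (Sum.inl i)))
        (vec (Sum.inl 0) : V k m))).map
      ((TensorProduct.mk k (V k m) (VDual k m)).flip (covec (Sum.inr i)))

lemma finReg_diff (hg : RegG A Ω g) (hh : RegG A Ω h) {s : Y → ExtT k m}
    (hs : FinReg A Ω s) : FinReg A Ω (fun y => diff (g y, h y) (s y)) :=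
  hs.bind (fun y => diff (g y, h y)) fun a =>
    finReg_polyD (fun u => reg_ev hg hh u) (finReg_cyc hg hh) a

/-! #### Polynomial functions on `G × G` and on affine spaces -/

lemma comp_mem_of_regG {ψ : Y → G k m × G k m} (h1 : RegG A Ω (fun y => (ψ y).1))
    (h2 : RegG A Ω (fun y => (ψ y).2)) : ∀ a ∈ polyGG k m, a ∘ ψ ∈ regAlg A Ω := by
  intro a ha
  induction ha using Algebra.adjoin_induction with
  | mem f hf =>
    rcases hf with ⟨a, b, rfl⟩ | ⟨a, b, rfl⟩
    · exact h1 a b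
    · exact h2 a b
  | algebraMap r => exact reg_const r
  | add f f' _ _ hf hf' => exact reg_add hf hf'
  | mul f f' _ _ hf hf' => exact reg_mul hf hf'

lemma regG_fst (Ω : Set (G k m × G k m)) : RegG (polyGG k m) Ω Prod.fst :=
  fun a b => le_regAlg (Algebra.subset_adjoin (Or.inl ⟨a, b, rfl⟩))

lemma regG_snd (Ω : Set (G k m × G k m)) : RegG (polyGG k m) Ω Prod.snd :=
  fun a b => le_regAlg (Algebra.subset_adjoin (Or.inr ⟨a, b, rfl⟩))

lemma regG_id (Ω : Set (G k m)) : RegG (polyG k m) Ω id :=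
  fun a b => le_regAlg (Algebra.subset_adjoin ⟨a, b, rfl⟩)

lemma comp_mem_of_regG' {ψ : Y → G k m} (h1 : RegG A Ω ψ) :
    ∀ a ∈ polyG k m, a ∘ ψ ∈ regAlg A Ω := by
  intro a ha
  induction ha using Algebra.adjoin_induction with
  | mem f hf =>
    obtain ⟨a, b, rfl⟩ := hf
    exact h1 a b
  | algebraMap r => exact reg_const r
  | add f f' _ _ hf hf' => exact reg_add hf hf'
  | mul f f' _ _ hf hf' => exact reg_mul hf hf'

variable {σ : Type*}

variable (k σ) in
/-- Polynomial functions on the affine space `k^σ`. -/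
def polyAff : Subalgebra k ((σ → k) → k) where
  carrier := {f | ∃ r : MvPolynomial σ k, ∀ z, f z = MvPolynomial.eval z r}
  mul_mem' := by
    rintro f g ⟨r, hr⟩ ⟨r', hr'⟩
    exact ⟨r * r', fun z => by rw [map_mul, Pi.mul_apply, hr, hr']⟩
  add_mem' := by
    rintro f g ⟨r, hr⟩ ⟨r', hr'⟩
    exact ⟨r + r', fun z => by rw [map_add, Pi.add_apply, hr, hr']⟩
  algebraMap_mem' c := ⟨MvPolynomial.C c, fun z => by rw [MvPolynomial.eval_C]; rfl⟩

lemma eval_mem_regAlg (r : MvPolynomial σ k) (Ω : Set (σ → k)) :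
    (fun z => MvPolynomial.eval z r) ∈ regAlg (polyAff k σ) Ω := le_regAlg ⟨r, fun _ => rfl⟩

lemma coord_mem_regAlg (i : σ) (Ω : Set (σ → k)) :
    (fun z => z i) ∈ regAlg (polyAff k σ) Ω :=
  regAlg_congr (eval_mem_regAlg (MvPolynomial.X i) Ω) fun z _ => by rw [MvPolynomial.eval_X]

lemma comp_mem_of_coord {ψ : Y → σ → k} (h : ∀ i, (fun y => ψ y i) ∈ regAlg A Ω) :
    ∀ a ∈ polyAff k σ, a ∘ ψ ∈ regAlg A Ω := by
  rintro a ⟨r, hr⟩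
  refine regAlg_congr (f := fun y => MvPolynomial.eval (ψ y) r) ?_ fun y _ => hr _
  induction r using MvPolynomial.induction_on generalizing a with
  | C c => exact regAlg_congr (reg_const c) fun y _ => by rw [MvPolynomial.eval_C]
  | add p q hp hq =>
    exact regAlg_congr (reg_add (hp _ fun _ => rfl) (hq _ fun _ => rfl)) fun y _ => map_add _ _ _
  | mul_X p i hp =>
    exact regAlg_congr (reg_mul (hp _ fun _ => rfl) (h i)) fun y _ => by
      rw [map_mul, MvPolynomial.eval_X]

lemma finReg_evalMap (f : MvPolynomial σ k ⊗[k] E) (Ω : Set (σ → k)) :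
    FinReg (polyAff k σ) Ω (fun z => evalMap z f) := by
  induction f with
  | zero => exact FinReg.zero.congr fun z _ => map_zero _
  | add a b ha hb => exact (ha.add hb).congr fun z _ => map_add _ _ _
  | tmul r a =>
    exact (FinReg.smul_const (eval_mem_regAlg r Ω) a).congr fun z _ => evalMap_tmul z r a

/-- Denominators are cleared one summand at a time. They are only available near z₀, so the identity
is restricted to the locus where their product is nonzero. -/
lemma FinReg.exists_evalMap {Ω : Set (σ → k)} {s : (σ → k) → E}
    (hs : FinReg (polyAff k σ) Ω s) {z₀ : σ → k} (hz₀ : z₀ ∈ Ω) :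
    ∃ (q : MvPolynomial σ k) (f : MvPolynomial σ k ⊗[k] E), MvPolynomial.eval z₀ q ≠ 0 ∧
      ∀ z ∈ Ω, MvPolynomial.eval z q ≠ 0 → evalMap z f = MvPolynomial.eval z q • s z := by
  induction hs with
  | zero => exact ⟨1, 0, by rw [map_one]; exact one_ne_zero, fun z _ _ => by simp⟩
  | add_smul c hc e s hs s' h ih =>
    obtain ⟨q, f, hq, hf⟩ := ih
    obtain ⟨a, ⟨ra, hra⟩, b, ⟨rb, hrb⟩, hb, hab⟩ := hc z₀ hz₀
    refine ⟨q * rb, (q * ra) ⊗ₜ e + TensorProduct.map (LinearMap.mulLeft k rb) LinearMap.id f,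
      ?_, fun z hz hne => ?_⟩
    · rw [map_mul, ← hrb]
      exact mul_ne_zero hq hb
    · rw [map_mul, mul_ne_zero_iff] at hne
      rw [map_add, evalMap_tmul, evalMap_mul, hf z hz hne.1, h z hz, hab z hz (by rw [hrb]; exact hne.2),
        map_mul, map_mul, hra, hrb, smul_add, smul_smul, smul_smul]
      congr 2
      · have := hne.2
        field_simp
      · rw [mul_comm]

end Regularity

/-! ### Local slices of `G × G → X × X` and extension of sections from a slice -/

section Slice

variable {k : Type*} [Field k] {m : ℕ}

variable (m) in
/-- Indices of the coordinates on the product of two open cells. -/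
abbrev PairIdx : Type := (Fin 2 × Idx m) ⊕ (Fin 2 × Idx m)

section

variable (g₀ h₀ : G k m)

/-- A slice of `G × G → X × X` through `(g₀, h₀)`. -/
def sliceMap (z : PairIdx m → k) : G k m × G k m :=
  (h₀ * cellG (fun c => z (Sum.inr c)) * (h₀⁻¹ * g₀) * cellG (fun c => z (Sum.inl c)),
    h₀ * cellG (fun c => z (Sum.inr c)))

lemma sliceMap_zero : sliceMap g₀ h₀ 0 = (g₀, h₀) := by
  have : cellG (fun _ => 0 : Fin 2 × Idx m → k) = 1 := cellG_zero
  simp only [sliceMap, Pi.zero_apply, this, mul_one, mul_inv_cancel_left]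

/-- This is the purpose of the form of `sliceMap`: h⁻¹g, and with it the differential, depends on
the first block of coordinates only, the second block being mere parameters. -/
lemma sliceMap_inv_mul (z : PairIdx m → k) : (sliceMap g₀ h₀ z).2⁻¹ * (sliceMap g₀ h₀ z).1 =
    h₀⁻¹ * g₀ * cellG (fun c => z (Sum.inl c)) := by
  simp only [sliceMap]
  group

lemma regG_cellG_comp (f : Fin 2 × Idx m → PairIdx m) (Ω : Set (PairIdx m → k)) :
    RegG (polyAff k (PairIdx m)) Ω (fun z => cellG (fun c => z (f c))) :=
  regG_cellG fun _ => coord_mem_regAlg _ Ω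

lemma regG_sliceMap_snd (Ω : Set (PairIdx m → k)) :
    RegG (polyAff k (PairIdx m)) Ω (fun z => (sliceMap g₀ h₀ z).2) :=
  (RegG.const h₀).mul (regG_cellG_comp _ Ω)

lemma regG_sliceMap_fst (Ω : Set (PairIdx m → k)) :
    RegG (polyAff k (PairIdx m)) Ω (fun z => (sliceMap g₀ h₀ z).1) :=
  (((RegG.const h₀).mul (regG_cellG_comp _ Ω)).mul (RegG.const _)).mul (regG_cellG_comp _ Ω)

lemma isZariskiOpen_preimage_sliceMap {Ω : Set (G k m × G k m)}
    (hΩ : IsZariskiOpen (polyGG k m) Ω) :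
    IsZariskiOpen (polyAff k (PairIdx m)) {z | sliceMap g₀ h₀ z ∈ Ω} := by
  have := (isZariskiOpen_univ (A := polyAff k (PairIdx m))).preimage (ψ := sliceMap g₀ h₀)
    (comp_mem_of_regG (regG_sliceMap_fst g₀ h₀ _) (regG_sliceMap_snd g₀ h₀ _)) hΩ
  convert this using 1
  ext z
  simp

lemma FinReg.comp_sliceMap {E : Type*} [AddCommGroup E] [Module k E] {Ω : Set (G k m × G k m)}
    {s : G k m × G k m → E} (hs : FinReg (polyGG k m) Ω s) :
    FinReg (polyAff k (PairIdx m)) {z | sliceMap g₀ h₀ z ∈ Ω} (fun z => s (sliceMap g₀ h₀ z)) :=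
  hs.comp (comp_mem_of_regG (regG_sliceMap_fst g₀ h₀ _) (regG_sliceMap_snd g₀ h₀ _))
    fun _ hz => hz

/-- The second component of the slice point over `y`. -/
def sliceH (y : G k m × G k m) : G k m := h₀ * cellG (cellCoord (h₀⁻¹ * y.2))

/-- The first component of `y`, moved close to the identity. -/
def sliceU (y : G k m × G k m) : G k m := (sliceH h₀ y * (h₀⁻¹ * g₀))⁻¹ * y.1

/-- The coordinates of the slice point over `y`. -/
def sliceCoord (y : G k m × G k m) : PairIdx m → k :=
  Sum.elim (cellCoord (sliceU g₀ h₀ y)) (cellCoord (h₀⁻¹ * y.2))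

/-- The element of `P` that moves the first component of `y` to the slice. -/
def sliceP (y : G k m × G k m) : G k m :=
  (sliceU g₀ h₀ y)⁻¹ * cellG (cellCoord (sliceU g₀ h₀ y))

/-- The element of `P` that moves the second component of `y` to the slice. -/
def sliceQ (y : G k m × G k m) : G k m := (h₀⁻¹ * y.2)⁻¹ * cellG (cellCoord (h₀⁻¹ * y.2))

/-- The open set on which the slice coordinates of the second component are defined. -/
def sliceDom₂ : Set (G k m × G k m) := {y | detV2 (h₀⁻¹ * y.2) ≠ 0}

/-- The open set on which the slice coordinates are defined. -/
def sliceDom : Set (G k m × G k m) := {y | y ∈ sliceDom₂ h₀ ∧ detV2 (sliceU g₀ h₀ y) ≠ 0}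

lemma mul_sliceP_sliceQ (y : G k m × G k m) :
    (y.1 * sliceP g₀ h₀ y, y.2 * sliceQ h₀ y) = sliceMap g₀ h₀ (sliceCoord g₀ h₀ y) := by
  simp only [sliceMap, sliceP, sliceQ, sliceCoord, Sum.elim_inl, Sum.elim_inr]
  refine Prod.ext ?_ ?_
  · simp only [sliceU, sliceH]
    group
  · group

lemma sliceP_mem {y : G k m × G k m} (hy : y ∈ sliceDom g₀ h₀) : sliceP g₀ h₀ y ∈ P k m :=
  inv_mul_cellG_mem_P hy.2

lemma sliceQ_mem {y : G k m × G k m} (hy : y ∈ sliceDom g₀ h₀) : sliceQ h₀ y ∈ P k m :=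
  inv_mul_cellG_mem_P hy.1

section Invariance

variable {p q : G k m} (hp : p ∈ P k m) (hq : q ∈ P k m) (y : G k m × G k m)

include hq in
lemma cellCoord_snd_mul : cellCoord (h₀⁻¹ * (y.2 * q)) = cellCoord (h₀⁻¹ * y.2) := by
  rw [← mul_assoc, cellCoord_mul _ hq]

include hq in
lemma sliceU_mul : sliceU g₀ h₀ (y.1 * p, y.2 * q) = sliceU g₀ h₀ y * p := by
  rw [sliceU, sliceU, sliceH, sliceH, cellCoord_snd_mul h₀ hq, mul_assoc _ y.1]

include hp hq in
lemma sliceCoord_mul : sliceCoord g₀ h₀ (y.1 * p, y.2 * q) = sliceCoord g₀ h₀ y := by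
  rw [sliceCoord, sliceU_mul g₀ h₀ hq, cellCoord_snd_mul h₀ hq, cellCoord_mul _ hp]
  rfl

include hp hq in
lemma mul_sliceP_mul : p * sliceP g₀ h₀ (y.1 * p, y.2 * q) = sliceP g₀ h₀ y := by
  rw [sliceP, sliceU_mul g₀ h₀ hq, cellCoord_mul _ hp, sliceP]
  group

include hq in
lemma mul_sliceQ_mul : q * sliceQ h₀ (y.1 * p, y.2 * q) = sliceQ h₀ y := by
  rw [sliceQ, cellCoord_snd_mul h₀ hq, sliceQ]
  group

include hp hq in
lemma sliceDom_mul : (y.1 * p, y.2 * q) ∈ sliceDom g₀ h₀ ↔ y ∈ sliceDom g₀ h₀ := by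
  simp only [sliceDom, sliceDom₂, Set.mem_ofPred_eq, sliceU_mul g₀ h₀ hq, ← mul_assoc,
    detV2_mul _ hp, detV2_mul _ hq, mul_ne_zero_iff, detV2_ne_zero hp, detV2_ne_zero hq, ne_eq,
    not_false_eq_true, and_true]

end Invariance

lemma regG_snd_left (Ω : Set (G k m × G k m)) :
    RegG (polyGG k m) Ω (fun y => h₀⁻¹ * y.2) := (RegG.const h₀⁻¹).mul (regG_snd Ω)

lemma isZariskiOpen_sliceDom₂ : IsZariskiOpen (polyGG k m) (sliceDom₂ h₀) := by
  have := (isZariskiOpen_univ (A := polyGG k m)).ne_zero (regG_snd_left h₀ Set.univ).detV2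
  convert this using 1
  ext y
  simp [sliceDom₂]

lemma regG_cellG_snd :
    RegG (polyGG k m) (sliceDom₂ h₀) (fun y => cellG (cellCoord (h₀⁻¹ * y.2))) :=
  regG_cellG fun c => (regG_snd_left h₀ _).cellCoord (fun _ hy => hy) c

lemma regG_sliceU : RegG (polyGG k m) (sliceDom₂ h₀) (sliceU g₀ h₀) :=
  ((((RegG.const h₀).mul (regG_cellG_snd h₀)).mul (RegG.const _)).inv).mul (regG_fst _)

lemma isZariskiOpen_sliceDom : IsZariskiOpen (polyGG k m) (sliceDom g₀ h₀) :=
  (isZariskiOpen_sliceDom₂ h₀).ne_zero (regG_sliceU g₀ h₀).detV2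

lemma sliceDom_subset : sliceDom g₀ h₀ ⊆ sliceDom₂ h₀ := fun _ hy => hy.1

lemma reg_sliceCoord (c : PairIdx m) :
    (fun y => sliceCoord g₀ h₀ y c) ∈ regAlg (polyGG k m) (sliceDom g₀ h₀) := by
  rcases c with c | c
  · exact ((regG_sliceU g₀ h₀).mono (sliceDom_subset g₀ h₀)).cellCoord (fun _ hy => hy.2) c
  · exact (regG_snd_left h₀ _).cellCoord (fun _ hy => hy.1) c

lemma regG_sliceQ : RegG (polyGG k m) (sliceDom g₀ h₀) (sliceQ h₀) :=
  (regG_snd_left h₀ _).inv.mul ((regG_cellG_snd h₀).mono (sliceDom_subset g₀ h₀))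

lemma regG_sliceP : RegG (polyGG k m) (sliceDom g₀ h₀) (sliceP g₀ h₀) :=
  ((regG_sliceU g₀ h₀).mono (sliceDom_subset g₀ h₀)).inv.mul
    (regG_cellG fun c => reg_sliceCoord g₀ h₀ (Sum.inl c))

lemma sliceU_base : sliceU g₀ h₀ (g₀, h₀) = 1 := by
  rw [sliceU, sliceH, inv_mul_cancel, cellCoord_one, cellG_zero, mul_one, mul_inv_cancel_left,
    inv_mul_cancel]

lemma base_mem_sliceDom : (g₀, h₀) ∈ sliceDom g₀ h₀ := by
  refine ⟨?_, ?_⟩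
  · change detV2 (h₀⁻¹ * h₀) ≠ 0
    rw [inv_mul_cancel, detV2_one]
    exact one_ne_zero
  · rw [sliceU_base, detV2_one]
    exact one_ne_zero

lemma sliceCoord_base : sliceCoord g₀ h₀ (g₀, h₀) = 0 := by
  rw [sliceCoord, sliceU_base, inv_mul_cancel, cellCoord_one]
  funext c
  rcases c with c | c <;> rfl

end

lemma preim_mul {U : Set (SpGr k m × SpGr k m)} {p q : G k m} (hp : p ∈ P k m) (hq : q ∈ P k m)
    {y : G k m × G k m} : (y.1 * p, y.2 * q) ∈ preim U ↔ y ∈ preim U := by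
  change (orbit (y.1 * p), orbit (y.2 * q)) ∈ U ↔ (orbit y.1, orbit y.2) ∈ U
  rw [orbit_mul _ hp, orbit_mul _ hq]

/-- Points of G × G with the same image in X × X differ by P × P, so a stable set is saturated. -/
lemma preim_image {Ω : Set (G k m × G k m)}
    (h : ∀ y, ∀ p ∈ P k m, ∀ q ∈ P k m, y ∈ Ω → (y.1 * p, y.2 * q) ∈ Ω) :
    preim ((fun y : G k m × G k m => (orbit y.1, orbit y.2)) '' Ω) = Ω := by
  ext y
  constructor
  · rintro ⟨y', hy', he⟩
    obtain ⟨h1, h2⟩ := Prod.ext_iff.1 he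
    have := h y' _ (orbit_eq_iff.1 h1) _ (orbit_eq_iff.1 h2) hy'
    rwa [mul_inv_cancel_left, mul_inv_cancel_left] at this
  · exact fun hy => ⟨y, hy, rfl⟩

lemma IsSection.finReg {j : ℕ} {U : Set (SpGr k m × SpGr k m)} {s : G k m × G k m → ExtT k m}
    (hs : IsSection j U s) : FinReg (polyGG k m) (preim U) s :=
  hs.regular.finReg (M k m j) hs.mem

/-- Near (g₀, h₀) a regular family (p, q) in P × P moves each y to the slice. The values of s₀ are
transported back by `rhoHom p q`, and equivariance follows from the cocycle property of (p, q) in y.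
-/
theorem exists_section_of_slice [CharZero k] (g₀ h₀ : G k m) {U : Set (SpGr k m × SpGr k m)}
    (hU : IsOpenXX U) (hx : (orbit g₀, orbit h₀) ∈ U) {Ω : Set (PairIdx m → k)}
    (hΩ : IsZariskiOpen (polyAff k (PairIdx m)) Ω) (h0 : 0 ∈ Ω) {j : ℕ}
    {s₀ : (PairIdx m → k) → ExtT k m} (hs₀ : FinReg (polyAff k (PairIdx m)) Ω s₀)
    (hM : ∀ z ∈ Ω, s₀ z ∈ M k m j) :
    ∃ U', IsOpenXX U' ∧ (orbit g₀, orbit h₀) ∈ U' ∧ U' ⊆ U ∧ ∃ s, IsSection j U' s ∧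
      ∀ y ∈ preim U', ∃ p ∈ P k m, ∃ q ∈ P k m, ∃ z ∈ Ω,
        (y.1 * p, y.2 * q) = sliceMap g₀ h₀ z ∧ s y = rhoHom p q (s₀ z) := by
  let Ω' : Set (G k m × G k m) :=
    {y | y ∈ sliceDom g₀ h₀ ∧ sliceCoord g₀ h₀ y ∈ Ω} ∩ preim U
  have hcoord := comp_mem_of_coord (reg_sliceCoord g₀ h₀)
  have hopen : IsZariskiOpen (polyGG k m) Ω' :=
    ((isZariskiOpen_sliceDom g₀ h₀).preimage hcoord hΩ).inter hU
  let U' := (fun y : G k m × G k m => (orbit y.1, orbit y.2)) '' Ω'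
  have hpre : preim U' = Ω' := by
    refine preim_image ?_
    rintro y p hp q hq ⟨⟨hy1, hy2⟩, hy3⟩
    refine ⟨⟨(sliceDom_mul g₀ h₀ hp hq y).2 hy1, ?_⟩, (preim_mul hp hq).2 hy3⟩
    rwa [sliceCoord_mul g₀ h₀ hp hq y]
  have hsub : Ω' ⊆ sliceDom g₀ h₀ := fun y hy => hy.1.1
  refine ⟨U', ?_, ⟨(g₀, h₀), ⟨⟨base_mem_sliceDom g₀ h₀, ?_⟩, hx⟩, rfl⟩, ?_,
    fun y => rhoHom (sliceP g₀ h₀ y) (sliceQ h₀ y) (s₀ (sliceCoord g₀ h₀ y)), ⟨?_, ?_, ?_⟩, ?_⟩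
  · rw [IsOpenXX, hpre]
    exact hopen
  · rw [sliceCoord_base]
    exact h0
  · rintro _ ⟨y, hy, rfl⟩
    exact hy.2
  · intro y hy
    rw [hpre] at hy
    exact rhoHom_mem_M (sliceP_mem g₀ h₀ hy.1.1) (sliceQ_mem g₀ h₀ hy.1.1) (hM _ hy.1.2)
  · rw [hpre]
    refine FinReg.isRegularOn ?_
    have h1 : FinReg (polyGG k m) Ω' (fun y => s₀ (sliceCoord g₀ h₀ y)) :=
      hs₀.comp (fun a ha => regAlg_mono hsub (hcoord a ha)) fun y hy => hy.1.2
    exact h1.bind (fun y => (rhoHom (sliceP g₀ h₀ y) (sliceQ h₀ y)).toLinearMap) fun a =>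
      finReg_rhoHom ((regG_sliceP g₀ h₀).mono hsub) ((regG_sliceQ g₀ h₀).mono hsub) a
  · intro y hy p hp q hq
    rw [hpre] at hy
    have hp' : sliceP g₀ h₀ (y.1 * p, y.2 * q) ∈ P k m :=
      sliceP_mem g₀ h₀ ((sliceDom_mul g₀ h₀ hp hq y).2 hy.1.1)
    rw [rho_eq, rhoHom_comp _ _ hp', sliceCoord_mul g₀ h₀ hp hq, mul_sliceP_mul g₀ h₀ hp hq,
      mul_sliceQ_mul h₀ hq]
  · intro y hy
    rw [hpre] at hy
    exact ⟨_, sliceP_mem g₀ h₀ hy.1.1, _, sliceQ_mem g₀ h₀ hy.1.1, _, hy.1.2,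
      mul_sliceP_sliceQ g₀ h₀ y, rfl⟩

/-- To solve `d s' = s` near a point, it suffices to do so on a slice. -/
theorem exists_primitive_of_slice [CharZero k] (g₀ h₀ : G k m) {U : Set (SpGr k m × SpGr k m)}
    (hU : IsOpenXX U) (hx : (orbit g₀, orbit h₀) ∈ U) {Ω : Set (PairIdx m → k)}
    (hΩ : IsZariskiOpen (polyAff k (PairIdx m)) Ω) (h0 : 0 ∈ Ω) {i j : ℕ}
    {s₀ : (PairIdx m → k) → ExtT k m} (hs₀ : FinReg (polyAff k (PairIdx m)) Ω s₀)
    (hM : ∀ z ∈ Ω, s₀ z ∈ M k m j) {s : G k m × G k m → ExtT k m} (hs : IsSection i U s)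
    (hd : ∀ z ∈ Ω, sliceMap g₀ h₀ z ∈ preim U →
      diff (sliceMap g₀ h₀ z) (s₀ z) = s (sliceMap g₀ h₀ z)) :
    ∃ U', IsOpenXX U' ∧ (orbit g₀, orbit h₀) ∈ U' ∧ U' ⊆ U ∧ ∃ s', IsSection j U' s' ∧
      ∀ y ∈ preim U', diff y (s' y) = s y := by
  obtain ⟨U', hU', hx', hsub, s', hs', h⟩ := exists_section_of_slice g₀ h₀ hU hx hΩ h0 hs₀ hM
  refine ⟨U', hU', hx', hsub, s', hs', fun y hy => ?_⟩
  obtain ⟨p, hp, q, hq, z, hz, hyz, hsy⟩ := h y hy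
  have hyU : y ∈ preim U := hsub hy
  -- Equivariance of d transfers the equation to the slice, where it is assumed; equivariance of s
  -- carries the value back to y.
  rw [hsy, diff_rhoHom y hp, hyz, hd z hz (by rw [← hyz]; exact (preim_mul hp hq).2 hyU), ← hyz]
  exact hs.equivariant y hyU p hp q hq

end Slice

/-! ### The Koszul complex on the slice through a diagonal point -/

section CellFrame

variable {k : Type*} [Field k] {m : ℕ}

/-- The linear form `v ⊗ f ↦ v_a f_b`. -/
def tensorCoord (a b : Idx m) : Module.Dual k (V k m ⊗[k] VDual k m) :=
  LinearMap.mul' k k ∘ₗ TensorProduct.map (covec a) (Module.Dual.eval k (V k m) (vec b))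

lemma tensorCoord_tmul (a b : Idx m) (v : V k m) (f : VDual k m) :
    tensorCoord a b (v ⊗ₜ f) = v a * f (vec b) := rfl

lemma covec_vec (a b : Idx m) : (covec a : VDual k m) (vec b) = if a = b then 1 else 0 := by
  simp [covec, vec, Pi.single_apply]

lemma vec_apply (a b : Idx m) : (vec a : V k m) b = if b = a then 1 else 0 := by
  simp [vec, Pi.single_apply]

lemma lead_injective : Function.Injective (lead (m := m)) := by
  intro a b h
  fin_cases a <;> fin_cases b <;> simp_all [lead]

lemma vec_lead_mem (c : Fin 2) : (vec (lead c) : V k m) ∈ V2 k m := by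
  unfold lead
  split_ifs
  · exact vec_inl_mem_V2_zero
  · exact vec_inl_mem_V2_one

lemma covec_sum (f : VDual k m) : f = ∑ b, f (vec b) • covec b := by
  refine (Pi.basisFun k (Idx m)).ext fun b => ?_
  simp only [Pi.basisFun_apply, LinearMap.sum_apply, LinearMap.smul_apply, covec,
    LinearMap.proj_apply, smul_eq_mul, Pi.single_apply, mul_ite, mul_one, mul_zero,
    Finset.sum_ite_eq', Finset.mem_univ, if_true]
  rfl

lemma V2_sum {v : V k m} (hv : v ∈ V2 k m) : v = ∑ c : Fin 2, v (lead c) • vec (lead c) := by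
  rw [Fin.sum_univ_two]
  exact mem_V2_eq hv

lemma apply_vec_of_mem_L {f : VDual k m} (hf : f ∈ L k m) (c : Fin 2) : f (vec (lead c)) = 0 :=
  (Submodule.mem_dualAnnihilator f).1 hf _ (vec_lead_mem c)

variable (m) in
/-- The coordinates on the first of two open cells. -/
def pairIdx : Finset (PairIdx m) := (cellIdx m).map Function.Embedding.inl

lemma inr_zero_notMem_cellIdx : ((1, Sum.inr 0) : Fin 2 × Idx m) ∉ cellIdx m := by
  simp [mem_cellIdx]

lemma V2L_repr {w : V k m ⊗[k] VDual k m} (hw : w ∈ V2L k m) :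
    ∑ c ∈ cellIdx m, tensorCoord (lead c.1) c.2 w • (vec (lead c.1) ⊗ₜ[k] covec c.2) +
      tensorCoord (Sum.inl 1) (Sum.inr 0) w • (vec (Sum.inl 1) ⊗ₜ[k] covec (Sum.inr 0)) = w := by
  classical
  have e : ∀ w : V k m ⊗[k] VDual k m,
      ∑ c ∈ cellIdx m, tensorCoord (lead c.1) c.2 w • (vec (lead c.1) ⊗ₜ[k] covec c.2) +
      tensorCoord (Sum.inl 1) (Sum.inr 0) w • (vec (Sum.inl 1) ⊗ₜ[k] covec (Sum.inr 0)) =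
      ∑ c ∈ insert ((1, Sum.inr 0) : Fin 2 × Idx m) (cellIdx m),
        tensorCoord (lead c.1) c.2 w • ((vec (lead c.1) : V k m) ⊗ₜ[k] (covec c.2 : VDual k m)) := by
    intro w
    rw [Finset.sum_insert inr_zero_notMem_cellIdx, add_comm]
    rfl
  have key : V2L k m ≤ LinearMap.eqLocus
      (∑ c ∈ insert ((1, Sum.inr 0) : Fin 2 × Idx m) (cellIdx m),
        (tensorCoord (lead c.1) c.2 : Module.Dual k (V k m ⊗[k] VDual k m)).smulRight
          ((vec (lead c.1) : V k m) ⊗ₜ[k] (covec c.2 : VDual k m))) LinearMap.id := by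
    refine Submodule.map₂_le.2 fun v hv f hf => ?_
    rw [LinearMap.mem_eqLocus, LinearMap.sum_apply, TensorProduct.mk_apply, LinearMap.id_apply]
    simp only [LinearMap.smulRight_apply, tensorCoord_tmul]
    -- The sum may run over all index pairs: the additional terms evaluate f ∈ (V/V_2)^* at a basis
    -- vector of V_2.
    rw [Finset.sum_subset (Finset.subset_univ _)]
    · conv_rhs => rw [V2_sum hv, covec_sum f, TensorProduct.sum_tmul]
      rw [Fintype.sum_prod_type]
      refine Finset.sum_congr rfl fun c _ => ?_
      rw [TensorProduct.tmul_sum]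
      refine Finset.sum_congr rfl fun b _ => ?_
      rw [TensorProduct.smul_tmul_smul]
    · rintro ⟨c, b⟩ _ hb
      have : ∃ c', b = lead c' := by
        by_contra! hne
        have h0 : b ≠ Sum.inl 0 := hne 0
        have h1 : b ≠ Sum.inl 1 := hne 1
        refine hb (Finset.mem_insert.2 ?_)
        by_cases h : ((c, b) : Fin 2 × Idx m) = (1, Sum.inr 0)
        · exact Or.inl h
        · exact Or.inr (mem_cellIdx.2 ⟨h0, h1, h⟩)
      obtain ⟨c', rfl⟩ := this
      rw [apply_vec_of_mem_L hf, mul_zero, zero_smul]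
  have h := key hw
  rw [LinearMap.mem_eqLocus, LinearMap.sum_apply, LinearMap.id_apply] at h
  rw [e]
  exact h

variable (k m) in
/-- The frame of `V_2 ⊗ (V/V_2)^*` that belongs to the coordinates on the open cell. -/
def cellFrame : Frame k m (PairIdx m) (pairIdx m) where
  u := Sum.elim (fun c => vec (lead c.1) ⊗ₜ covec c.2) fun _ => 0
  φ := Sum.elim (fun c => tensorCoord (lead c.1) c.2) fun _ => 0
  e := vec (Sum.inl 1) ⊗ₜ covec (Sum.inr 0)
  ε := tensorCoord (Sum.inl 1) (Sum.inr 0)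
  φ_u_self := by
    intro i hi
    obtain ⟨c, hc, rfl⟩ := Finset.mem_map.1 hi
    simp [tensorCoord_tmul, vec_apply, covec_vec]
  φ_u_ne := by
    intro i hi j hj hij
    obtain ⟨c, hc, rfl⟩ := Finset.mem_map.1 hi
    obtain ⟨d, hd, rfl⟩ := Finset.mem_map.1 hj
    simp only [Function.Embedding.inl_apply, Sum.elim_inl, tensorCoord_tmul, vec_apply, covec_vec]
    by_cases h1 : c.1 = d.1
    · have h2 : d.2 ≠ c.2 := fun h => hij (by
        rw [Function.Embedding.inl_apply, Function.Embedding.inl_apply, Prod.ext h1 h.symm])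
      rw [if_neg h2, mul_zero]
    · rw [if_neg fun h => h1 (lead_injective h), zero_mul]
  φ_e := by
    intro i hi
    obtain ⟨c, hc, rfl⟩ := Finset.mem_map.1 hi
    simp only [Function.Embedding.inl_apply, Sum.elim_inl, tensorCoord_tmul, vec_apply, covec_vec]
    by_cases h1 : c.1 = 1
    · have h2 : Sum.inr 0 ≠ c.2 := fun h => (mem_cellIdx.1 hc).2.2 (Prod.ext h1 h.symm)
      rw [if_neg h2, mul_zero]
    · rw [if_neg fun h => h1 (lead_injective (h.trans rfl)), zero_mul]
  ε_e := by simp [tensorCoord_tmul, vec_apply, covec_vec]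
  u_mem := by
    intro i hi
    obtain ⟨c, hc, rfl⟩ := Finset.mem_map.1 hi
    exact tmul_mem_V2L (vec_lead_mem _)
      (covec_mem_L (mem_cellIdx.1 hc).1 (mem_cellIdx.1 hc).2.1)
  e_mem := tmul_mem_V2L vec_inl_mem_V2_one (covec_inr_mem_L 0)
  repr := by
    intro w hw
    rw [pairIdx, Finset.sum_map]
    exact V2L_repr hw

/-! #### The change of frame that straightens the cycle `t` -/

section

variable (z : PairIdx m → k)

/-- The slice through `(1, 1)`, up to the diagonal action of `G`. -/
def cellPair : G k m × G k m := (cellG (fun c => z (Sum.inl c)), 1)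

lemma ev_cellPair_tmul (v : V k m) (f : VDual k m) :
    ev (cellPair z) (v ⊗ₜ f) = f (act (cellG (fun c => z (Sum.inl c))) v) := by
  rw [ev_tmul]
  simp only [cellPair, inv_one, one_mul]

lemma ev_cellPair_u {c : Fin 2 × Idx m} (hc : c ∈ cellIdx m) :
    ev (cellPair z) (vec (lead c.1) ⊗ₜ covec c.2) = z (Sum.inl c) := by
  obtain ⟨h0, h1, h2⟩ := mem_cellIdx.1 hc
  obtain ⟨i, b⟩ := c
  rw [ev_cellPair_tmul]
  by_cases hi : i = 0
  · subst hi
    change covec b (act (cellG fun c => z (Sum.inl c)) (vec (Sum.inl 0))) = _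
    rw [act_cellG_zero]
    exact planeA_of_ne (fun c => z (Sum.inl c)) h0 h1
  · obtain rfl : i = 1 := by omega
    change covec b (act (cellG fun c => z (Sum.inl c)) (vec (Sum.inl 1))) = _
    rw [act_cellG_one]
    exact planeB_of_ne (fun c => z (Sum.inl c)) h0 h1 fun h => h2 (Prod.ext rfl h)

/-- Only the summand of t with x_{n+1} contributes, and there the coefficient of v_2 is the
v_1-coordinate of A, which is 1. Thus t can replace e in the frame on the whole cell. -/
lemma ε_cyc : (cellFrame k m).ε (cyc (cellPair z)) = 1 := by
  rw [cyc_eq_kap, eta, map_sum, map_sum, Finset.sum_eq_single_of_mem 0 (Finset.mem_univ _)]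
  · rw [kap_tmul, map_sub, map_smul, map_smul, ev_cellPair_tmul, ev_cellPair_tmul, act_cellG_zero,
      act_cellG_one]
    simp [cellFrame, tensorCoord_tmul, covec, planeA_inl_zero, vec]
  · intro i _ hi
    rw [kap_tmul, map_sub, map_smul, map_smul]
    simp [cellFrame, tensorCoord_tmul, covec_vec, hi]

/-- The linear automorphism `w ↦ w + a ε(w) (t - e)` of `V ⊗ V^*`. -/
def shear (a : k) : V k m ⊗[k] VDual k m →ₗ[k] V k m ⊗[k] VDual k m :=
  LinearMap.id + a • (cellFrame k m).ε.smulRight (cyc (cellPair z) - (cellFrame k m).e)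

lemma shear_apply (a : k) (w : V k m ⊗[k] VDual k m) : shear z a w =
    w + a • (cellFrame k m).ε w • (cyc (cellPair z) - (cellFrame k m).e) := rfl

lemma shear_mem (a : k) {w : V k m ⊗[k] VDual k m} (hw : w ∈ V2L k m) :
    shear z a w ∈ V2L k m :=
  add_mem hw (Submodule.smul_mem _ _ (Submodule.smul_mem _ _
    (sub_mem (cyc_mem_V2L _) (cellFrame k m).e_mem)))

/-- Since ε(t − e) = 0, the shears form a one-parameter group; in particular the parameters 1 and −1
give mutually inverse maps. -/
lemma shear_comp (a b : k) (w : V k m ⊗[k] VDual k m) :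
    shear z a (shear z b w) = shear z (a + b) w := by
  simp only [shear_apply, map_add, map_smul, map_sub, ε_cyc, (cellFrame k m).ε_e]
  module

lemma shear_e : shear z 1 (cellFrame k m).e = cyc (cellPair z) := by
  rw [shear_apply, (cellFrame k m).ε_e, one_smul, one_smul, add_sub_cancel]

/-- As ev(t) = 0, replacing e by t removes the nonlinear evaluation on e, and what remains is the
linear form with coefficients z_i. -/
lemma ev_shear {w : V k m ⊗[k] VDual k m} (hw : w ∈ V2L k m) :
    ev (cellPair z) (shear z 1 w) = (cellFrame k m).lin z w := by
  have h := congrArg (ev (cellPair z)) ((cellFrame k m).repr w hw)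
  rw [map_add, map_sum, map_smul] at h
  rw [shear_apply, one_smul, map_add, map_smul, map_sub, ev_cyc, Frame.lin, LinearMap.sum_apply,
    ← h, smul_eq_mul, smul_eq_mul, zero_sub, mul_neg, add_neg_cancel_right]
  refine Finset.sum_congr rfl fun i hi => ?_
  obtain ⟨c, hc, rfl⟩ := Finset.mem_map.1 hi
  rw [map_smul, LinearMap.smul_apply, smul_eq_mul, smul_eq_mul, mul_comm]
  congr 1
  exact ev_cellPair_u z hc

/-- The algebra automorphism of `Λ[T]` induced by `shear`. -/
def shearHom (a : k) : ExtT k m →ₐ[k] ExtT k m :=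
  Polynomial.mapAlgHom (ExteriorAlgebra.map (shear z a))

lemma shearHom_ι (a : k) (w : V k m ⊗[k] VDual k m) :
    shearHom z a (Polynomial.C (ExteriorAlgebra.ι k w)) =
      Polynomial.C (ExteriorAlgebra.ι k (shear z a w)) := by
  refine (Polynomial.map_C _).trans (congrArg _ ?_)
  exact ExteriorAlgebra.map_apply_ι _ _

lemma shearHom_X (a : k) : shearHom z a Polynomial.X = (Polynomial.X : ExtT k m) :=
  Polynomial.map_X _

lemma shearHom_comp (x : ExtT k m) {a b : k} (h : a + b = 0) :
    shearHom z a (shearHom z b x) = x := by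
  induction x using polyExt_induction with
  | algebraMap r => rw [AlgHom.commutes, AlgHom.commutes]
  | add x y hx hy => rw [map_add, map_add, hx, hy]
  | ι_mul u x hx =>
    rw [map_mul, map_mul, hx, shearHom_ι, shearHom_ι, shear_comp, h, shear_apply, zero_smul,
      add_zero]
  | X_mul x hx => rw [map_mul, map_mul, hx, shearHom_X, shearHom_X]

lemma shearHom_mem_M (a : k) {j : ℕ} {x : ExtT k m} (hx : x ∈ M k m j) :
    shearHom z a x ∈ M k m j := by
  refine M_induction (P := fun j x => shearHom z a x ∈ M k m j) ?_ ?_ ?_ ?_ ?_ hx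
  · intro j
    rw [map_zero]
    exact zero_mem _
  · intro r
    rw [AlgHom.commutes]
    exact algebraMap_mem_M r
  · intro j x y _ _ hx hy
    rw [map_add]
    exact add_mem hx hy
  · intro u hu j x _ hx
    rw [map_mul, shearHom_ι]
    exact ι_mul_mem_M (shear_mem z a hu) hx
  · intro j x _ hx
    rw [map_mul, shearHom_X]
    exact X_mul_mem_M hx

/-- Conjugation by the shear turns the differential into the model one, with T ↦ e constant and
contraction by ∑ z_i φ_i. -/
lemma diff_shearHom {j : ℕ} {x : ExtT k m} (hx : x ∈ M k m j) :
    diff (cellPair z) (shearHom z 1 x) =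
      shearHom z 1 (polyD ((cellFrame k m).lin z) (cellFrame k m).e x) := by
  rw [diff_eq_polyD, polyD_algHom (φ' := ev (cellPair z) ∘ₗ shear z 1) (t' := (cellFrame k m).e)
    (shearHom z 1) (shear z 1) (shearHom_ι z 1) rfl, polyD_congr _ (fun u hu => ev_shear z hu) hx]
  intro b
  rw [shearHom_X, polyD_X_mul, shear_e]

end

/-! ### Clearing denominators and solving the equation on the cell -/

lemma regG_cellPair (Ω : Set (PairIdx m → k)) :
    RegG (polyAff k (PairIdx m)) Ω (fun z => cellG (fun c => z (Sum.inl c))) :=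
  regG_cellG_comp _ Ω

lemma finReg_shearHom (a : k) (Ω : Set (PairIdx m → k)) (x : ExtT k m) :
    FinReg (polyAff k (PairIdx m)) Ω (fun z => shearHom z a x) := by
  refine finReg_algHom (ρ := fun z => shearHom z a) (fun u => ?_) ?_ x
  · have h1 : FinReg (polyAff k (PairIdx m)) Ω (fun z => cyc (cellPair z)) :=
      finReg_cyc (regG_cellPair Ω) (RegG.const 1)
    have h2 : FinReg (polyAff k (PairIdx m)) Ω (fun z => shear z a u) :=
      ((FinReg.const u).add ((h1.sub (FinReg.const (cellFrame k m).e)).map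
        (a • (cellFrame k m).ε u • LinearMap.id))).congr fun z _ => shear_apply z a u
    exact h2.C_ι.congr fun z _ => shearHom_ι z a u
  · exact (FinReg.const Polynomial.X).congr fun z _ => shearHom_X z a

lemma FinReg.shearHom {Ω : Set (PairIdx m → k)} {s : (PairIdx m → k) → ExtT k m}
    (hs : FinReg (polyAff k (PairIdx m)) Ω s) (a : k) :
    FinReg (polyAff k (PairIdx m)) Ω (fun z => shearHom z a (s z)) :=
  hs.bind (fun z => (SymplecticDiagonal.shearHom z a).toLinearMap) fun x => finReg_shearHom a Ω x

lemma exists_polyM_of_finReg {σ : Type*} {Ω : Set (σ → k)} (hΩ : IsZariskiOpen (polyAff k σ) Ω)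
    {z₀ : σ → k} (hz₀ : z₀ ∈ Ω) {j : ℕ} {s : (σ → k) → ExtT k m}
    (hs : FinReg (polyAff k σ) Ω s) (hM : ∀ z ∈ Ω, s z ∈ M k m j) :
    ∃ q : MvPolynomial σ k, ∃ f ∈ polyM k m σ j, MvPolynomial.eval z₀ q ≠ 0 ∧
      ∀ z, MvPolynomial.eval z q ≠ 0 → z ∈ Ω ∧ evalMap z f = MvPolynomial.eval z q • s z := by
  obtain ⟨q, f, hq, hf⟩ := hs.exists_evalMap hz₀
  obtain ⟨a, ⟨r, hr⟩, ha, haΩ⟩ := hΩ z₀ hz₀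
  -- Projecting to M_j makes the polynomial map M_j-valued everywhere without changing it over Ω.
  -- The factor r ensures that nonvanishing of the denominator places z in Ω.
  obtain ⟨π, hπ⟩ := LinearMap.exists_leftInverse_of_injective (M k m j).subtype
    (Submodule.ker_subtype _)
  let π' : ExtT k m →ₗ[k] ExtT k m := (M k m j).subtype ∘ₗ π
  have hπ' : ∀ x ∈ M k m j, π' x = x := fun x hx =>
    congrArg Subtype.val (LinearMap.congr_fun hπ ⟨x, hx⟩)
  have hmem : ∀ g : MvPolynomial σ k ⊗[k] ExtT k m,
      TensorProduct.map (LinearMap.mulLeft k r) π' g ∈ polyM k m σ j := by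
    intro g
    induction g with
    | zero => rw [map_zero]; exact zero_mem _
    | add x y hx hy => rw [map_add]; exact add_mem hx hy
    | tmul p x => exact tmul_mem_polyM _ (π x).2
  have hev : ∀ z, ∀ g : MvPolynomial σ k ⊗[k] ExtT k m,
      evalMap z (TensorProduct.map (LinearMap.mulLeft k r) π' g) =
        MvPolynomial.eval z r • π' (evalMap z g) := by
    intro z g
    induction g with
    | zero => simp only [map_zero, smul_zero]
    | add x y hx hy => simp only [map_add, hx, hy, smul_add]
    | tmul p x =>
      rw [TensorProduct.map_tmul, evalMap_tmul, evalMap_tmul, LinearMap.mulLeft_apply, map_mul,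
        map_smul, mul_smul]
  refine ⟨r * q, _, hmem f, ?_, fun z hz => ?_⟩
  · rw [map_mul, ← hr]
    exact mul_ne_zero ha hq
  · rw [map_mul, mul_ne_zero_iff] at hz
    have hzΩ : z ∈ Ω := haΩ z (by rw [hr]; exact hz.1)
    refine ⟨hzΩ, ?_⟩
    rw [hev, hf z hzΩ hz.2, map_smul, hπ' _ (hM z hzΩ), map_mul, mul_smul]

lemma isZariskiOpen_eval_ne_zero {σ : Type*} (q : MvPolynomial σ k) :
    IsZariskiOpen (polyAff k σ) {z | MvPolynomial.eval z q ≠ 0} :=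
  fun _ hy => ⟨_, ⟨q, fun _ => rfl⟩, hy, fun _ hz => hz⟩

/-- Lifting a polynomial primitive through the change of frame. -/
lemma exists_primitive_of_modelD {j : ℕ} {s : (PairIdx m → k) → ExtT k m}
    (q : MvPolynomial (PairIdx m) k) {b : MvPolynomial (PairIdx m) k ⊗[k] ExtT k m}
    (hb : b ∈ polyM k m (PairIdx m) j)
    (h : ∀ z, MvPolynomial.eval z q ≠ 0 → evalMap z ((cellFrame k m).modelD b) =
      MvPolynomial.eval z q • shearHom z (-1) (s z)) :
    ∃ s₀ : (PairIdx m → k) → ExtT k m,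
      FinReg (polyAff k (PairIdx m)) {z | MvPolynomial.eval z q ≠ 0} s₀ ∧
      (∀ z, s₀ z ∈ M k m j) ∧
      ∀ z, MvPolynomial.eval z q ≠ 0 → diff (cellPair z) (s₀ z) = s z := by
  refine ⟨fun z => (MvPolynomial.eval z q)⁻¹ • shearHom z 1 (evalMap z b), ?_, fun z => ?_,
    fun z hz => ?_⟩
  · exact ((finReg_evalMap b _).shearHom 1).smul
      (regAlg_inv (eval_mem_regAlg q _) fun z hz => hz)
  · exact Submodule.smul_mem _ _ (shearHom_mem_M z 1 (evalMap_mem_M z hb))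
  · rw [map_smul, diff_shearHom z (evalMap_mem_M z hb), ← Frame.evalMap_modelD, h z hz, map_smul,
      smul_smul, inv_mul_cancel₀ hz, one_smul, shearHom_comp z _ (add_neg_cancel 1)]

theorem exists_primitive_cell [CharZero k] {Ω : Set (PairIdx m → k)}
    (hΩ : IsZariskiOpen (polyAff k (PairIdx m)) Ω) (h0 : 0 ∈ Ω) {j : ℕ}
    {s : (PairIdx m → k) → ExtT k m} (hs : FinReg (polyAff k (PairIdx m)) Ω s)
    (hM : ∀ z ∈ Ω, s z ∈ M k m (j + 1)) (hd : ∀ z ∈ Ω, diff (cellPair z) (s z) = 0) :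
    ∃ Ω', IsZariskiOpen (polyAff k (PairIdx m)) Ω' ∧ 0 ∈ Ω' ∧
      ∃ s₀ : (PairIdx m → k) → ExtT k m, FinReg (polyAff k (PairIdx m)) Ω' s₀ ∧
        (∀ z ∈ Ω', s₀ z ∈ M k m (j + 2)) ∧ ∀ z ∈ Ω', diff (cellPair z) (s₀ z) = s z := by
  obtain ⟨q, f, hf, hq, hqf⟩ := exists_polyM_of_finReg hΩ h0 (hs.shearHom (-1))
    (fun z hz => shearHom_mem_M z (-1) (hM z hz))
  have hcyc : ∀ z ∈ Ω, polyD ((cellFrame k m).lin z) (cellFrame k m).e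
      (shearHom z (-1) (s z)) = 0 := by
    intro z hz
    have h := diff_shearHom z (shearHom_mem_M z (-1) (hM z hz))
    rw [shearHom_comp z _ (add_neg_cancel 1), hd z hz] at h
    have h' := congrArg (shearHom z (-1)) h
    rw [shearHom_comp z _ (neg_add_cancel 1), map_zero] at h'
    exact h'.symm
  -- The polynomial map f is known to be a cycle only where q ≠ 0. Multiplying by q once more makes
  -- it a cycle at every point, whence the denominator q² below.
  obtain ⟨b, hb, hbf⟩ := (cellFrame k m).exists_modelD_eq (map_mulLeft_mem_polyM q hf)
    (evalMap_ext fun z => by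
      rw [Frame.evalMap_modelD, evalMap_mul, map_smul]
      by_cases hz : MvPolynomial.eval z q = 0
      · rw [hz, zero_smul]
      · rw [(hqf z hz).2, map_smul, hcyc z (hqf z hz).1, smul_zero, smul_zero])
  obtain ⟨s₀, h1, h2, h3⟩ := exists_primitive_of_modelD (s := s) (q * q) hb (fun z hz => by
    rw [map_mul, mul_ne_zero_iff] at hz
    rw [hbf, evalMap_mul, (hqf z hz.1).2, map_mul, mul_smul])
  refine ⟨_, isZariskiOpen_eval_ne_zero (q * q), ?_, s₀, h1, fun z _ => h2 z, h3⟩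
  change MvPolynomial.eval 0 (q * q) ≠ 0
  rw [map_mul]
  exact mul_ne_zero hq hq

theorem exists_primitive_cell_zero [CharZero k] {Ω : Set (PairIdx m → k)}
    (hΩ : IsZariskiOpen (polyAff k (PairIdx m)) Ω) (h0 : 0 ∈ Ω)
    {s : (PairIdx m → k) → ExtT k m} (hs : FinReg (polyAff k (PairIdx m)) Ω s)
    (hM : ∀ z ∈ Ω, s z ∈ M k m 0)
    (hd : ∀ z ∈ Ω, (∀ i ∈ pairIdx m, z i = 0) → s z = 0) :
    ∃ Ω', IsZariskiOpen (polyAff k (PairIdx m)) Ω' ∧ 0 ∈ Ω' ∧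
      ∃ s₀ : (PairIdx m → k) → ExtT k m, FinReg (polyAff k (PairIdx m)) Ω' s₀ ∧
        (∀ z ∈ Ω', s₀ z ∈ M k m 1) ∧ ∀ z ∈ Ω', diff (cellPair z) (s₀ z) = s z := by
  let ℓ : ExtT k m →ₗ[k] k := ExteriorAlgebra.algebraMapInv.toLinearMap ∘ₗ
    (Polynomial.lcoeff (Ext k m) 0).restrictScalars k
  have hℓ : ∀ x ∈ M k m 0, x = algebraMap k (ExtT k m) (ℓ x) := fun x hx =>
    eq_algebraMap_of_mem_M hx
  obtain ⟨q, f, hf, hq, hqf⟩ := exists_polyM_of_finReg hΩ h0 hs hM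
  obtain ⟨r, hr⟩ : ∃ r : MvPolynomial (PairIdx m) k, ∀ z, MvPolynomial.eval z r =
      ℓ (evalMap z f) := by
    clear hqf hf
    induction f with
    | zero => exact ⟨0, fun z => by simp only [map_zero]⟩
    | add x y hx hy =>
      obtain ⟨r, hr⟩ := hx
      obtain ⟨r', hr'⟩ := hy
      exact ⟨r + r', fun z => by rw [map_add, map_add, map_add, hr, hr']⟩
    | tmul p x =>
      refine ⟨MvPolynomial.C (ℓ x) * p, fun z => ?_⟩
      rw [evalMap_tmul, map_smul, map_mul, MvPolynomial.eval_C, smul_eq_mul, mul_comm]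
  -- Where the coordinates in `pairIdx m` vanish, either q = 0 or s = 0, so q·r vanishes there
  -- without restriction on z.
  obtain ⟨b, hb, hbf⟩ := (cellFrame k m).exists_modelD_eq_tmul_one (r := q * r) (fun z hz => by
    rw [map_mul]
    by_cases hqz : MvPolynomial.eval z q = 0
    · rw [hqz, zero_mul]
    · rw [hr, (hqf z hqz).2, hd z (hqf z hqz).1 hz, smul_zero, map_zero, mul_zero])
  obtain ⟨s₀, h1, h2, h3⟩ := exists_primitive_of_modelD (s := s) (q * q) hb (fun z hz => by
    rw [map_mul, mul_ne_zero_iff] at hz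
    have hs' := hℓ _ (hM z (hqf z hz.1).1)
    rw [hbf, evalMap_tmul, map_mul, map_mul, hr, (hqf z hz.1).2, map_smul, hs', AlgHom.commutes,
      ← hs', smul_eq_mul, ← mul_assoc, mul_smul]
    congr 1
    conv_rhs => rw [hs', Algebra.algebraMap_eq_smul_one]
    rw [map_one])
  refine ⟨_, isZariskiOpen_eval_ne_zero (q * q), ?_, s₀, h1, fun z _ => h2 z, h3⟩
  change MvPolynomial.eval 0 (q * q) ≠ 0
  rw [map_mul]
  exact mul_ne_zero hq hq

end CellFrame

/-! ### The resolution of the diagonal -/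

section Resolution

variable {k : Type*} [Field k] {m : ℕ}

lemma M_ne_bot (j : ℕ) : M k m j ≠ ⊥ := by
  obtain ⟨a, ha, ha0⟩ : ∃ a ∈ M k m j, a ≠ 0 := by
    -- The witnesses are 1 in degree 0 and e in degree 1; multiplication by T is injective and
    -- raises the degree by 2.
    induction j using Nat.twoStepInduction with
    | zero => exact ⟨_, algebraMap_mem_M 1, by rw [map_one]; exact one_ne_zero⟩
    | one =>
      refine ⟨_, ι_mul_mem_M (cellFrame k m).e_mem (algebraMap_mem_M 1), ?_⟩
      rw [map_one, mul_one]
      intro h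
      have h0 := (ExteriorAlgebra.ι_inj k _ _).1 ((Polynomial.C_eq_zero.1 h).trans (map_zero _).symm)
      have h1 := (cellFrame k m).ε_e
      rw [h0, map_zero] at h1
      exact zero_ne_one h1
    | more j ih _ =>
      obtain ⟨a, ha, ha0⟩ := ih
      refine ⟨_, X_mul_mem_M ha, fun h => ha0 ?_⟩
      ext1 i
      rw [← Polynomial.coeff_X_mul, h, Polynomial.coeff_zero, Polynomial.coeff_zero]
  exact fun h => ha0 ((Submodule.mem_bot k).1 (h ▸ ha))

variable (k m) in
/-- The projection of `Λ[T]` to its part of degree `0`. -/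
def augLin : ExtT k m →ₗ[k] k := ExteriorAlgebra.algebraMapInv.toLinearMap ∘ₗ
  (Polynomial.lcoeff (Ext k m) 0).restrictScalars k

lemma augLin_apply (x : ExtT k m) :
    augLin k m x = ExteriorAlgebra.algebraMapInv (x.coeff 0) := rfl

lemma eq_algebraMap_augLin {x : ExtT k m} (hx : x ∈ M k m 0) :
    x = algebraMap k (ExtT k m) (augLin k m x) := eq_algebraMap_of_mem_M hx

lemma augLin_algebraMap (r : k) : augLin k m (algebraMap k (ExtT k m) r) = r := by
  rw [augLin_apply, Polynomial.algebraMap_apply, Polynomial.coeff_C_zero]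
  exact ExteriorAlgebra.algebraMap_leftInverse _ r

lemma aug_apply (s : G k m × G k m → ExtT k m) (g : G k m) : aug s g = augLin k m (s (g, g)) := rfl

lemma ev_eq_zero {y : G k m × G k m} (h : y.2⁻¹ * y.1 ∈ P k m) {w : V k m ⊗[k] VDual k m}
    (hw : w ∈ V2L k m) : ev y w = 0 := by
  have : V2L k m ≤ LinearMap.ker (ev y) := by
    refine Submodule.map₂_le.2 fun v hv f hf => ?_
    rw [LinearMap.mem_ker, TensorProduct.mk_apply, ev_tmul]
    exact (Submodule.mem_dualAnnihilator f).1 hf _ (act_mem_V2 h hv)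
  exact this hw

/-- If ev vanishes on all v ⊗ x_a with v in V_2 and a ≠ 1, 2, then h⁻¹g maps V_2 into itself. So ev
cuts out the diagonal. -/
lemma exists_ev_ne_zero {y : G k m × G k m} (h : y.2⁻¹ * y.1 ∉ P k m) :
    ∃ w ∈ V2L k m, ev y w ≠ 0 := by
  by_contra! hcon
  have key : ∀ v ∈ V2 k m, act (y.2⁻¹ * y.1) v ∈ V2 k m := fun v hv =>
    mem_V2_iff.2 fun a h0 h1 => by
      have := hcon _ (tmul_mem_V2L hv (covec_mem_L h0 h1))
      rwa [ev_tmul] at this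
  exact h (mem_P_of_mem (key _ vec_inl_mem_V2_zero) (key _ vec_inl_mem_V2_one))

/-- Over the diagonal ev vanishes on V_2 ⊗ (V/V_2)^*, and an element of M_1 contains no T, so t does
not enter either. -/
lemma augLin_diff {y : G k m × G k m} (h : y.2⁻¹ * y.1 ∈ P k m) {a : ExtT k m}
    (ha : a ∈ M k m 1) : augLin k m (diff y a) = 0 := by
  rw [diff_eq_polyD, polyD_congr (φ' := 0) _ (fun u hu => ev_eq_zero h hu) ha, augLin_apply,
    polyD_coeff, map_zero, LinearMap.zero_apply, (mem_M.1 ha (0 + 1)).2 (by norm_num), mul_zero,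
    smul_zero, add_zero, map_zero]

lemma cellG_eq_one {z : Fin 2 × Idx m → k} (h : ∀ c ∈ cellIdx m, z c = 0) : cellG z = 1 := by
  have hA : planeA z = planeA 0 := by
    funext j
    by_cases h0 : j = Sum.inl 0
    · simp only [planeA, if_pos h0]
    by_cases h1 : j = Sum.inl 1
    · simp only [planeA, if_neg h0, if_pos h1]
    rw [planeA_of_ne z h0 h1, planeA_of_ne 0 h0 h1]
    exact h _ (mem_cellIdx.2 ⟨h0, h1, by simp⟩)
  have hB' : planeB' z = planeB' 0 := by
    funext j
    by_cases h0 : j = Sum.inl 0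
    · simp only [planeB', if_pos h0]
    by_cases h1 : j = Sum.inl 1
    · simp only [planeB', if_neg h0, if_pos h1]
    by_cases h2 : j = Sum.inr 0
    · simp only [planeB', if_neg h0, if_neg h1, if_pos h2]
    simp only [planeB', if_neg h0, if_neg h1, if_neg h2]
    exact h _ (mem_cellIdx.2 ⟨h0, h1, fun he => h2 (Prod.ext_iff.1 he).2⟩)
  refine eq_one_of_act _ fun x => ?_
  rw [act_cellG, planeB, hA, hB', ← planeB, ← act_cellG, cellG_zero, act_one, LinearMap.id_apply]

theorem IsSection.diff [CharZero k] {j : ℕ} {U : Set (SpGr k m × SpGr k m)}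
    {s : G k m × G k m → ExtT k m} (hs : IsSection (j + 1) U s) :
    IsSection j U (fun y => diff y (s y)) where
  mem y hy := diff_mem_M y (hs.mem y hy)
  regular := (finReg_diff (regG_fst _) (regG_snd _) hs.finReg).isRegularOn
  equivariant y hy p hp q hq := by
    rw [rho_eq, ← diff_rhoHom y hp, ← rho_eq, hs.equivariant y hy p hp q hq]

lemma augLin_rho {p q : G k m} {x : ExtT k m} (hx : x ∈ M k m 0) :
    augLin k m (rho p q x) = augLin k m x := by
  rw [eq_algebraMap_augLin hx, rho_eq, AlgHom.commutes]

theorem IsSection.aug {U : Set (SpGr k m × SpGr k m)} {s : G k m × G k m → ExtT k m}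
    (hs : IsSection 0 U s) : IsSectionDiag U (aug s) where
  regular :=
    ((hs.finReg.comp (ψ := fun g : G k m => (g, g)) (Ω := preimDiag U)
      (comp_mem_of_regG (regG_id _) (regG_id _)) fun _ hg => hg).map (augLin k m)).isRegularOn
  invariant g hg p hp := by
    have hgp : (g * p, g * p) ∈ preim U := (preim_mul (y := (g, g)) hp hp).2 hg
    rw [aug_apply, aug_apply, ← augLin_rho (hs.mem _ hgp)]
    exact congrArg _ (hs.equivariant (g, g) hg p hp p hp)

/-- Off the diagonal the complex is locally contractible. -/
theorem exists_primitive_off_diagonal [CharZero k] {g₀ h₀ : G k m} (h : h₀⁻¹ * g₀ ∉ P k m) {i : ℕ}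
    {U : Set (SpGr k m × SpGr k m)} (hU : IsOpenXX U) (hx : (orbit g₀, orbit h₀) ∈ U)
    {s : G k m × G k m → ExtT k m} (hs : IsSection i U s)
    (hd : ∀ y ∈ preim U, SymplecticDiagonal.diff y (s y) = 0) :
    ∃ U', IsOpenXX U' ∧ (orbit g₀, orbit h₀) ∈ U' ∧ U' ⊆ U ∧ ∃ s', IsSection (i + 1) U' s' ∧
      ∀ y ∈ preim U', SymplecticDiagonal.diff y (s' y) = s y := by
  obtain ⟨w, hw, hne⟩ := exists_ev_ne_zero (y := (g₀, h₀)) h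
  have hev := fun Ω => reg_ev (regG_sliceMap_fst g₀ h₀ Ω) (regG_sliceMap_snd g₀ h₀ Ω) w
  have hopen := (isZariskiOpen_preimage_sliceMap g₀ h₀ hU).ne_zero (hev _)
  refine exists_primitive_of_slice g₀ h₀ hU hx hopen ?_
    -- The choice is w·s/ev(w): from d(w·s) = ev(w) s − w·ds and ds = 0 its differential is s.
    (s₀ := fun z => (ev (sliceMap g₀ h₀ z) w)⁻¹ •
      (Polynomial.C (ExteriorAlgebra.ι k w) * s (sliceMap g₀ h₀ z))) ?_ ?_ hs ?_
  · refine ⟨?_, ?_⟩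
    · change sliceMap g₀ h₀ 0 ∈ preim U
      rw [sliceMap_zero]
      exact hx
    · change ev (sliceMap g₀ h₀ 0) w ≠ 0
      rw [sliceMap_zero]
      exact hne
  · exact ((FinReg.const _).mul ((hs.finReg.comp_sliceMap g₀ h₀).mono fun z hz => hz.1)).smul
      (regAlg_inv (hev _) fun z hz => hz.2)
  · exact fun z hz => Submodule.smul_mem _ _ (ι_mul_mem_M hw (hs.mem _ hz.1))
  · intro z hz hzU
    have h0 := hd _ hzU
    rw [diff_eq_polyD] at h0
    rw [map_smul, diff_eq_polyD, polyD_ι_mul, h0, mul_zero, sub_zero, smul_smul,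
      inv_mul_cancel₀ hz.2, one_smul]

lemma diff_sliceMap_diagonal (g₀ : G k m) (z : PairIdx m → k) :
    diff (sliceMap g₀ g₀ z) = diff (cellPair z) := by
  refine diff_congr ?_
  rw [sliceMap_inv_mul, inv_mul_cancel, one_mul, cellPair, inv_one, one_mul]

theorem exists_primitive_of_diff_eq_zero [CharZero k] {j : ℕ} {U : Set (SpGr k m × SpGr k m)}
    (hU : IsOpenXX U) {s : G k m × G k m → ExtT k m} (hs : IsSection (j + 1) U s)
    (hd : ∀ y ∈ preim U, diff y (s y) = 0) {x : SpGr k m × SpGr k m} (hx : x ∈ U) :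
    ∃ U', IsOpenXX U' ∧ x ∈ U' ∧ U' ⊆ U ∧ ∃ s', IsSection (j + 2) U' s' ∧
      ∀ y ∈ preim U', diff y (s' y) = s y := by
  obtain ⟨x₁, x₂⟩ := x
  obtain ⟨g₀, rfl⟩ := orbit_surjective x₁
  by_cases h : orbit g₀ = x₂
  · subst h
    have h0 : (0 : PairIdx m → k) ∈ {z | sliceMap g₀ g₀ z ∈ preim U} := by
      change sliceMap g₀ g₀ 0 ∈ preim U
      rw [sliceMap_zero]
      exact hx
    obtain ⟨Ω, hΩ, hΩ0, s₀, h1, h2, h3⟩ := exists_primitive_cell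
      (isZariskiOpen_preimage_sliceMap g₀ g₀ hU) h0 (hs.finReg.comp_sliceMap g₀ g₀)
      (fun z hz => hs.mem _ hz) fun z hz => by rw [← diff_sliceMap_diagonal g₀, hd _ hz]
    exact exists_primitive_of_slice g₀ g₀ hU hx hΩ hΩ0 h1 h2 hs fun z hz _ => by
      rw [diff_sliceMap_diagonal, h3 z hz]
  · obtain ⟨h₀, rfl⟩ := orbit_surjective x₂
    exact exists_primitive_off_diagonal (fun hP => h (orbit_eq_iff.2 hP).symm) hU hx hs hd

theorem exists_primitive_of_aug_eq_zero [CharZero k] {U : Set (SpGr k m × SpGr k m)}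
    (hU : IsOpenXX U) {s : G k m × G k m → ExtT k m} (hs : IsSection 0 U s)
    (hd : ∀ g ∈ preimDiag U, aug s g = 0) {x : SpGr k m × SpGr k m} (hx : x ∈ U) :
    ∃ U', IsOpenXX U' ∧ x ∈ U' ∧ U' ⊆ U ∧ ∃ s', IsSection 1 U' s' ∧
      ∀ y ∈ preim U', diff y (s' y) = s y := by
  obtain ⟨x₁, x₂⟩ := x
  obtain ⟨g₀, rfl⟩ := orbit_surjective x₁
  by_cases h : orbit g₀ = x₂
  · subst h
    have h0 : (0 : PairIdx m → k) ∈ {z | sliceMap g₀ g₀ z ∈ preim U} := by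
      change sliceMap g₀ g₀ 0 ∈ preim U
      rw [sliceMap_zero]
      exact hx
    obtain ⟨Ω, hΩ, hΩ0, s₀, h1, h2, h3⟩ := exists_primitive_cell_zero
      (isZariskiOpen_preimage_sliceMap g₀ g₀ hU) h0 (hs.finReg.comp_sliceMap g₀ g₀)
      (fun z hz => hs.mem _ hz) fun z hz hz0 => by
        -- Slice points with vanishing first block lie over the diagonal and have equal components,
        -- so s there is the value of `aug s`, which is zero.
        have hz1 : cellG (fun c => z (Sum.inl c)) = 1 :=
          cellG_eq_one fun c hc => hz0 _ (Finset.mem_map_of_mem _ hc)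
        have hz2 : sliceMap g₀ g₀ z = ((sliceMap g₀ g₀ z).2, (sliceMap g₀ g₀ z).2) := by
          simp only [sliceMap, hz1, inv_mul_cancel, mul_one]
        have hz' : sliceMap g₀ g₀ z ∈ preim U := hz
        rw [eq_algebraMap_augLin (hs.mem _ hz'), hz2, ← aug_apply, hd _ (by rw [hz2] at hz'; exact hz'),
          map_zero]
    exact exists_primitive_of_slice g₀ g₀ hU hx hΩ hΩ0 h1 h2 hs fun z hz _ => by
      rw [diff_sliceMap_diagonal, h3 z hz]
  · obtain ⟨h₀, rfl⟩ := orbit_surjective x₂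
    exact exists_primitive_off_diagonal (fun hP => h (orbit_eq_iff.2 hP).symm) hU hx hs
      fun y hy => polyD_eq_zero_of_mem_M_zero _ _ (hs.mem y hy)

lemma aug_eq_zero_of_exists_primitive {U : Set (SpGr k m × SpGr k m)}
    {s : G k m × G k m → ExtT k m}
    (h : ∀ x ∈ U, ∃ U', IsOpenXX U' ∧ x ∈ U' ∧ U' ⊆ U ∧ ∃ s', IsSection 1 U' s' ∧
      ∀ y ∈ preim U', diff y (s' y) = s y) {g : G k m} (hg : g ∈ preimDiag U) : aug s g = 0 := by
  obtain ⟨U', -, hx, -, s', hs', hd⟩ := h _ hg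
  rw [aug_apply, ← hd (g, g) hx]
  refine augLin_diff ?_ (hs'.mem _ hx)
  rw [inv_mul_cancel]
  exact one_mem_P

/-- Near a diagonal point φ is extended to (g, h) ↦ φ(h), on the part of U where (hP, hP) lies in U.
Near any other point 0 will do, on a neighbourhood that misses the diagonal. -/
theorem exists_aug_eq [CharZero k] {U : Set (SpGr k m × SpGr k m)} (hU : IsOpenXX U)
    {φ : G k m → k} (hφ : IsSectionDiag U φ) {x : SpGr k m × SpGr k m} (hx : x ∈ U) :
    ∃ U', IsOpenXX U' ∧ x ∈ U' ∧ U' ⊆ U ∧ ∃ s, IsSection 0 U' s ∧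
      ∀ g ∈ preimDiag U', aug s g = φ g := by
  obtain ⟨x₁, x₂⟩ := x
  obtain ⟨g₀, rfl⟩ := orbit_surjective x₁
  by_cases h : orbit g₀ = x₂
  · subst h
    have hsnd : preim {x : SpGr k m × SpGr k m | x ∈ U ∧ (x.2, x.2) ∈ U} ⊆
        {y | y.2 ∈ preimDiag U} := fun y hy => hy.2
    refine ⟨{x | x ∈ U ∧ (x.2, x.2) ∈ U}, ?_, ⟨hx, hx⟩, fun x hx => hx.1,
      fun y => algebraMap k _ (φ y.2), ⟨fun y _ => algebraMap_mem_M _, ?_, ?_⟩,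
      fun g _ => augLin_algebraMap _⟩
    · exact hU.preimage (ψ := fun y => (y.2, y.2)) (comp_mem_of_regG (regG_snd _) (regG_snd _)) hU
    · refine FinReg.isRegularOn (FinReg.congr (FinReg.smul_const (regAlg_comp
        (comp_mem_of_regG' (regG_snd _)) hsnd (hφ.regular LinearMap.id)) 1) fun y _ => ?_)
      rw [Algebra.algebraMap_eq_smul_one, LinearMap.id_apply]
    · intro y hy p _ q hq
      rw [rho_eq, AlgHom.commutes]
      exact congrArg _ (hφ.invariant _ hy.2 q hq)
  · obtain ⟨h₀, rfl⟩ := orbit_surjective x₂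
    obtain ⟨w, hw, hne⟩ := exists_ev_ne_zero (y := (g₀, h₀))
      fun hP => h (orbit_eq_iff.2 hP).symm
    have hopen := (isZariskiOpen_univ (A := polyAff k (PairIdx m))).ne_zero
      (reg_ev (regG_sliceMap_fst g₀ h₀ _) (regG_sliceMap_snd g₀ h₀ _) w)
    obtain ⟨U', hU', hx', hsub, s, hs, h'⟩ := exists_section_of_slice g₀ h₀ hU hx hopen
      ⟨Set.mem_univ _, by rw [sliceMap_zero]; exact hne⟩ (FinReg.const 0)
      fun _ _ => zero_mem (M k m 0)
    refine ⟨U', hU', hx', hsub, s, hs, fun g hg => ?_⟩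
    obtain ⟨p, hp, q, hq, z, hz, hyz, -⟩ := h' (g, g) hg
    -- A diagonal point over U' would have a slice representative with ev(w) ≠ 0, whereas ev
    -- vanishes over the diagonal.
    refine absurd (ev_eq_zero ?_ hw) hz.2
    rw [← hyz]
    change (g * q)⁻¹ * (g * p) ∈ P k m
    rw [mul_inv_rev, mul_assoc, inv_mul_cancel_left]
    exact mul_mem_P (inv_mem_P hq) hp

end Resolution

end SymplecticDiagonal

end

open SymplecticDiagonal in
theorem theorem2p19 (k : Type*) [Field k] [IsAlgClosed k] [CharZero k] (m : ℕ) :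
    -- the fibres `M_j` of the bundles `Φ_j` are non-zero for all `j`: `D` does not terminate
    (∀ j, M k m j ≠ ⊥) ∧
    -- `d` is a map of sheaves `Φ_{j+1} → Φ_j`
    (∀ j U, IsOpenXX U → ∀ s, IsSection (k := k) (m := m) (j + 1) U s →
      IsSection j U (fun y => diff y (s y))) ∧
    -- `D` is a complex
    (∀ j U, IsOpenXX U → ∀ s, IsSection (k := k) (m := m) (j + 2) U s →
      ∀ y ∈ preim U, diff y (diff y (s y)) = 0) ∧
    -- exactness at `Φ_j` for `j ≥ 1`
    (∀ j U, IsOpenXX U → ∀ s, IsSection (k := k) (m := m) (j + 1) U s →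
      (∀ y ∈ preim U, diff y (s y) = 0) →
      ∀ x ∈ U, ∃ U', IsOpenXX U' ∧ x ∈ U' ∧ U' ⊆ U ∧
        ∃ s', IsSection (j + 2) U' s' ∧ ∀ y ∈ preim U', diff y (s' y) = s y) ∧
    -- restriction to the diagonal is a map of sheaves `Φ_0 = O_{X × X} → O_Δ`
    (∀ U, IsOpenXX U → ∀ s, IsSection (k := k) (m := m) 0 U s → IsSectionDiag U (aug s)) ∧
    -- its kernel is the image of `d : Φ_1 → Φ_0`
    (∀ U, IsOpenXX U → ∀ s, IsSection (k := k) (m := m) 0 U s →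
      ((∀ g ∈ preimDiag U, aug s g = 0) ↔
        ∀ x ∈ U, ∃ U', IsOpenXX U' ∧ x ∈ U' ∧ U' ⊆ U ∧
          ∃ s', IsSection 1 U' s' ∧ ∀ y ∈ preim U', diff y (s' y) = s y)) ∧
    -- it is surjective as a map of sheaves
    (∀ U, IsOpenXX U → ∀ φ, IsSectionDiag (k := k) (m := m) U φ →
      ∀ x ∈ U, ∃ U', IsOpenXX U' ∧ x ∈ U' ∧ U' ⊆ U ∧
        ∃ s, IsSection 0 U' s ∧ ∀ g ∈ preimDiag U', aug s g = φ g) := by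
  refine ⟨M_ne_bot, fun j U _ s hs => hs.diff, fun j U _ s _ y _ => diff_diff y (s y),
    fun j U hU s hs hd x hx => exists_primitive_of_diff_eq_zero hU hs hd hx,
    fun U _ s hs => hs.aug, fun U hU s hs => ⟨fun hd x hx => ?_, fun h g hg => ?_⟩,
    fun U hU φ hφ x hx => exists_aug_eq hU hφ hx⟩
  · exact exists_primitive_of_aug_eq_zero hU hs hd hx
  · exact aug_eq_zero_of_exists_primitive h hg
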